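/- Let $P\subset\mathbb R^d$ be a parallelohedron, that is, a $d$-dimensional convex polytope whose translates tile $\mathbb R^d$ face-to-face (distinct cells have disjoint interiors, and the intersection of any two cells is empty or a common face of both). Let $\mathcal T_P$ be a face-to-face tiling of $\mathbb R^d$ by translates of $P$. A *Voronoi parallelohedron* is the Dirichlet domain $\{x\in\mathbb R^d:\ \|x-p\|\le\|x-q\|\ \text{for all } q\in\Lambda\}$ of a point $p$ of some $d$-dimensional lattice $\Lambda\subset\mathbb R^d$. The Voronoi conjecture *holds for $P$* if some invertible affine transformation of $\mathbb R^d$ maps $P$ onto a Voronoi parallelohedron. A *canonical scaling* of $\mathcal T_P$ is a function $s$ that assigns a positive real number to each $(d-1)$-face of the tiling such that for every $(d-2)$-face $G$ of the tiling $$\sum_{i=1}^{k}s(F_i)\,\mathbf n_i=0,$$ where $F_1,\dots,F_k$ are all the $(d-1)$-faces of the tiling that contain $G$, and $\mathbf n_i$ is the unit normal to $F_i$ that points in the direction of traversal when one goes around $G$ in one of the two possible directions, the same for all $i$ (the choice of this direction only affects the sign of the sum). Then the Voronoi conjecture holds for $P$ if and only if $\mathcal T_P$ has a canonical scaling. -/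

import Mathlib

open scoped Pointwise

/-- A `d`-dimensional convex polytope in `ℝ^d`: the convex hull of a finite set of points,
with nonempty interior. -/
def IsFullDimPolytope {d : ℕ} (P : Set (EuclideanSpace ℝ (Fin d))) : Prop :=
  (∃ V : Set (EuclideanSpace ℝ (Fin d)), V.Finite ∧ P = convexHull ℝ V) ∧ (interior P).Nonempty

/-- `T` is a normal (face-to-face) tiling of `ℝ^d` by translates of `P`: its cells are translates
of `P`, they cover the space, distinct cells have disjoint interiors, and the intersection of any
two cells is a common face of both. (`IsExposed ℝ Q F` says that `F` is empty or is the set of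
maximizers on `Q` of a linear functional; for a polytope `Q` these are exactly its faces, with
`∅` and `Q` included.) -/
structure IsNormalTranslateTiling {d : ℕ} (P : Set (EuclideanSpace ℝ (Fin d)))
    (T : Set (Set (EuclideanSpace ℝ (Fin d)))) : Prop where
  translate : ∀ Q ∈ T, ∃ t : EuclideanSpace ℝ (Fin d), Q = t +ᵥ P
  cover : ⋃₀ T = Set.univ
  disjoint : ∀ Q ∈ T, ∀ R ∈ T, Q ≠ R → Disjoint (interior Q) (interior R)
  face_to_face : ∀ Q ∈ T, ∀ R ∈ T, IsExposed ℝ Q (Q ∩ R) ∧ IsExposed ℝ R (Q ∩ R)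

/-- A parallelohedron: a convex polytope whose translates tile the space face-to-face. -/
def IsParallelohedron {d : ℕ} (P : Set (EuclideanSpace ℝ (Fin d))) : Prop :=
  IsFullDimPolytope P ∧ ∃ T : Set (Set (EuclideanSpace ℝ (Fin d))), IsNormalTranslateTiling P T

/-- The Dirichlet domain of the point `p` with respect to the set `Λ`. -/
def dirichletDomain {d : ℕ} (Λ : Set (EuclideanSpace ℝ (Fin d))) (p : EuclideanSpace ℝ (Fin d)) :
    Set (EuclideanSpace ℝ (Fin d)) :=
  {x | ∀ q ∈ Λ, ‖x - p‖ ≤ ‖x - q‖}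

/-- A Voronoi parallelohedron: the Dirichlet domain of a point of a `d`-dimensional lattice. -/
def IsVoronoiParallelohedron {d : ℕ} (V : Set (EuclideanSpace ℝ (Fin d))) : Prop :=
  ∃ (Λ : Submodule ℤ (EuclideanSpace ℝ (Fin d))) (_ : DiscreteTopology Λ),
    IsZLattice ℝ Λ ∧ ∃ p ∈ Λ, V = dirichletDomain (Λ : Set (EuclideanSpace ℝ (Fin d))) p

/-- The Voronoi conjecture holds for `P`: some nondegenerate affine transformation maps `P` onto a
Voronoi parallelohedron. -/
def VoronoiConjectureHoldsFor {d : ℕ} (P : Set (EuclideanSpace ℝ (Fin d))) : Prop :=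
  ∃ f : EuclideanSpace ℝ (Fin d) ≃ᵃ[ℝ] EuclideanSpace ℝ (Fin d),
    IsVoronoiParallelohedron (f '' P)

/-- `F` is a (nonempty) face of codimension `k` of the tiling `T`, i.e. a `(d-k)`-dimensional face
of one of its cells. -/
def IsTilingFace {d : ℕ} (T : Set (Set (EuclideanSpace ℝ (Fin d)))) (k : ℕ)
    (F : Set (EuclideanSpace ℝ (Fin d))) : Prop :=
  F.Nonempty ∧ (∃ Q ∈ T, IsExposed ℝ Q F) ∧ Module.finrank ℝ (vectorSpan ℝ F) + k = d

/-- The hyperfaces (`(d-1)`-faces) of the tiling `T` that contain the set `G`. -/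
def facetsAround {d : ℕ} (T : Set (Set (EuclideanSpace ℝ (Fin d))))
    (G : Set (EuclideanSpace ℝ (Fin d))) : Set (Set (EuclideanSpace ℝ (Fin d))) :=
  {F | IsTilingFace T 1 F ∧ G ⊆ F}

/-- `n` assigns to the hyperfaces around the `(d-2)`-face `G` unit normals that agree with one of
the two directions of going around `G`.

Such a direction is an orientation of the two-dimensional quotient of `ℝ^d` by the directions of
`G`. The orientation is given by a nonzero alternating form `ω` whose kernel contains
the directions of `G`. In the quotient, `G` becomes a point and each hyperface `F ⊇ G` a segment
starting at this point; the normal `n F` has to point to the positive side of that segment. -/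
def AreCoherentNormals {d : ℕ} (T : Set (Set (EuclideanSpace ℝ (Fin d))))
    (G : Set (EuclideanSpace ℝ (Fin d)))
    (n : Set (EuclideanSpace ℝ (Fin d)) → EuclideanSpace ℝ (Fin d)) : Prop :=
  ∃ ω : EuclideanSpace ℝ (Fin d) →ₗ[ℝ] EuclideanSpace ℝ (Fin d) →ₗ[ℝ] ℝ,
    ω ≠ 0 ∧ ω.IsAlt ∧ (∀ v ∈ vectorSpan ℝ G, ω v = 0) ∧
    ∀ F ∈ facetsAround T G,
      ‖n F‖ = 1 ∧ (∀ v ∈ vectorSpan ℝ F, inner ℝ v (n F) = 0) ∧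
      ∀ x ∈ G, ∀ y ∈ F \ G, 0 < ω (y - x) (n F)

/-- The torsion of the scaling `s` around the `(d-2)`-face `G`, computed with the normals `n`. The
sum is over the hyperfaces containing `G`; there are finitely many of them in a tiling by
translates of a polytope. -/
noncomputable def torsion {d : ℕ} (T : Set (Set (EuclideanSpace ℝ (Fin d))))
    (s : Set (EuclideanSpace ℝ (Fin d)) → ℝ)
    (n : Set (EuclideanSpace ℝ (Fin d)) → EuclideanSpace ℝ (Fin d))
    (G : Set (EuclideanSpace ℝ (Fin d))) : EuclideanSpace ℝ (Fin d) :=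
  ∑ᶠ F ∈ facetsAround T G, s F • n F

/-- `s` is a canonical scaling of the tiling `T`: it is positive on all hyperfaces (its values on
other sets play no role) and has zero torsion around every `(d-2)`-face. -/
def IsCanonicalScaling {d : ℕ} (T : Set (Set (EuclideanSpace ℝ (Fin d))))
    (s : Set (EuclideanSpace ℝ (Fin d)) → ℝ) : Prop :=
  (∀ F, IsTilingFace T 1 F → 0 < s F) ∧
  ∀ G, IsTilingFace T 2 G → ∀ n, AreCoherentNormals T G n → torsion T s n G = 0

/-!
Let `s` be a canonical scaling. Give each oriented facet crossing the jump `s F • n`, with `n` the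
unit normal in the direction of the crossing. Canonicity says that the jumps around a codimension 2
face add up to zero; as a path between two cells can be pushed off the faces of higher codimension,
the jumps are the differences of a function on the cells, the gradients of a piecewise linear
generatrix. The differences of the gradients along two non-parallel vectors between neighbouring
cells are multiples of independent normals, so going around a parallelogram of translates shows that
the mixed second differences vanish. Averaging the differences along each vector then gives a linear
map `A` that sends every vector from a cell to a neighbour to a positive multiple of the facet
normal. The existence of a function with these gradients makes `A` symmetric, and monotonicity along
lines makes it positive definite. In the Euclidean metric given by `A` the facets are orthogonal to
the vectors between neighbouring cells and bisect them, so `P` becomes a Dirichlet domain.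

Conversely, if `f` maps `P` to a Dirichlet domain and `L` is its linear part, then `A = Lᵀ L` sends
the vectors between neighbouring cells to positive multiples of the facet normals. These vectors add
up to zero around a codimension 2 face, so the lengths of their images form a canonical scaling.
-/

namespace Parallelohedron

open Set Module Filter Topology
open scoped RealInnerProductSpace

/-! ### Relative interiors, exposed faces and general position -/

section Module

variable {E : Type*} [AddCommGroup E] [Module ℝ E]

theorem map_eq_zero_of_mem_vectorSpan {F : Set E} {l : E →ₗ[ℝ] ℝ} {c : ℝ} (hc : ∀ x ∈ F, l x = c)
    {u : E} (hu : u ∈ vectorSpan ℝ F) : l u = 0 := by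
  suffices vectorSpan ℝ F ≤ LinearMap.ker l from this hu
  rw [vectorSpan_def, Submodule.span_le]
  rintro _ ⟨x, hx, y, hy, rfl⟩
  simp [hc x hx, hc y hy]

theorem finrank_vectorSpan_insert_le_add_one [FiniteDimensional ℝ E] (S : Set E) (x : E) :
    finrank ℝ (vectorSpan ℝ (insert x S)) ≤ finrank ℝ (vectorSpan ℝ S) + 1 := by
  have h := finrank_vectorSpan_insert_le (affineSpan ℝ S) x
  rw [direction_affineSpan] at h
  exact (Submodule.finrank_mono
    (vectorSpan_mono ℝ (insert_subset_insert (subset_affineSpan ℝ S)))).trans h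

theorem mem_affineSpan_insert_of_combo_mem {S : Set E} {x y : E} {a b : ℝ} (hab : a + b = 1)
    (hb : b ≠ 0) (h : a • x + b • y ∈ affineSpan ℝ S) : y ∈ affineSpan ℝ (insert x S) := by
  have hx : x ∈ affineSpan ℝ (insert x S) := subset_affineSpan ℝ _ (mem_insert _ _)
  convert AffineMap.lineMap_mem b⁻¹ hx (affineSpan_mono ℝ (subset_insert x S) h) using 1
  obtain rfl : a = 1 - b := by linarith
  rw [AffineMap.lineMap_apply_module]
  match_scalars <;> field_simp
  ring

theorem segment_disjoint_affineSpan {S : Set E} {x y : E} (hx : x ∉ affineSpan ℝ S)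
    (hy : y ∉ affineSpan ℝ (insert x S)) :
    Disjoint (segment ℝ x y) (affineSpan ℝ S : Set E) := by
  rw [Set.disjoint_left]
  rintro z ⟨a, b, -, -, hab, rfl⟩ hz
  rcases eq_or_ne b 0 with rfl | hb
  · exact hx (by simpa [show a = 1 by linarith] using hz)
  · exact hy (mem_affineSpan_insert_of_combo_mem hab hb hz)

theorem triangle_disjoint_affineSpan {S : Set E} {x y z : E} (hx : x ∉ affineSpan ℝ S)
    (hy : y ∉ affineSpan ℝ (insert x S)) (hz : z ∉ affineSpan ℝ (insert y (insert x S))) :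
    Disjoint (convexHull ℝ {x, y, z}) (affineSpan ℝ S : Set E) := by
  rw [Set.disjoint_left]
  intro w hw hwS
  rw [convexHull_insert (by simp), convexHull_pair, mem_convexJoin] at hw
  obtain ⟨_, rfl, u, hu, a, b, -, -, hab, rfl⟩ := hw
  rcases eq_or_ne b 0 with rfl | hb
  · exact hx (by simpa [show a = 1 by linarith] using hwS)
  · exact Set.disjoint_left.1 (segment_disjoint_affineSpan hy hz) hu
      (mem_affineSpan_insert_of_combo_mem hab hb hwS)

end Module

section Exposed

variable {E : Type*} [AddCommGroup E] [Module ℝ E] [TopologicalSpace E] {Q K K' : Set E}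

theorem mem_of_isExposed_of_sub_mem_vectorSpan (hK : IsExposed ℝ Q K) {x y : E} (hx : x ∈ Q)
    (hy : y ∈ K) (h : x - y ∈ vectorSpan ℝ K) : x ∈ K := by
  obtain ⟨l, rfl⟩ := hK ⟨y, hy⟩
  have hxy : l.toLinearMap (x - y) = 0 := map_eq_zero_of_mem_vectorSpan
    (fun z hz => le_antisymm (hy.2 z hz.1) (hz.2 y hy.1)) h
  rw [map_sub, sub_eq_zero] at hxy
  exact ⟨hx, fun z hz => (hy.2 z hz).trans_eq hxy.symm⟩

variable [FiniteDimensional ℝ E]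

theorem eq_of_isExposed_of_finrank_le (hK : IsExposed ℝ Q K) (hne : K.Nonempty) (h : K ⊆ K')
    (hQ : K' ⊆ Q) (hd : finrank ℝ (vectorSpan ℝ K') ≤ finrank ℝ (vectorSpan ℝ K)) : K = K' := by
  obtain ⟨y, hy⟩ := hne
  refine h.antisymm fun x hx => mem_of_isExposed_of_sub_mem_vectorSpan hK (hQ hx) hy ?_
  rw [Submodule.eq_of_le_of_finrank_le (vectorSpan_mono ℝ h) hd]
  exact vsub_mem_vectorSpan ℝ hx (h hy)

theorem finrank_vectorSpan_lt_of_isExposed (hK : IsExposed ℝ Q K) (hne : K.Nonempty) (h : K ⊆ K')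
    (hQ : K' ⊆ Q) (hn : K ≠ K') : finrank ℝ (vectorSpan ℝ K) < finrank ℝ (vectorSpan ℝ K') := by
  by_contra! hd
  exact hn (eq_of_isExposed_of_finrank_le hK hne h hQ hd)

end Exposed

section IntrinsicInterior

variable {E : Type*} [AddCommGroup E] [Module ℝ E] [TopologicalSpace E] [IsTopologicalAddGroup E]
  [ContinuousSMul ℝ E] {Q F K : Set E} {w : E}

theorem eventually_add_smul_mem_of_mem_intrinsicInterior (hw : w ∈ intrinsicInterior ℝ F) {u : E}
    (hu : u ∈ vectorSpan ℝ F) : ∀ᶠ t : ℝ in 𝓝 0, w + t • u ∈ F := by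
  obtain ⟨y, hy, rfl⟩ := mem_intrinsicInterior.1 hw
  rw [← direction_affineSpan] at hu
  have hmem (t : ℝ) : (y : E) + t • u ∈ affineSpan ℝ F := by
    rw [add_comm]
    exact AffineSubspace.vadd_mem_of_mem_direction (Submodule.smul_mem _ t hu) y.2
  let f : ℝ → affineSpan ℝ F := fun t => ⟨y + t • u, hmem t⟩
  have hf : Continuous f := by fun_prop
  have hf0 : f 0 = y := by ext; simp [f]
  filter_upwards [hf.continuousAt.preimage_mem_nhds
    (isOpen_interior.mem_nhds (hf0.symm ▸ hy))] with t ht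
  exact interior_subset (s := Subtype.val ⁻¹' F) ht

theorem eq_of_forall_le_of_mem_intrinsicInterior {l : E →ₗ[ℝ] ℝ}
    (hw : w ∈ intrinsicInterior ℝ F) (hl : ∀ x ∈ F, l x ≤ l w) {x : E} (hx : x ∈ F) :
    l x = l w := by
  refine le_antisymm (hl x hx) ?_
  have hu : w - x ∈ vectorSpan ℝ F := vsub_mem_vectorSpan ℝ (intrinsicInterior_subset hw) hx
  obtain ⟨t, ht0, ht⟩ := (eventually_mem_nhdsWithin.and
    ((eventually_add_smul_mem_of_mem_intrinsicInterior hw hu).filter_mono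
      (nhdsWithin_le_nhds (s := Ioi 0)))).exists
  have hle := hl _ ht
  simp only [map_add, map_smul, map_sub, smul_eq_mul, mem_Ioi] at hle ht0
  nlinarith

theorem subset_of_isExposed_of_mem_intrinsicInterior (hK : IsExposed ℝ Q K) (hFQ : F ⊆ Q)
    (hw : w ∈ intrinsicInterior ℝ F) (hwK : w ∈ K) : F ⊆ K := by
  obtain ⟨l, rfl⟩ := hK ⟨w, hwK⟩
  intro x hx
  have hxw : l x = l w := eq_of_forall_le_of_mem_intrinsicInterior (l := l.toLinearMap) hw
    (fun z hz => hwK.2 z (hFQ hz)) hx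
  exact ⟨hFQ hx, fun y hy => hxw ▸ hwK.2 y hy⟩

end IntrinsicInterior

section Normed

variable {E : Type*} [NormedAddCommGroup E] [NormedSpace ℝ E]

theorem vectorSpan_eq_top_of_interior_nonempty {K : Set E} (hK : (interior K).Nonempty) :
    vectorSpan ℝ K = ⊤ := by
  have h : affineSpan ℝ K = ⊤ := by
    rw [← top_le_iff, ← isOpen_interior.affineSpan_eq_top hK]
    exact affineSpan_mono ℝ interior_subset
  rw [← direction_affineSpan, h, AffineSubspace.direction_top]

theorem eq_zero_of_forall_add_mem {K : Set E} (hb : Bornology.IsBounded K) (hne : K.Nonempty)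
    {u : E} (h : ∀ x ∈ K, x + u ∈ K) : u = 0 := by
  obtain ⟨x, hx⟩ := hne
  have hk (k : ℕ) : x + k • u ∈ K := by
    induction k with
    | zero => simpa using hx
    | succ k ih => simpa [succ_nsmul, add_assoc] using h _ ih
  obtain ⟨C, hC⟩ := hb.exists_norm_le
  by_contra hu
  obtain ⟨k, hCk⟩ := exists_nat_gt ((C + ‖x‖) / ‖u‖)
  rw [div_lt_iff₀ (norm_pos_iff.2 hu)] at hCk
  have hle : k * ‖u‖ ≤ ‖x + k • u‖ + ‖x‖ := by
    simpa [← Nat.cast_smul_eq_nsmul ℝ, norm_smul] using norm_sub_le (x + k • u) x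
  linarith [hC _ (hk k)]

theorem exists_mem_segment_mem_frontier {Q : Set E} {x y : E} (hx : x ∈ Q) (hy : y ∉ Q) :
    ∃ z ∈ segment ℝ x y, z ∈ frontier Q := by
  by_contra! h
  have hxs := left_mem_segment ℝ x y
  have hys := right_mem_segment ℝ x y
  have hcover : segment ℝ x y ⊆ interior Q ∪ interior Qᶜ := fun z hz => by
    rw [← compl_frontier_eq_union_interior]
    exact h z hz
  obtain ⟨z, -, hz, hz'⟩ := (convex_segment x y).isPreconnected _ _ isOpen_interior
    isOpen_interior hcover
    ⟨x, hxs, (hcover hxs).resolve_right fun hx' => interior_subset hx' hx⟩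
    ⟨y, hys, (hcover hys).resolve_left fun hy' => hy (interior_subset hy')⟩
  exact interior_subset hz' (interior_subset hz)

variable [FiniteDimensional ℝ E]

theorem interior_nonempty_of_finrank_vectorSpan_eq {K : Set E} (hK : Convex ℝ K)
    (hne : K.Nonempty) (hd : finrank ℝ (vectorSpan ℝ K) = finrank ℝ E) :
    (interior K).Nonempty := by
  rw [hK.interior_nonempty_iff_affineSpan_eq_top,
    ← AffineSubspace.direction_eq_top_iff_of_nonempty ((affineSpan_nonempty ℝ).2 hne),
    direction_affineSpan]
  exact Submodule.eq_top_of_finrank_eq hd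

theorem exists_mem_forall_notMem_affineSpan {ι : Type*} {I : Set ι} (hI : I.Countable)
    {S : ι → Set E} (hS : ∀ i ∈ I, finrank ℝ (vectorSpan ℝ (S i)) < finrank ℝ E) {U : Set E}
    (hU : IsOpen U) (hne : U.Nonempty) : ∃ x ∈ U, ∀ i ∈ I, x ∉ affineSpan ℝ (S i) := by
  borelize E
  have hnull : ∀ i ∈ I, ∀ᵐ x ∂(MeasureTheory.Measure.addHaar : MeasureTheory.Measure E),
      x ∉ affineSpan ℝ (S i) := fun i hi => by
    refine MeasureTheory.measure_eq_zero_iff_ae_notMem.1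
      (MeasureTheory.Measure.addHaar_affineSubspace _ _ fun htop => (hS i hi).ne ?_)
    rw [← direction_affineSpan, htop, AffineSubspace.direction_top, finrank_top]
  exact (MeasureTheory.Measure.dense_of_ae
    ((MeasureTheory.ae_ball_iff hI).2 hnull)).inter_open_nonempty U hU hne

end Normed

/-! ### Facets and their outer normals -/

section Codim

variable {E : Type*} [AddCommGroup E] [Module ℝ E]

/-- Being a nonempty set whose affine hull has codimension `k`. For an exposed face of a convex
polytope this says that it is a face of codimension `k`. -/
def HasCodim (k : ℕ) (F : Set E) : Prop :=
  F.Nonempty ∧ finrank ℝ (vectorSpan ℝ F) + k = finrank ℝ E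

theorem HasCodim.eq_of_isExposed [TopologicalSpace E] [FiniteDimensional ℝ E] {Q K K' : Set E}
    {k : ℕ} (hK : IsExposed ℝ Q K) (h : HasCodim k K) (h' : HasCodim k K') (hs : K ⊆ K')
    (hQ : K' ⊆ Q) : K = K' := by
  refine eq_of_isExposed_of_finrank_le hK h.1 hs hQ ?_
  have := h.2
  have := h'.2
  omega

end Codim

section InnerProductSpace

variable {E : Type*} [NormedAddCommGroup E] [InnerProductSpace ℝ E]

/-- `n` is an outer unit normal of `Q` along its exposed face `F`: the linear functional `⟪n, ·⟫`
attains its maximum on `Q` exactly on `F`. -/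
def IsFacetNormal (Q F : Set E) (n : E) : Prop :=
  ‖n‖ = 1 ∧ ∃ m : ℝ, (∀ x ∈ Q, ⟪n, x⟫ ≤ m) ∧ F = {x ∈ Q | ⟪n, x⟫ = m}

namespace IsFacetNormal

variable {Q F : Set E} {n : E}

theorem inner_eq_zero (h : IsFacetNormal Q F n) {u : E} (hu : u ∈ vectorSpan ℝ F) :
    ⟪n, u⟫ = 0 := by
  obtain ⟨-, m, -, rfl⟩ := h
  exact map_eq_zero_of_mem_vectorSpan (l := innerₛₗ ℝ n) (fun x hx => hx.2) hu

theorem subset (h : IsFacetNormal Q F n) : F ⊆ Q := by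
  obtain ⟨-, m, -, rfl⟩ := h
  exact fun x hx => hx.1

theorem inner_le (h : IsFacetNormal Q F n) {x y : E} (hx : x ∈ Q) (hy : y ∈ F) :
    ⟪n, x⟫ ≤ ⟪n, y⟫ := by
  obtain ⟨-, m, hm, rfl⟩ := h
  exact (hm x hx).trans_eq hy.2.symm

theorem mem_of_inner_le (h : IsFacetNormal Q F n) {x y : E} (hx : x ∈ Q) (hy : y ∈ F)
    (hxy : ⟪n, y⟫ ≤ ⟪n, x⟫) : x ∈ F := by
  have hle := h.inner_le hx hy
  obtain ⟨-, m, -, rfl⟩ := h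
  exact ⟨hx, hy.2 ▸ le_antisymm hle hxy⟩

theorem inner_eq (h : IsFacetNormal Q F n) {x y : E} (hx : x ∈ F) (hy : y ∈ F) :
    ⟪n, x⟫ = ⟪n, y⟫ :=
  le_antisymm (h.inner_le (h.subset hx) hy) (h.inner_le (h.subset hy) hx)

theorem ne_zero (h : IsFacetNormal Q F n) : n ≠ 0 :=
  norm_ne_zero_iff.1 (h.1 ▸ one_ne_zero)

theorem inner_lt_of_mem_interior (h : IsFacetNormal Q F n) {x y : E} (hx : x ∈ interior Q)
    (hy : y ∈ F) : ⟪n, x⟫ < ⟪n, y⟫ := by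
  obtain ⟨r, hr, hb⟩ := Metric.isOpen_iff.1 isOpen_interior x hx
  have hz : x + (r / 2) • n ∈ Q := by
    refine interior_subset (hb ?_)
    rw [Metric.mem_ball, dist_eq_norm, add_sub_cancel_left, norm_smul, h.1, mul_one,
      Real.norm_of_nonneg (by positivity)]
    exact half_lt_self hr
  have hle := h.inner_le hz hy
  rw [inner_add_right, inner_smul_right, real_inner_self_eq_norm_sq, h.1] at hle
  linarith

theorem isExposed (h : IsFacetNormal Q F n) : IsExposed ℝ Q F := by
  rintro ⟨y, hy⟩
  refine ⟨innerSL ℝ n, Subset.antisymm (fun x hx => ⟨h.subset hx, fun z hz => ?_⟩) fun x hx => ?_⟩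
  · exact h.inner_le hz hx
  · exact h.mem_of_inner_le hx.1 hy (hx.2 y (h.subset hy))

theorem convex (h : IsFacetNormal Q F n) (hQ : Convex ℝ Q) : Convex ℝ F :=
  h.isExposed.convex hQ

end IsFacetNormal

variable [FiniteDimensional ℝ E] {Q R F : Set E} {n n' : E}

theorem vectorSpan_eq_orthogonal (hF : HasCodim 1 F) (hn : n ≠ 0)
    (h : ∀ u ∈ vectorSpan ℝ F, ⟪n, u⟫ = 0) : vectorSpan ℝ F = (ℝ ∙ n)ᗮ := by
  refine Submodule.eq_of_le_of_finrank_le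
    (fun u hu => (Submodule.mem_orthogonal_singleton_iff_inner_right).2 (h u hu)) ?_
  have hsum := Submodule.finrank_add_finrank_orthogonal (ℝ ∙ n)
  rw [finrank_span_singleton hn] at hsum
  have := hF.2
  omega

theorem eq_inner_smul_of_orthogonal (hF : HasCodim 1 F) (hn : ‖n‖ = 1)
    (h : ∀ u ∈ vectorSpan ℝ F, ⟪n, u⟫ = 0) (h' : ∀ u ∈ vectorSpan ℝ F, ⟪n', u⟫ = 0) :
    n' = ⟪n, n'⟫ • n := by
  have hmem : n' ∈ (vectorSpan ℝ F)ᗮ := (Submodule.mem_orthogonal' _ _).2 h'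
  rw [vectorSpan_eq_orthogonal hF (norm_ne_zero_iff.1 (hn ▸ one_ne_zero)) h,
    Submodule.orthogonal_orthogonal, Submodule.mem_span_singleton] at hmem
  obtain ⟨c, rfl⟩ := hmem
  rw [inner_smul_right, real_inner_self_eq_norm_sq, hn, one_pow, mul_one]

theorem eq_or_eq_neg_of_orthogonal (hF : HasCodim 1 F) (hn : ‖n‖ = 1) (hn' : ‖n'‖ = 1)
    (h : ∀ u ∈ vectorSpan ℝ F, ⟪n, u⟫ = 0) (h' : ∀ u ∈ vectorSpan ℝ F, ⟪n', u⟫ = 0) :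
    n' = n ∨ n' = -n := by
  have heq := eq_inner_smul_of_orthogonal hF hn h h'
  have habs : |⟪n, n'⟫| = 1 := by
    rw [heq, norm_smul, hn, mul_one] at hn'
    exact hn'
  rcases eq_or_eq_neg_of_abs_eq habs with hc | hc <;> rw [hc] at heq
  · exact Or.inl (by simpa using heq)
  · exact Or.inr (by simpa using heq)

theorem IsFacetNormal.unique (hQ : (interior Q).Nonempty) (hF : HasCodim 1 F)
    (h : IsFacetNormal Q F n) (h' : IsFacetNormal Q F n') : n' = n := by
  refine (eq_or_eq_neg_of_orthogonal hF h.1 h'.1 (fun u => h.inner_eq_zero)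
    fun u => h'.inner_eq_zero).resolve_right ?_
  rintro rfl
  obtain ⟨x, hx⟩ := hQ
  obtain ⟨y, hy⟩ := hF.1
  have hlt := h'.inner_lt_of_mem_interior hx hy
  rw [inner_neg_left, inner_neg_left] at hlt
  linarith [h.inner_lt_of_mem_interior hx hy]

theorem exists_isFacetNormal (hQ : (interior Q).Nonempty) (hF : HasCodim 1 F)
    (h : IsExposed ℝ Q F) : ∃ n, IsFacetNormal Q F n := by
  obtain ⟨l, rfl⟩ := h hF.1
  obtain ⟨y, hyQ, hy⟩ := hF.1
  obtain ⟨a, rfl⟩ := (InnerProductSpace.toDual ℝ E).surjective l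
  simp only [InnerProductSpace.toDual_apply_apply] at hF hy ⊢
  have ha : 0 < ‖a‖ := by
    rw [norm_pos_iff]
    rintro rfl
    have hset : {x ∈ Q | ∀ y ∈ Q, ⟪(0 : E), y⟫ ≤ ⟪0, x⟫} = Q := by simp
    have hcodim := hF.2
    rw [hset, vectorSpan_eq_top_of_interior_nonempty hQ, finrank_top] at hcodim
    omega
  refine ⟨‖a‖⁻¹ • a, norm_smul_inv_norm (𝕜 := ℝ) (norm_pos_iff.1 ha), ‖a‖⁻¹ * ⟪a, y⟫,
    fun x hx => ?_, ?_⟩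
  · rw [real_inner_smul_left]
    gcongr
    exact hy x hx
  · ext x
    simp only [mem_ofPred_eq, real_inner_smul_left, mul_right_inj' (inv_ne_zero ha.ne')]
    exact and_congr_right fun hx =>
      ⟨fun h => le_antisymm (hy x hx) (h y hyQ), fun h z hz => h ▸ hy z hz⟩

theorem interior_inter_interior_nonempty_of_isFacetNormal (hQ : Convex ℝ Q)
    (hQi : (interior Q).Nonempty) (hR : Convex ℝ R) (hRi : (interior R).Nonempty)
    (hF : HasCodim 1 F) (h : IsFacetNormal Q F n) (h' : IsFacetNormal R F n) :
    (interior Q ∩ interior R).Nonempty := by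
  rw [← not_disjoint_iff_nonempty_inter]
  intro hdisj
  -- A functional separating the interiors is constant on `F`, hence proportional to `⟪n, ·⟫`; but
  -- `⟪n, ·⟫` has both interiors on the same side of `F`.
  obtain ⟨l, c, hlQ, hlR⟩ := geometric_hahn_banach_open_open hQ.interior isOpen_interior
    hR.interior isOpen_interior hdisj
  obtain ⟨a, rfl⟩ := (InnerProductSpace.toDual ℝ E).surjective l
  simp only [InnerProductSpace.toDual_apply_apply] at hlQ hlR
  have hcont : Continuous fun z : E => ⟪a, z⟫ := by fun_prop
  have hF_eq : ∀ z ∈ F, ⟪a, z⟫ = c := fun z hz => by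
    refine le_antisymm ?_ ?_
    · have hz' : z ∈ closure (interior Q) := by
        rw [hQ.closure_interior_eq_closure_of_nonempty_interior hQi]
        exact subset_closure (h.subset hz)
      exact closure_minimal (fun x hx => (hlQ x hx).le) (isClosed_le hcont continuous_const) hz'
    · have hz' : z ∈ closure (interior R) := by
        rw [hR.closure_interior_eq_closure_of_nonempty_interior hRi]
        exact subset_closure (h'.subset hz)
      exact closure_minimal (fun x hx => (hlR x hx).le) (isClosed_le continuous_const hcont) hz'
  have ha : a = ⟪n, a⟫ • n := eq_inner_smul_of_orthogonal hF h.1 (fun u => h.inner_eq_zero)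
    fun u => map_eq_zero_of_mem_vectorSpan (l := innerₛₗ ℝ a) hF_eq
  obtain ⟨x, hx⟩ := hQi
  obtain ⟨y, hy⟩ := hRi
  obtain ⟨z, hz⟩ := hF.1
  have hax := hlQ x hx
  have hay := hlR y hy
  rw [← hF_eq z hz, ha, real_inner_smul_left, real_inner_smul_left] at hax hay
  nlinarith [h.inner_lt_of_mem_interior hx hz, h'.inner_lt_of_mem_interior hy hz]

end InnerProductSpace

/-! ### Face-to-face tilings -/

section Tiling

variable {E : Type*} [NormedAddCommGroup E] [NormedSpace ℝ E] {T : Set (Set E)}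

/-- A locally finite face-to-face tiling by convex bodies, not necessarily translates of each
other. -/
structure IsFaceTiling (T : Set (Set E)) : Prop where
  convex : ∀ Q ∈ T, Convex ℝ Q
  compact : ∀ Q ∈ T, IsCompact Q
  interior_nonempty : ∀ Q ∈ T, (interior Q).Nonempty
  locallyFinite : LocallyFinite ((↑) : T → Set E)
  cover : ∀ x, ∃ Q ∈ T, x ∈ Q
  disjoint : ∀ Q ∈ T, ∀ R ∈ T, Q ≠ R → Disjoint (interior Q) (interior R)
  isExposed_inter : ∀ Q ∈ T, ∀ R ∈ T, IsExposed ℝ Q (Q ∩ R)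

namespace IsFaceTiling

theorem isExposed_inter_right (hT : IsFaceTiling T) {Q R : Set E} (hQ : Q ∈ T) (hR : R ∈ T) :
    IsExposed ℝ R (Q ∩ R) :=
  inter_comm R Q ▸ hT.isExposed_inter R hR Q hQ

theorem exists_ball_forall_mem (hT : IsFaceTiling T) (w : E) :
    ∃ r > 0, ∀ Q ∈ T, (Q ∩ Metric.ball w r).Nonempty → w ∈ Q := by
  obtain ⟨r, hr, hball⟩ := Metric.mem_nhds_iff.1 (hT.locallyFinite.iInter_compl_mem_nhds
    (fun Q => (hT.compact Q Q.2).isClosed) w)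
  refine ⟨r, hr, fun Q hQ ⟨x, hxQ, hx⟩ => ?_⟩
  by_contra hwQ
  exact mem_iInter₂.1 (hball hx) ⟨Q, hQ⟩ hwQ hxQ

theorem finite_inter_compact (hT : IsFaceTiling T) {K : Set E} (hK : IsCompact K) :
    {R ∈ T | (R ∩ K).Nonempty}.Finite := by
  refine ((hT.locallyFinite.finite_nonempty_inter_compact hK).image (↑)).subset ?_
  exact fun R hR => ⟨⟨R, hR.1⟩, hR.2, rfl⟩

theorem finite_mem (hT : IsFaceTiling T) (w : E) : {R ∈ T | w ∈ R}.Finite :=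
  (hT.finite_inter_compact (isCompact_singleton (x := w))).subset
    fun _ hR => ⟨hR.1, w, hR.2, rfl⟩

theorem eq_of_mem_interior (hT : IsFaceTiling T) {Q R : Set E} (hQ : Q ∈ T) (hR : R ∈ T) {x : E}
    (hx : x ∈ interior Q) (hxR : x ∈ R) : R = Q := by
  by_contra hne
  have hcl : x ∈ closure (interior R) := by
    rw [(hT.convex R hR).closure_interior_eq_closure_of_nonempty_interior
      (hT.interior_nonempty R hR)]
    exact subset_closure hxR
  obtain ⟨y, hyQ, hyR⟩ := mem_closure_iff.1 hcl _ isOpen_interior hx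
  exact Set.disjoint_left.1 (hT.disjoint R hR Q hQ hne) hyR hyQ

theorem exists_ne_of_notMem_interior (hT : IsFaceTiling T) {Q : Set E} {w : E}
    (hw : w ∉ interior Q) : ∃ R ∈ T, R ≠ Q ∧ w ∈ R := by
  by_contra! h
  obtain ⟨r, hr, hb⟩ := hT.exists_ball_forall_mem w
  refine hw (mem_interior.2 ⟨Metric.ball w r, fun x hx => ?_, Metric.isOpen_ball,
    Metric.mem_ball_self hr⟩)
  obtain ⟨R, hR, hxR⟩ := hT.cover x
  by_contra hxQ
  exact h R hR (fun hRQ => hxQ (hRQ ▸ hxR)) (hb R hR ⟨x, hxR, hx⟩)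

theorem ne_of_hasCodim_one (hT : IsFaceTiling T) {Q R : Set E} (hQ : Q ∈ T)
    (h : HasCodim 1 (Q ∩ R)) : Q ≠ R := by
  rintro rfl
  have hcodim := h.2
  rw [inter_self, vectorSpan_eq_top_of_interior_nonempty (hT.interior_nonempty Q hQ),
    finrank_top] at hcodim
  omega

variable [FiniteDimensional ℝ E]

theorem countable (hT : IsFaceTiling T) : T.Countable := by
  have : ProperSpace E := FiniteDimensional.proper_real E
  exact countable_univ_iff.1 <| hT.locallyFinite.countable_univ fun Q =>
    (hT.interior_nonempty Q Q.2).mono interior_subset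

theorem finrank_inter_lt (hT : IsFaceTiling T) {Q R : Set E} (hQ : Q ∈ T) (hR : R ∈ T)
    (hne : Q ≠ R) (hn : (Q ∩ R).Nonempty) :
    finrank ℝ (vectorSpan ℝ (Q ∩ R)) < finrank ℝ E := by
  refine lt_of_le_of_ne (Submodule.finrank_le _) fun h => hne ?_
  obtain ⟨x, hx⟩ := interior_nonempty_of_finrank_vectorSpan_eq
    ((hT.convex Q hQ).inter (hT.convex R hR)) hn h
  exact (hT.eq_of_mem_interior hQ hR (interior_mono inter_subset_left hx)
    (interior_subset hx).2).symm

end IsFaceTiling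

end Tiling

section Neighbors

variable {E : Type*} [NormedAddCommGroup E] [InnerProductSpace ℝ E] [FiniteDimensional ℝ E]
  {T : Set (Set E)}

namespace IsFaceTiling

variable {Q R S F : Set E}

theorem exists_inter_eq_of_isExposed (hT : IsFaceTiling T) (hQ : Q ∈ T) (hF : HasCodim 1 F)
    (h : IsExposed ℝ Q F) : ∃ R ∈ T, R ≠ Q ∧ Q ∩ R = F := by
  obtain ⟨n, hn⟩ := exists_isFacetNormal (hT.interior_nonempty Q hQ) hF h
  obtain ⟨w, hw⟩ := hF.1.intrinsicInterior (hn.convex (hT.convex Q hQ))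
  have hwF := intrinsicInterior_subset hw
  have hwQ := hn.subset hwF
  obtain ⟨R, hR, hRQ, hwR⟩ := hT.exists_ne_of_notMem_interior (Q := Q) (w := w) fun hwi =>
    (hn.inner_lt_of_mem_interior hwi hwF).false
  refine ⟨R, hR, hRQ, (eq_of_isExposed_of_finrank_le h hF.1
    (subset_of_isExposed_of_mem_intrinsicInterior (hT.isExposed_inter Q hQ R hR) hn.subset hw
      ⟨hwQ, hwR⟩) inter_subset_left ?_).symm⟩
  have hlt := hT.finrank_inter_lt hQ hR hRQ.symm ⟨w, hwQ, hwR⟩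
  have := hF.2
  omega

theorem exists_isFacetNormal_inter (hT : IsFaceTiling T) (hQ : Q ∈ T) (hR : R ∈ T)
    (h : HasCodim 1 (Q ∩ R)) :
    ∃ n, IsFacetNormal Q (Q ∩ R) n ∧ IsFacetNormal R (Q ∩ R) (-n) := by
  obtain ⟨n, hn⟩ :=
    exists_isFacetNormal (hT.interior_nonempty Q hQ) h (hT.isExposed_inter Q hQ R hR)
  obtain ⟨n', hn'⟩ :=
    exists_isFacetNormal (hT.interior_nonempty R hR) h (hT.isExposed_inter_right hQ hR)
  refine ⟨n, hn, ?_⟩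
  rcases eq_or_eq_neg_of_orthogonal h hn.1 hn'.1 (fun u => hn.inner_eq_zero)
    (fun u => hn'.inner_eq_zero) with rfl | rfl
  · obtain ⟨x, hx, hx'⟩ := interior_inter_interior_nonempty_of_isFacetNormal (hT.convex Q hQ)
      (hT.interior_nonempty Q hQ) (hT.convex R hR) (hT.interior_nonempty R hR) h hn hn'
    exact absurd (hT.eq_of_mem_interior hQ hR hx (interior_subset hx')).symm
      (hT.ne_of_hasCodim_one hQ h)
  · exact hn'

theorem neighbor_unique (hT : IsFaceTiling T) (hQ : Q ∈ T) (hR : R ∈ T) (hS : S ∈ T)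
    (h : HasCodim 1 (Q ∩ R)) (he : Q ∩ R = Q ∩ S) : R = S := by
  obtain ⟨n, hnQ, hnR⟩ := hT.exists_isFacetNormal_inter hQ hR h
  obtain ⟨n', hnQ', hnS⟩ := hT.exists_isFacetNormal_inter hQ hS (he ▸ h)
  rw [← he] at hnQ' hnS
  rw [hnQ.unique (hT.interior_nonempty Q hQ) h hnQ'] at hnS
  obtain ⟨x, hxR, hxS⟩ := interior_inter_interior_nonempty_of_isFacetNormal (hT.convex R hR)
    (hT.interior_nonempty R hR) (hT.convex S hS) (hT.interior_nonempty S hS) h hnR hnS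
  exact (hT.eq_of_mem_interior hR hS hxR (interior_subset hxS)).symm

theorem eq_or_eq_of_mem_intrinsicInterior (hT : IsFaceTiling T) (hQ : Q ∈ T) (hR : R ∈ T)
    (hS : S ∈ T) (h : HasCodim 1 (Q ∩ R)) {w : E} (hw : w ∈ intrinsicInterior ℝ (Q ∩ R))
    (hwS : w ∈ S) : S = Q ∨ S = R := by
  refine or_iff_not_imp_left.2 fun hSQ => ?_
  have hwQ := (intrinsicInterior_subset hw).1
  refine (hT.neighbor_unique hQ hR hS h ?_).symm
  refine eq_of_isExposed_of_finrank_le (hT.isExposed_inter Q hQ R hR) h.1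
    (subset_of_isExposed_of_mem_intrinsicInterior (hT.isExposed_inter Q hQ S hS)
      inter_subset_left hw ⟨hwQ, hwS⟩) inter_subset_left ?_
  have hlt := hT.finrank_inter_lt hQ hS (Ne.symm hSQ) ⟨w, hwQ, hwS⟩
  have := h.2
  omega

/-- A generic segment from the interior of `Q` to `y` avoids the faces of codimension at least two,
so it leaves `Q` through a facet. -/
theorem exists_facet_inner_lt_of_notMem (hT : IsFaceTiling T) (hQ : Q ∈ T) {y : E}
    (hy : y ∉ Q) : ∃ R ∈ T, HasCodim 1 (Q ∩ R) ∧ ∀ n, IsFacetNormal Q (Q ∩ R) n →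
      ∀ z ∈ Q ∩ R, ⟪n, z⟫ < ⟪n, y⟫ := by
  obtain ⟨x, hx, hx_generic⟩ := exists_mem_forall_notMem_affineSpan
    (I := {R ∈ T | finrank ℝ (vectorSpan ℝ (Q ∩ R)) + 2 ≤ finrank ℝ E})
    (hT.countable.mono fun R hR => hR.1) (S := fun R => insert y (Q ∩ R))
    (fun R hR => by
      have := finrank_vectorSpan_insert_le_add_one (Q ∩ R) y
      have := hR.2
      omega) isOpen_interior (hT.interior_nonempty Q hQ)
  obtain ⟨z, hz, hzf⟩ := exists_mem_segment_mem_frontier (interior_subset hx) hy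
  have hzQ : z ∈ Q := (hT.compact Q hQ).isClosed.frontier_subset hzf
  obtain ⟨R, hR, hRQ, hzR⟩ := hT.exists_ne_of_notMem_interior (Q := Q) (w := z) hzf.2
  obtain ⟨a, b, ha, hb, hab, rfl⟩ := hz
  have ha0 : a ≠ 0 := by
    rintro rfl
    exact hy (by simpa [show b = 1 by linarith] using hzQ)
  have hcodim : HasCodim 1 (Q ∩ R) := by
    refine ⟨⟨_, hzQ, hzR⟩, ?_⟩
    have hlt := hT.finrank_inter_lt hQ hR hRQ.symm ⟨_, hzQ, hzR⟩
    by_contra hne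
    refine hx_generic R ⟨hR, by omega⟩
      (mem_affineSpan_insert_of_combo_mem (add_comm b a ▸ hab) ha0 ?_)
    rw [add_comm]
    exact subset_affineSpan ℝ _ ⟨hzQ, hzR⟩
  refine ⟨R, hR, hcodim, fun n hn z hz => ?_⟩
  have hlt := hn.inner_lt_of_mem_interior hx ⟨hzQ, hzR⟩
  rw [← hn.inner_eq ⟨hzQ, hzR⟩ hz]
  obtain rfl : a = 1 - b := by linarith
  have ha_pos : 0 < 1 - b := ha.lt_of_ne' ha0
  rw [inner_add_right, inner_smul_right, inner_smul_right] at hlt ⊢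
  nlinarith

end IsFaceTiling

end Neighbors

/-! ### Potentials of local cocycles on convex sets -/

section Cocycle

variable {Γ : Type*} [AddCommGroup Γ]

theorem sum_range_sub_sum_range_of_forall_add_eq {α : Type*} {k : α → α → Γ} {p q : ℕ → α} {N : ℕ}
    (h₀ : k (p 0) (q 0) = 0)
    (h : ∀ i < N, k (p i) (q i) + k (q i) (q (i + 1)) =
      k (p i) (p (i + 1)) + k (p (i + 1)) (q (i + 1))) :
    ∑ i ∈ Finset.range N, k (q i) (q (i + 1)) - ∑ i ∈ Finset.range N, k (p i) (p (i + 1)) =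
      k (p N) (q N) := by
  induction N with
  | zero => simp [h₀]
  | succ N ih =>
    rw [Finset.sum_range_succ, Finset.sum_range_succ, add_sub_add_comm,
      ih fun i hi => h i (by omega), ← add_sub_assoc, h N (by omega), add_sub_cancel_left]

variable {E : Type*} [NormedAddCommGroup E]

/-- `φ` is a potential of the differences `k` on `X`, up to a uniform distance. -/
def IsPotentialOn (k : E → E → Γ) (X : Set E) (φ : E → Γ) : Prop :=
  ∃ δ > 0, ∀ x ∈ X, ∀ y ∈ X, dist x y < δ → φ y - φ x = k x y

variable {k : E → E → Γ} {X : Set E} {φ ψ : E → Γ}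

theorem IsPotentialOn.mono {Y : Set E} (h : IsPotentialOn k Y φ) (hXY : X ⊆ Y) :
    IsPotentialOn k X φ := by
  obtain ⟨δ, hδ, h⟩ := h
  exact ⟨δ, hδ, fun x hx y hy => h x (hXY hx) y (hXY hy)⟩

variable [NormedSpace ℝ E]

theorem exists_nat_dist_lineMap_lt (D : ℝ) {δ : ℝ} (hδ : 0 < δ) :
    ∃ N : ℕ, 0 < N ∧ ∀ x y : E, dist x y ≤ D → ∀ i : ℕ,
      dist (AffineMap.lineMap x y ((i : ℝ) / N)) (AffineMap.lineMap x y (((i + 1 : ℕ) : ℝ) / N)) <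
        δ := by
  obtain ⟨N, hN⟩ := exists_nat_gt (max (D / δ) 0)
  have hN_pos : (0 : ℝ) < N := (le_max_right _ _).trans_lt hN
  refine ⟨N, Nat.cast_pos.1 hN_pos, fun x y hxy i => ?_⟩
  have hdist : dist ((i : ℝ) / N) (((i + 1 : ℕ) : ℝ) / N) = 1 / N := by
    rw [Real.dist_eq, ← sub_div, abs_div, abs_of_pos hN_pos]
    simp
  rw [dist_lineMap_lineMap, hdist, one_div, inv_mul_lt_iff₀ hN_pos]
  exact hxy.trans_lt ((div_lt_iff₀ hδ).1 ((le_max_left _ _).trans_lt hN))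

theorem dist_lineMap_lineMap_le_of_mem_Icc (x y z : E) {c : ℝ} (hc : c ∈ Icc (0 : ℝ) 1) :
    dist (AffineMap.lineMap x y c) (AffineMap.lineMap x z c) ≤ dist y z := by
  rw [AffineMap.lineMap_apply_module, AffineMap.lineMap_apply_module, dist_add_left, dist_smul₀,
    Real.norm_of_nonneg hc.1]
  exact mul_le_of_le_one_left dist_nonneg hc.2

theorem IsPotentialOn.sub_eq (h : IsPotentialOn k X φ) (h' : IsPotentialOn k X ψ)
    (hX : Convex ℝ X) {x y : E} (hx : x ∈ X) (hy : y ∈ X) : φ y - φ x = ψ y - ψ x := by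
  obtain ⟨δ, hδ, h⟩ := h
  obtain ⟨δ', hδ', h'⟩ := h'
  refine hX.isPreconnected.induction₂ (fun x y => φ y - φ x = ψ y - ψ x) ?_ ?_ ?_ hx hy
  · intro x hx
    filter_upwards [mem_nhdsWithin_of_mem_nhds (Metric.ball_mem_nhds x (lt_min hδ hδ')),
      self_mem_nhdsWithin] with y hy hyX
    rw [Metric.mem_ball, dist_comm] at hy
    rw [h x hx y hyX (hy.trans_le (min_le_left _ _)),
      h' x hx y hyX (hy.trans_le (min_le_right _ _))]
  · intro x y z _ _ _ hxy hyz
    simpa using congrArg₂ (· + ·) hxy hyz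
  · intro x y _ _ hxy
    rw [← neg_sub (φ y), hxy, neg_sub]

/-- The potential at `y` is the sum of `k` along a fine subdivision of the segment from a base
point to `y`; two nearby segments span a ladder of small triangles. -/
theorem exists_isPotentialOn (hX : Convex ℝ X) (hb : Bornology.IsBounded X) {δ : ℝ} (hδ : 0 < δ)
    (hk : ∀ x ∈ X, ∀ y ∈ X, ∀ z ∈ X, dist x y < δ → dist y z < δ → dist x z < δ →
      k x y + k y z = k x z) : ∃ φ, IsPotentialOn k X φ := by
  rcases X.eq_empty_or_nonempty with rfl | ⟨x₀, hx₀⟩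
  · exact ⟨0, 1, one_pos, fun x hx => hx.elim⟩
  obtain ⟨D, hD⟩ := (Metric.isBounded_iff_subset_closedBall x₀).1 hb
  obtain ⟨N, hN, hrung⟩ := exists_nat_dist_lineMap_lt (E := E) D (half_pos hδ)
  have hN' : (N : ℝ) ≠ 0 := Nat.cast_ne_zero.2 hN.ne'
  let p (y : E) (i : ℕ) : E := AffineMap.lineMap x₀ y ((i : ℝ) / N)
  have hIcc : ∀ i ≤ N, (i : ℝ) / N ∈ Icc (0 : ℝ) 1 := fun i hi =>
    unitInterval.div_mem (by positivity) (by positivity) (by exact_mod_cast hi)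
  have hpX : ∀ i ≤ N, ∀ y ∈ X, p y i ∈ X := fun i hi y hy => hX.lineMap_mem hx₀ hy (hIcc i hi)
  have hp_zero : ∀ y, p y 0 = x₀ := fun y => by simp [p]
  have hp_last : ∀ y, p y N = y := fun y => by simp [p, div_self hN']
  refine ⟨fun y => ∑ i ∈ Finset.range N, k (p y i) (p y (i + 1)), δ / 2, half_pos hδ,
    fun y hy z hz hyz => ?_⟩
  have hladder := sum_range_sub_sum_range_of_forall_add_eq (k := k) (p := p y) (q := p z) (N := N)
    ?_ fun i hi => ?_
  · rwa [hp_last, hp_last] at hladder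
  · rw [hp_zero, hp_zero]
    simpa [hδ] using hk x₀ hx₀ x₀ hx₀ x₀ hx₀
  · have hside : dist (p y i) (p z i) < δ / 2 :=
      (dist_lineMap_lineMap_le_of_mem_Icc x₀ y z (hIcc i hi.le)).trans_lt hyz
    have hside' : dist (p y (i + 1)) (p z (i + 1)) < δ / 2 :=
      (dist_lineMap_lineMap_le_of_mem_Icc x₀ y z (hIcc (i + 1) hi)).trans_lt hyz
    have hstep : dist (p y i) (p y (i + 1)) < δ / 2 :=
      hrung x₀ y (by rw [dist_comm]; exact hD hy) i
    have hstep' : dist (p z i) (p z (i + 1)) < δ / 2 :=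
      hrung x₀ z (by rw [dist_comm]; exact hD hz) i
    have hdiag := dist_triangle (p y i) (p z i) (p z (i + 1))
    have hyi := hpX i hi.le y hy
    have hzi' := hpX (i + 1) hi z hz
    rw [hk _ hyi _ (hpX i hi.le z hz) _ hzi' (by linarith) (by linarith) (by linarith),
      hk _ hyi _ (hpX (i + 1) hi y hy) _ hzi' (by linarith) (by linarith) (by linarith)]

open Classical in
/-- The integral of the differences `k` along the segment from `x` to `y`; it is `0` by convention
if `k` has no potential on the segment. -/
noncomputable def segmentIntegral (k : E → E → Γ) (x y : E) : Γ :=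
  if h : ∃ φ, IsPotentialOn k (segment ℝ x y) φ then h.choose y - h.choose x else 0

theorem IsPotentialOn.segmentIntegral_eq {x y : E} (h : IsPotentialOn k (segment ℝ x y) φ) :
    segmentIntegral k x y = φ y - φ x := by
  have hex : ∃ φ, IsPotentialOn k (segment ℝ x y) φ := ⟨φ, h⟩
  rw [segmentIntegral, dif_pos hex]
  exact hex.choose_spec.sub_eq h (convex_segment x y) (left_mem_segment ℝ x y)
    (right_mem_segment ℝ x y)

theorem IsPotentialOn.segmentIntegral_add {x y z : E}
    (h : IsPotentialOn k (convexHull ℝ {x, y, z}) φ) :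
    segmentIntegral k x y + segmentIntegral k y z = segmentIntegral k x z := by
  have hside : ∀ p ∈ ({x, y, z} : Set E), ∀ q ∈ ({x, y, z} : Set E),
      segmentIntegral k p q = φ q - φ p := fun p hp q hq =>
    (h.mono ((convex_convexHull ℝ _).segment_subset (subset_convexHull ℝ _ hp)
      (subset_convexHull ℝ _ hq))).segmentIntegral_eq
  rw [hside x (by simp) y (by simp), hside y (by simp) z (by simp), hside x (by simp) z (by simp)]
  abel

theorem segmentIntegral_eq_of_forall_add_eq {x y : E}
    (h : ∀ p ∈ segment ℝ x y, ∀ q ∈ segment ℝ x y, ∀ r ∈ segment ℝ x y, k p q + k q r = k p r) :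
    segmentIntegral k x y = k x y := by
  have hx := left_mem_segment ℝ x y
  have hpot : IsPotentialOn k (segment ℝ x y) (k x) :=
    ⟨1, one_pos, fun p hp q hq _ => by rw [← h x hx p hp q hq, add_sub_cancel_left]⟩
  rw [hpot.segmentIntegral_eq, sub_eq_self]
  simpa using h x hx x hx x hx

end Cocycle

/-! ### Cocycles on the cells of a tiling -/

section TilingCocycle

variable {E : Type*} [NormedAddCommGroup E] [NormedSpace ℝ E] {T : Set (Set E)}
  {Γ : Type*} [AddCommGroup Γ]

namespace IsFaceTiling

theorem exists_lebesgue_number (hT : IsFaceTiling T) {X : Set E} (hX : IsCompact X) :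
    ∃ δ > 0, ∀ x ∈ X, ∃ w ∈ X, ∀ Q ∈ T, (Q ∩ Metric.ball x δ).Nonempty → w ∈ Q := by
  choose r hr h using hT.exists_ball_forall_mem
  obtain ⟨δ, hδ, hcover⟩ := lebesgue_number_lemma_of_metric
    (c := fun w : X => Metric.ball w.1 (r w)) hX (fun _ => Metric.isOpen_ball)
    (fun x hx => mem_iUnion.2 ⟨⟨x, hx⟩, Metric.mem_ball_self (hr x)⟩)
  refine ⟨δ, hδ, fun x hx => ?_⟩
  obtain ⟨w, hw⟩ := hcover x hx
  exact ⟨w, w.2, fun Q hQ hne => h w Q hQ (hne.mono (inter_subset_inter_right _ hw))⟩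

theorem interior_inter_ball_nonempty (hT : IsFaceTiling T) {Q : Set E} (hQ : Q ∈ T) {w : E}
    (hw : w ∈ Q) {r : ℝ} (hr : 0 < r) : (interior Q ∩ Metric.ball w r).Nonempty := by
  have hcl : w ∈ closure (interior Q) := by
    rw [(hT.convex Q hQ).closure_interior_eq_closure_of_nonempty_interior
      (hT.interior_nonempty Q hQ)]
    exact subset_closure hw
  rw [inter_comm]
  exact mem_closure_iff.1 hcl _ Metric.isOpen_ball (Metric.mem_ball_self hr)

end IsFaceTiling

/-- The intersections of three cells that have codimension at least three. A generic triangle does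
not meet their affine hulls. -/
def thinTriples (T : Set (Set E)) : Set (Set E) :=
  {F | (∃ Q ∈ T, ∃ R ∈ T, ∃ S ∈ T, F = Q ∩ R ∩ S) ∧
    finrank ℝ (vectorSpan ℝ F) + 3 ≤ finrank ℝ E}

theorem countable_thinTriples (hT : T.Countable) : (thinTriples T).Countable := by
  refine ((hT.prod (hT.prod hT)).image fun i => i.1 ∩ i.2.1 ∩ i.2.2).mono ?_
  rintro _ ⟨⟨Q, hQ, R, hR, S, hS, rfl⟩, -⟩
  exact ⟨(Q, R, S), ⟨hQ, hR, hS⟩, rfl⟩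

/-- `c` satisfies the cocycle relation on every triple of cells that share a face of codimension
at most two. -/
def IsCellCocycle (T : Set (Set E)) (c : Set E → Set E → Γ) : Prop :=
  ∀ Q ∈ T, ∀ R ∈ T, ∀ S ∈ T, (Q ∩ R ∩ S).Nonempty →
    finrank ℝ E ≤ finrank ℝ (vectorSpan ℝ (Q ∩ R ∩ S)) + 2 → c Q R + c R S = c Q S

namespace IsCellCocycle

variable {c : Set E → Set E → Γ} {cell : E → Set E}

theorem exists_isPotentialOn (hc : IsCellCocycle T c) (hT : IsFaceTiling T)
    (hcell : ∀ x, cell x ∈ T ∧ x ∈ cell x) {X : Set E} (hX : IsCompact X) (hXc : Convex ℝ X)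
    (hthin : ∀ F ∈ thinTriples T, Disjoint X (affineSpan ℝ F)) :
    ∃ φ, IsPotentialOn (fun x y => c (cell x) (cell y)) X φ := by
  obtain ⟨δ, hδ, hleb⟩ := hT.exists_lebesgue_number hX
  refine Parallelohedron.exists_isPotentialOn hXc hX.isBounded hδ
    fun x hx y _ z _ hxy _ hxz => ?_
  obtain ⟨w, hwX, hw⟩ := hleb x hx
  have hw_cell : ∀ y, dist x y < δ → w ∈ cell y := fun y hy =>
    hw _ (hcell y).1 ⟨y, (hcell y).2, by rwa [Metric.mem_ball, dist_comm]⟩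
  have hwxyz : w ∈ cell x ∩ cell y ∩ cell z :=
    ⟨⟨hw_cell x (by rwa [dist_self]), hw_cell y hxy⟩, hw_cell z hxz⟩
  refine hc _ (hcell x).1 _ (hcell y).1 _ (hcell z).1 ⟨w, hwxyz⟩ ?_
  by_contra! hlt
  exact Set.disjoint_left.1 (hthin _ ⟨⟨_, (hcell x).1, _, (hcell y).1, _, (hcell z).1, rfl⟩,
    by omega⟩) hwX (subset_affineSpan ℝ _ hwxyz)

theorem segmentIntegral_add (hc : IsCellCocycle T c) (hT : IsFaceTiling T)
    (hcell : ∀ x, cell x ∈ T ∧ x ∈ cell x) {x y z : E}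
    (hx : ∀ F ∈ thinTriples T, x ∉ affineSpan ℝ F)
    (hy : ∀ F ∈ thinTriples T, y ∉ affineSpan ℝ (insert x F))
    (hz : ∀ F ∈ thinTriples T, z ∉ affineSpan ℝ (insert y (insert x F))) :
    segmentIntegral (fun x y => c (cell x) (cell y)) x y +
      segmentIntegral (fun x y => c (cell x) (cell y)) y z =
      segmentIntegral (fun x y => c (cell x) (cell y)) x z := by
  obtain ⟨φ, hφ⟩ := hc.exists_isPotentialOn hT hcell
    (Set.Finite.isCompact_convexHull ℝ (by simp)) (convex_convexHull ℝ {x, y, z})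
    fun F hF => triangle_disjoint_affineSpan (hx F hF) (hy F hF) (hz F hF)
  exact hφ.segmentIntegral_add

variable [FiniteDimensional ℝ E]

theorem segmentIntegral_eq (hc : IsCellCocycle T c) {Q R : Set E} (hQ : Q ∈ T) (hR : R ∈ T)
    (hne : (Q ∩ R).Nonempty) (hcodim : finrank ℝ E ≤ finrank ℝ (vectorSpan ℝ (Q ∩ R)) + 2)
    {y z : E} (hcell : ∀ p ∈ segment ℝ y z, cell p = Q ∨ cell p = R) :
    segmentIntegral (fun x y => c (cell x) (cell y)) y z = c (cell y) (cell z) := by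
  have hcellT : ∀ p ∈ segment ℝ y z, cell p ∈ T := fun p hp =>
    (hcell p hp).elim (· ▸ hQ) (· ▸ hR)
  have hsub : ∀ p ∈ segment ℝ y z, Q ∩ R ⊆ cell p := fun p hp => (hcell p hp).elim
    (fun h => h ▸ inter_subset_left) (fun h => h ▸ inter_subset_right)
  refine segmentIntegral_eq_of_forall_add_eq fun p hp q hq r hr => ?_
  have hsub_inter := subset_inter (subset_inter (hsub p hp) (hsub q hq)) (hsub r hr)
  refine hc _ (hcellT p hp) _ (hcellT q hq) _ (hcellT r hr) (hne.mono hsub_inter) ?_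
  have := Submodule.finrank_mono (vectorSpan_mono ℝ hsub_inter)
  omega

end IsCellCocycle

end TilingCocycle

section Walk

variable {E : Type*} [NormedAddCommGroup E] [InnerProductSpace ℝ E] {T : Set (Set E)}

/-- The cells `Q` and `R` share a facet whose normal from `Q` to `R` makes an acute or right angle
with `v`, so that a point moving in direction `v` may pass from `Q` to `R`. -/
def CrossesFacet (T : Set (Set E)) (v : E) (Q R : Set E) : Prop :=
  Q ∈ T ∧ R ∈ T ∧ HasCodim 1 (Q ∩ R) ∧
    ∃ n, IsFacetNormal Q (Q ∩ R) n ∧ IsFacetNormal R (Q ∩ R) (-n) ∧ 0 ≤ ⟪n, v⟫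

variable [FiniteDimensional ℝ E] {Q R : Set E}

namespace IsFaceTiling

theorem eq_or_crossesFacet (hT : IsFaceTiling T) (hQ : Q ∈ T) (hR : R ∈ T)
    (hne : (Q ∩ R).Nonempty) (hcodim : finrank ℝ E ≤ finrank ℝ (vectorSpan ℝ (Q ∩ R)) + 1)
    {x y : E} (hx : x ∈ Q) (hy : y ∈ R) {v : E} {t : ℝ} (ht : 0 < t) (hv : y - x = t • v) :
    Q = R ∨ CrossesFacet T v Q R := by
  refine or_iff_not_imp_left.2 fun hQR => ?_
  have hlt := hT.finrank_inter_lt hQ hR hQR hne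
  have hfacet : HasCodim 1 (Q ∩ R) := ⟨hne, by omega⟩
  obtain ⟨n, hn, hn'⟩ := hT.exists_isFacetNormal_inter hQ hR hfacet
  obtain ⟨w, hw⟩ := hne
  refine ⟨hQ, hR, hfacet, n, hn, hn', nonneg_of_mul_nonneg_right ?_ ht⟩
  have hxw := hn.inner_le hx hw
  have hyw := hn'.inner_le hy hw
  rw [← real_inner_smul_right, ← hv, inner_sub_right]
  rw [inner_neg_left, inner_neg_left] at hyw
  linarith

theorem exists_segment_forall_finrank_le (hT : IsFaceTiling T) {U V : Set E} (hU : IsOpen U)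
    (hU_ne : U.Nonempty) (hV : IsOpen V) (hV_ne : V.Nonempty) :
    ∃ x ∈ U, ∃ y ∈ V, ∀ w ∈ segment ℝ x y, ∀ Q ∈ T, ∀ R ∈ T, w ∈ Q ∩ R →
      finrank ℝ E ≤ finrank ℝ (vectorSpan ℝ (Q ∩ R)) + 1 := by
  let thin : Set (Set E × Set E) :=
    {i ∈ T ×ˢ T | finrank ℝ (vectorSpan ℝ (i.1 ∩ i.2)) + 2 ≤ finrank ℝ E}
  have hthin : thin.Countable := (hT.countable.prod hT.countable).mono (sep_subset _ _)
  obtain ⟨x, hxU, hx⟩ := exists_mem_forall_notMem_affineSpan hthin (S := fun i => i.1 ∩ i.2)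
    (fun i hi => by have := hi.2; omega) hU hU_ne
  obtain ⟨y, hyV, hy⟩ := exists_mem_forall_notMem_affineSpan hthin
    (S := fun i => insert x (i.1 ∩ i.2))
    (fun i hi => by
      have := hi.2
      have := finrank_vectorSpan_insert_le_add_one (i.1 ∩ i.2) x
      omega) hV hV_ne
  refine ⟨x, hxU, y, hyV, fun w hwX Q hQ R hR hw => ?_⟩
  by_contra! hlt
  have hmem : (Q, R) ∈ thin := ⟨⟨hQ, hR⟩, hlt⟩
  exact Set.disjoint_left.1 (segment_disjoint_affineSpan (hx _ hmem) (hy _ hmem)) hwX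
    (subset_affineSpan ℝ _ hw)

theorem reflTransGen_crossesFacet (hT : IsFaceTiling T) (hQ : Q ∈ T) (hR : R ∈ T) {x y : E}
    (hx : x ∈ interior Q) (hy : y ∈ interior R)
    (hcodim : ∀ w ∈ segment ℝ x y, ∀ Q ∈ T, ∀ R ∈ T, w ∈ Q ∩ R →
      finrank ℝ E ≤ finrank ℝ (vectorSpan ℝ (Q ∩ R)) + 1) :
    Relation.ReflTransGen (CrossesFacet T (y - x)) Q R := by
  choose cell hcellT hcell using hT.cover
  obtain ⟨δ, hδ, hleb⟩ := hT.exists_lebesgue_number (X := segment ℝ x y)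
    (by rw [← convexHull_pair]; exact Set.Finite.isCompact_convexHull ℝ (by simp))
  obtain ⟨N, hN, hdist⟩ := exists_nat_dist_lineMap_lt (E := E) (dist x y) hδ
  have hN' : (0 : ℝ) < N := Nat.cast_pos.2 hN
  let p (i : ℕ) : E := AffineMap.lineMap x y ((i : ℝ) / N)
  have hp_segment : ∀ i ≤ N, p i ∈ segment ℝ x y := fun i hi => by
    rw [segment_eq_image_lineMap]
    exact ⟨_, unitInterval.div_mem (by positivity) hN'.le (by exact_mod_cast hi), rfl⟩
  have hp_sub : ∀ i, p (i + 1) - p i = (1 / N : ℝ) • (y - x) := fun i => by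
    simp only [p, AffineMap.lineMap_apply_module]
    push_cast
    match_scalars <;> field_simp <;> ring
  have hwalk : ∀ i ≤ N,
      Relation.ReflTransGen (CrossesFacet T (y - x)) (cell (p 0)) (cell (p i)) := by
    intro i hi
    induction i with
    | zero => exact .refl
    | succ i ih =>
      obtain ⟨w, hwX, hw⟩ := hleb (p i) (hp_segment i (by omega))
      have hwi : w ∈ cell (p i) ∩ cell (p (i + 1)) :=
        ⟨hw _ (hcellT _) ⟨p i, hcell _, Metric.mem_ball_self hδ⟩,
          hw _ (hcellT _) ⟨p (i + 1), hcell _, by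
            rw [Metric.mem_ball, dist_comm]
            exact hdist x y le_rfl i⟩⟩
      rcases hT.eq_or_crossesFacet (hcellT _) (hcellT _) ⟨w, hwi⟩
        (hcodim w hwX _ (hcellT _) _ (hcellT _) hwi) (hcell (p i)) (hcell (p (i + 1)))
        (by positivity) (hp_sub i) with heq | hcross
      · exact heq ▸ ih (by omega)
      · exact (ih (by omega)).tail hcross
  have hpx : p 0 = x := by simp [p]
  have hpy : p N = y := by simp [p, div_self hN'.ne']
  have hQR := hwalk N le_rfl
  rwa [hpx, hpy, hT.eq_of_mem_interior hQ (hcellT x) hx (hcell x),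
    hT.eq_of_mem_interior hR (hcellT y) hy (hcell y)] at hQR

theorem exists_reflTransGen_crossesFacet (hT : IsFaceTiling T) (hQ : Q ∈ T) (hR : R ∈ T)
    {U V : Set E} (hU : IsOpen U) (hU_ne : U.Nonempty) (hUQ : U ⊆ interior Q) (hV : IsOpen V)
    (hV_ne : V.Nonempty) (hVR : V ⊆ interior R) :
    ∃ x ∈ U, ∃ y ∈ V, Relation.ReflTransGen (CrossesFacet T (y - x)) Q R := by
  obtain ⟨x, hx, y, hy, hcodim⟩ := hT.exists_segment_forall_finrank_le hU hU_ne hV hV_ne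
  exact ⟨x, hx, y, hy, hT.reflTransGen_crossesFacet hQ hR (hUQ hx) (hVR hy) hcodim⟩

theorem eq_of_forall_adjacent (hT : IsFaceTiling T) {α : Type*} {f : Set E → α}
    (hf : ∀ Q ∈ T, ∀ R ∈ T, HasCodim 1 (Q ∩ R) → f Q = f R) (hQ : Q ∈ T) (hR : R ∈ T) :
    f Q = f R := by
  obtain ⟨x, -, y, -, h⟩ := hT.exists_reflTransGen_crossesFacet hQ hR isOpen_interior
    (hT.interior_nonempty Q hQ) subset_rfl isOpen_interior (hT.interior_nonempty R hR) subset_rfl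
  clear hR
  induction h with
  | refl => rfl
  | tail _ hcross ih => exact ih.trans (hf _ hcross.1 _ hcross.2.1 hcross.2.2.1)

end IsFaceTiling

end Walk

section Potential

variable {E : Type*} [NormedAddCommGroup E] [InnerProductSpace ℝ E] [FiniteDimensional ℝ E]
  {T : Set (Set E)} {Γ : Type*} [AddCommGroup Γ] {c : Set E → Set E → Γ} {cell : E → Set E}

theorem exists_mem_forall_thinTriples_notMem_affineSpan (hT : T.Countable) (x : E) {Y : Set E}
    (hY : Y.Countable) {U : Set E} (hU : IsOpen U) (hne : U.Nonempty) :
    ∃ z ∈ U, ∀ F ∈ thinTriples T, ∀ y ∈ Y, z ∉ affineSpan ℝ (insert y (insert x F)) := by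
  obtain ⟨z, hzU, hz⟩ := exists_mem_forall_notMem_affineSpan
    (I := thinTriples T ×ˢ Y) ((countable_thinTriples hT).prod hY)
    (S := fun i => insert i.2 (insert x i.1)) (fun i hi => by
      have := hi.1.2
      have := finrank_vectorSpan_insert_le_add_one i.1 x
      have := finrank_vectorSpan_insert_le_add_one (insert x i.1) i.2
      omega) hU hne
  exact ⟨z, hzU, fun F hF y hy => hz (F, y) ⟨hF, hy⟩⟩

namespace IsCellCocycle

theorem segmentIntegral_eq_zero_of_mem_interior (hc : IsCellCocycle T c) (hT : IsFaceTiling T)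
    (hcell : ∀ x, cell x ∈ T ∧ x ∈ cell x) {Q : Set E} (hQ : Q ∈ T) {y z : E}
    (hy : y ∈ interior Q) (hz : z ∈ interior Q) :
    segmentIntegral (fun x y => c (cell x) (cell y)) y z = 0 := by
  have hcell_eq : ∀ p ∈ segment ℝ y z, cell p = Q := fun p hp =>
    hT.eq_of_mem_interior hQ (hcell p).1 ((hT.convex Q hQ).interior.segment_subset hy hz hp)
      (hcell p).2
  have hne : Q.Nonempty := ⟨y, interior_subset hy⟩
  have hcodim : finrank ℝ E ≤ finrank ℝ (vectorSpan ℝ Q) + 2 := by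
    rw [vectorSpan_eq_top_of_interior_nonempty ⟨y, hy⟩, finrank_top]
    omega
  rw [hc.segmentIntegral_eq hQ hQ (by rwa [inter_self]) (by rwa [inter_self])
    (fun p hp => .inr (hcell_eq p hp)), hcell_eq y (left_mem_segment ℝ y z),
    hcell_eq z (right_mem_segment ℝ y z)]
  simpa only [add_eq_left] using
    hc Q hQ Q hQ Q hQ (by rwa [inter_self, inter_self]) (by rwa [inter_self, inter_self])

theorem exists_forall_segmentIntegral_eq (hc : IsCellCocycle T c) (hT : IsFaceTiling T)
    (hcell : ∀ x, cell x ∈ T ∧ x ∈ cell x) {Q R : Set E} (hQ : Q ∈ T) (hR : R ∈ T)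
    (h : HasCodim 1 (Q ∩ R)) :
    ∃ w ∈ Q ∩ R, ∃ r > 0, ∀ y ∈ interior Q ∩ Metric.ball w r, ∀ z ∈ interior R ∩ Metric.ball w r,
      segmentIntegral (fun x y => c (cell x) (cell y)) y z = c Q R := by
  obtain ⟨w, hw⟩ := h.1.intrinsicInterior ((hT.convex Q hQ).inter (hT.convex R hR))
  obtain ⟨r, hr, hball⟩ := hT.exists_ball_forall_mem w
  refine ⟨w, intrinsicInterior_subset hw, r, hr, fun y hy z hz => ?_⟩
  rw [hc.segmentIntegral_eq hQ hR h.1 (by have := h.2; omega) fun p hp =>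
    hT.eq_or_eq_of_mem_intrinsicInterior hQ hR (hcell p).1 h hw
      (hball _ (hcell p).1 ⟨p, (hcell p).2, (convex_ball w r).segment_subset hy.2 hz.2 hp⟩),
    hT.eq_of_mem_interior hQ (hcell y).1 hy.1 (hcell y).2,
    hT.eq_of_mem_interior hR (hcell z).1 hz.1 (hcell z).2]

/-- The potential of a cell is the integral of the cocycle from a base point to a generic point of
the cell. -/
theorem exists_potential (hc : IsCellCocycle T c) (hT : IsFaceTiling T) :
    ∃ a : Set E → Γ, ∀ Q ∈ T, ∀ R ∈ T, HasCodim 1 (Q ∩ R) → a R - a Q = c Q R := by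
  choose cell hcellT hcell using hT.cover
  have hcell : ∀ x, cell x ∈ T ∧ x ∈ cell x := fun x => ⟨hcellT x, hcell x⟩
  let I : E → E → Γ := segmentIntegral fun x y => c (cell x) (cell y)
  obtain ⟨x₀, -, hx₀⟩ := exists_mem_forall_notMem_affineSpan (countable_thinTriples hT.countable)
    (S := fun F => F) (fun F hF => by have := hF.2; omega) isOpen_univ univ_nonempty
  have hgeneric : ∀ (Y : Set E) (U : Set E), Y.Countable → IsOpen U → U.Nonempty → ∃ z ∈ U,
      ∀ F ∈ thinTriples T, z ∉ affineSpan ℝ (insert x₀ F) ∧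
        ∀ y ∈ Y, z ∉ affineSpan ℝ (insert y (insert x₀ F)) := by
    intro Y U hY hU hne
    obtain ⟨z, hzU, hz⟩ := exists_mem_forall_thinTriples_notMem_affineSpan hT.countable x₀
      (hY.insert x₀) hU hne
    exact ⟨z, hzU, fun F hF => ⟨by simpa using hz F hF x₀ (mem_insert _ _),
      fun y hy => hz F hF y (mem_insert_of_mem _ hy)⟩⟩
  have hpt : ∀ Q, ∃ y, Q ∈ T → y ∈ interior Q ∧
      ∀ F ∈ thinTriples T, y ∉ affineSpan ℝ (insert x₀ F) := fun Q => by
    by_cases hQ : Q ∈ T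
    · obtain ⟨y, hy, hy'⟩ := hgeneric ∅ _ countable_empty isOpen_interior
        (hT.interior_nonempty Q hQ)
      exact ⟨y, fun _ => ⟨hy, fun F hF => (hy' F hF).1⟩⟩
    · exact ⟨x₀, fun h => (hQ h).elim⟩
  choose pt hpt using hpt
  refine ⟨fun Q => I x₀ (pt Q), fun Q hQ R hR hQR => ?_⟩
  obtain ⟨w, hw, r, hr, hcross⟩ := hc.exists_forall_segmentIntegral_eq hT hcell hQ hR hQR
  obtain ⟨y, hyU, hy⟩ := hgeneric {pt Q} _ (countable_singleton _)
    (isOpen_interior.inter Metric.isOpen_ball) (hT.interior_inter_ball_nonempty hQ hw.1 hr)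
  obtain ⟨z, hzU, hz⟩ := hgeneric {y, pt R} _ (by simp)
    (isOpen_interior.inter Metric.isOpen_ball) (hT.interior_inter_ball_nonempty hR hw.2 hr)
  have hQy := hc.segmentIntegral_add hT hcell hx₀ (hpt Q hQ).2 fun F hF => (hy F hF).2 _ rfl
  have hRz := hc.segmentIntegral_add hT hcell hx₀ (hpt R hR).2
    fun F hF => (hz F hF).2 _ (mem_insert_of_mem _ rfl)
  have hyz := hc.segmentIntegral_add hT hcell hx₀ (fun F hF => (hy F hF).1)
    fun F hF => (hz F hF).2 _ (mem_insert _ _)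
  rw [hc.segmentIntegral_eq_zero_of_mem_interior hT hcell hQ (hpt Q hQ).1 hyU.1, add_zero] at hQy
  rw [hc.segmentIntegral_eq_zero_of_mem_interior hT hcell hR (hpt R hR).1 hzU.1, add_zero] at hRz
  rw [hcross y hyU z hzU, ← hQy, ← hRz] at hyz
  exact sub_eq_iff_eq_add'.2 hyz.symm

end IsCellCocycle

end Potential

/-! ### Faces of codimension two -/

section Ridge

variable {E : Type*} [NormedAddCommGroup E] [NormedSpace ℝ E] {T : Set (Set E)}
  {G Q R F₁ F₂ : Set E}

/-- The facets of the tiling that contain `G`. -/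
def facetsAt (T : Set (Set E)) (G : Set E) : Set (Set E) :=
  {F | HasCodim 1 F ∧ (∃ Q ∈ T, IsExposed ℝ Q F) ∧ G ⊆ F}

/-- The cells of the tiling that contain `G`. -/
def cellsAt (T : Set (Set E)) (G : Set E) : Set (Set E) := {Q ∈ T | G ⊆ Q}

/-- A face of codimension two of some cell of the tiling. -/
structure IsRidge (T : Set (Set E)) (G : Set E) : Prop where
  codim : HasCodim 2 G
  exposed : ∃ Q ∈ T, IsExposed ℝ Q G

namespace IsFaceTiling

theorem inter_mem_facetsAt (hT : IsFaceTiling T) (hQ : Q ∈ cellsAt T G) (hR : R ∈ cellsAt T G)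
    (h : HasCodim 1 (Q ∩ R)) : Q ∩ R ∈ facetsAt T G :=
  ⟨h, ⟨Q, hQ.1, hT.isExposed_inter Q hQ.1 R hR.1⟩, subset_inter hQ.2 hR.2⟩

theorem finite_cellsAt (hT : IsFaceTiling T) (hG : G.Nonempty) : (cellsAt T G).Finite := by
  obtain ⟨g, hg⟩ := hG
  exact (hT.finite_mem g).subset fun _ hQ => ⟨hQ.1, hQ.2 hg⟩

theorem subset_of_mem_intrinsicInterior_ridge (hT : IsFaceTiling T) (hG : IsRidge T G) {g : E}
    (hg : g ∈ intrinsicInterior ℝ G) (hR : R ∈ T) (hgR : g ∈ R) : G ⊆ R := by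
  obtain ⟨Q, hQ, hGQ⟩ := hG.exposed
  exact (subset_of_isExposed_of_mem_intrinsicInterior (hT.isExposed_inter Q hQ R hR) hGQ.subset hg
    ⟨hGQ.subset (intrinsicInterior_subset hg), hgR⟩).trans inter_subset_right

end IsFaceTiling

theorem exists_mem_notMem_of_mem_facetsAt (hG : HasCodim 2 G) (hF : F₁ ∈ facetsAt T G) :
    ∃ y ∈ F₁, y ∉ G := by
  by_contra! hFG
  have hfacet := hF.1.2
  have hridge := hG.2
  rw [hF.2.2.antisymm hFG] at hridge
  omega

variable [FiniteDimensional ℝ E]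

theorem IsFaceTiling.exists_mem_intrinsicInterior_ridge (hT : IsFaceTiling T) (hG : IsRidge T G) :
    ∃ g, g ∈ intrinsicInterior ℝ G := by
  obtain ⟨Q, hQ, hGQ⟩ := hG.exposed
  exact hG.codim.1.intrinsicInterior (hGQ.convex (hT.convex Q hQ))

theorem inter_eq_of_hasCodim_two (hG : HasCodim 2 G) (hGQ : IsExposed ℝ Q G)
    (h₁ : HasCodim 1 F₁) (h₂ : HasCodim 1 F₂) (hF₁ : IsExposed ℝ Q F₁) (hF₂ : IsExposed ℝ Q F₂)
    (hG₁ : G ⊆ F₁) (hG₂ : G ⊆ F₂) (hne : F₁ ≠ F₂) : F₁ ∩ F₂ = G := by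
  have hsub : G ⊆ F₁ ∩ F₂ := subset_inter hG₁ hG₂
  have hlt : finrank ℝ (vectorSpan ℝ (F₁ ∩ F₂)) < finrank ℝ (vectorSpan ℝ F₁) :=
    finrank_vectorSpan_lt_of_isExposed (hF₁.inter hF₂) (hG.1.mono hsub) inter_subset_left
      hF₁.subset fun h => hne (h₁.eq_of_isExposed hF₁ h₂ (inter_eq_left.1 h) hF₂.subset)
  refine (eq_of_isExposed_of_finrank_le hGQ hG.1 hsub (inter_subset_left.trans hF₁.subset) ?_).symm
  have := hG.2
  have := h₁.2
  omega

end Ridge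

section RidgeInner

variable {E : Type*} [NormedAddCommGroup E] [InnerProductSpace ℝ E] [FiniteDimensional ℝ E]
  {T : Set (Set E)} {G Q R F : Set E}

namespace IsFaceTiling

theorem eventually_add_smul_mem (hT : IsFaceTiling T) (hQ : Q ∈ T) {g z : E} (hg : g ∈ Q)
    (hz : ∀ R ∈ T, HasCodim 1 (Q ∩ R) → g ∈ R → ∀ n, IsFacetNormal Q (Q ∩ R) n → ⟪n, z⟫ ≤ 0) :
    ∀ᶠ ε : ℝ in 𝓝[>] 0, g + ε • z ∈ Q := by
  have hfacets : ∀ᶠ ε : ℝ in 𝓝[>] 0, ∀ R ∈ {R ∈ T | (R ∩ Q).Nonempty}, HasCodim 1 (Q ∩ R) →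
      ∃ n, IsFacetNormal Q (Q ∩ R) n ∧ ∃ y ∈ Q ∩ R, ⟪n, g + ε • z⟫ ≤ ⟪n, y⟫ := by
    rw [Filter.eventually_all_finite (hT.finite_inter_compact (hT.compact Q hQ))]
    rintro R ⟨hR, -⟩
    rw [eventually_imp_distrib_left]
    intro hcodim
    obtain ⟨n, hn, -⟩ := hT.exists_isFacetNormal_inter hQ hR hcodim
    by_cases hgR : g ∈ R
    · filter_upwards [self_mem_nhdsWithin] with ε hε
      refine ⟨n, hn, g, ⟨hg, hgR⟩, ?_⟩
      rw [inner_add_right, inner_smul_right]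
      linarith [mul_nonpos_of_nonneg_of_nonpos (le_of_lt hε) (hz R hR hcodim hgR n hn)]
    · obtain ⟨y, hy⟩ := hcodim.1
      have hlt : ⟪n, g⟫ < ⟪n, y⟫ :=
        lt_of_not_ge fun hle => hgR (hn.mem_of_inner_le hg hy hle).2
      have hcont : Tendsto (fun ε : ℝ => ⟪n, g + ε • z⟫) (𝓝[>] 0) (𝓝 ⟪n, g⟫) :=
        ((show Continuous fun ε : ℝ => ⟪n, g + ε • z⟫ by fun_prop).tendsto' 0 _ (by simp)).mono_left
          nhdsWithin_le_nhds
      filter_upwards [hcont.eventually (eventually_lt_nhds hlt)] with ε hε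
      exact ⟨n, hn, y, hy, hε.le⟩
  filter_upwards [hfacets] with ε hε
  by_contra hnot
  obtain ⟨R, hR, hcodim, hsep⟩ := hT.exists_facet_inner_lt_of_notMem hQ hnot
  obtain ⟨n, hn, y, hy, hle⟩ := hε R ⟨hR, inter_comm Q R ▸ hcodim.1⟩ hcodim
  exact (hsep n hn y hy).not_ge hle

theorem mem_vectorSpan_of_forall_inner_eq_zero (hT : IsFaceTiling T) (hQ : Q ∈ T)
    (hGQ : IsExposed ℝ Q G) {g z : E} (hg : g ∈ G)
    (hz : ∀ R ∈ T, HasCodim 1 (Q ∩ R) → g ∈ R → ∀ n, IsFacetNormal Q (Q ∩ R) n → ⟪n, z⟫ = 0) :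
    z ∈ vectorSpan ℝ G := by
  obtain ⟨ε, ⟨hε_add, hε_sub⟩, hε⟩ :=
    (((hT.eventually_add_smul_mem hQ (z := z) (hGQ.subset hg) fun R hR hc hgR n hn =>
      (hz R hR hc hgR n hn).le).and
    (hT.eventually_add_smul_mem hQ (z := -z) (hGQ.subset hg) fun R hR hc hgR n hn => by
      rw [inner_neg_right, hz R hR hc hgR n hn, neg_zero])).and self_mem_nhdsWithin).exists
  have hmem : g + ε • z ∈ G := by
    refine hGQ.isExtreme.left_mem_of_mem_openSegment hε_add hε_sub hg
      ⟨1 / 2, 1 / 2, by norm_num, by norm_num, by norm_num, ?_⟩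
    module
  have hsub := vsub_mem_vectorSpan ℝ hmem hg
  rwa [vsub_eq_sub, add_sub_cancel_left, Submodule.smul_mem_iff _ (ne_of_gt hε)] at hsub

theorem exists_two_facets (hT : IsFaceTiling T) (hQ : Q ∈ T) (hG : HasCodim 2 G)
    (hGQ : IsExposed ℝ Q G) {g : E} (hg : g ∈ G) :
    ∃ R₁ ∈ T, ∃ R₂ ∈ T, R₁ ≠ R₂ ∧ HasCodim 1 (Q ∩ R₁) ∧ HasCodim 1 (Q ∩ R₂) ∧ g ∈ R₁ ∧ g ∈ R₂ := by
  by_contra! hcon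
  obtain ⟨n₀, hn₀⟩ : ∃ n₀ : E, ∀ R ∈ T, HasCodim 1 (Q ∩ R) → g ∈ R →
      ∀ n, IsFacetNormal Q (Q ∩ R) n → n = n₀ := by
    by_cases! h : ∃ R ∈ T, HasCodim 1 (Q ∩ R) ∧ g ∈ R
    · obtain ⟨R₀, hR₀, hc₀, hg₀⟩ := h
      obtain ⟨n₀, hn₀, -⟩ := hT.exists_isFacetNormal_inter hQ hR₀ hc₀
      refine ⟨n₀, fun R hR hc hgR n hn => ?_⟩
      obtain rfl : R₀ = R := by
        by_contra hne
        exact hcon R₀ hR₀ R hR hne hc₀ hc hg₀ hgR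
      exact hn₀.unique (hT.interior_nonempty Q hQ) hc hn
    · exact ⟨0, fun R hR hc hgR => absurd hgR (h R hR hc)⟩
  have hle : (ℝ ∙ n₀)ᗮ ≤ vectorSpan ℝ G := fun z hz =>
    hT.mem_vectorSpan_of_forall_inner_eq_zero hQ hGQ hg fun R hR hc hgR n hn => by
      rw [hn₀ R hR hc hgR n hn]
      exact Submodule.mem_orthogonal_singleton_iff_inner_right.1 hz
  have hspan : finrank ℝ (ℝ ∙ n₀) ≤ 1 := (finrank_span_le_card {n₀}).trans (by simp)
  have := Submodule.finrank_add_finrank_orthogonal (ℝ ∙ n₀)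
  have := Submodule.finrank_mono hle
  have := hG.2
  omega

theorem isExposed_ridge (hT : IsFaceTiling T) (hG : IsRidge T G) (hR : R ∈ cellsAt T G) :
    IsExposed ℝ R G := by
  obtain ⟨g, hg⟩ := hT.exists_mem_intrinsicInterior_ridge hG
  obtain ⟨Q, hQ, hGQ⟩ := hG.exposed
  obtain ⟨hR, hGR⟩ := hR
  rcases eq_or_ne Q R with rfl | hQR
  · exact hGQ
  have hsub : G ⊆ Q ∩ R := subset_inter hGQ.subset hGR
  have hlt := hT.finrank_inter_lt hQ hR hQR (hG.codim.1.mono hsub)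
  have hdim := hG.codim.2
  by_cases hcodim : HasCodim 1 (Q ∩ R)
  · obtain ⟨R₁, hR₁, R₂, hR₂, hne, hc₁, hc₂, hg₁, hg₂⟩ :=
      hT.exists_two_facets hQ hG.codim hGQ (intrinsicInterior_subset hg)
    obtain ⟨S, hS, hSR, hcS, hgS⟩ : ∃ S ∈ T, S ≠ R ∧ HasCodim 1 (Q ∩ S) ∧ g ∈ S := by
      by_cases h : R₁ = R
      · exact ⟨R₂, hR₂, fun h' => hne (h.trans h'.symm), hc₂, hg₂⟩
      · exact ⟨R₁, hR₁, h, hc₁, hg₁⟩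
    have hGS := hT.subset_of_mem_intrinsicInterior_ridge hG hg hS hgS
    have hinter := inter_eq_of_hasCodim_two hG.codim hGQ hcodim hcS (hT.isExposed_inter Q hQ R hR)
      (hT.isExposed_inter Q hQ S hS) hsub (subset_inter hGQ.subset hGS)
      (fun h => hSR (hT.neighbor_unique hQ hR hS hcodim h).symm)
    rw [show G = (R ∩ Q) ∩ (R ∩ S) by grind]
    exact (hT.isExposed_inter R hR Q hQ).inter (hT.isExposed_inter R hR S hS)
  · have hne : finrank ℝ (vectorSpan ℝ (Q ∩ R)) + 1 ≠ finrank ℝ E :=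
      fun h => hcodim ⟨hG.codim.1.mono hsub, h⟩
    rw [eq_of_isExposed_of_finrank_le hGQ hG.codim.1 hsub inter_subset_left (by omega)]
    exact hT.isExposed_inter_right hQ hR

theorem hasCodim_one_of_ne (hT : IsFaceTiling T) (hG : IsRidge T G)
    (hQ : Q ∈ cellsAt T G) (hR : R ∈ cellsAt T G) (hne : Q ≠ R) (hGne : G ≠ Q ∩ R) :
    HasCodim 1 (Q ∩ R) := by
  have hsub : G ⊆ Q ∩ R := subset_inter hQ.2 hR.2
  refine ⟨hG.codim.1.mono hsub, ?_⟩
  have := finrank_vectorSpan_lt_of_isExposed (hT.isExposed_ridge hG hQ) hG.codim.1 hsub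
    inter_subset_left hGne
  have := hT.finrank_inter_lt hQ.1 hR.1 hne (hG.codim.1.mono hsub)
  have := hG.codim.2
  omega

theorem eq_of_forall_adjacent_around (hT : IsFaceTiling T) (hG : IsRidge T G) {α : Type*}
    {f : Set E → α}
    (hf : ∀ Q ∈ cellsAt T G, ∀ R ∈ cellsAt T G, HasCodim 1 (Q ∩ R) → f Q = f R)
    (hQ : Q ∈ cellsAt T G) (hR : R ∈ cellsAt T G) : f Q = f R := by
  -- A generic segment from `Q` to `R` close to `G` meets only cells around `G` and misses `G`.
  obtain ⟨g, hg⟩ := hT.exists_mem_intrinsicInterior_ridge hG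
  have hgG := intrinsicInterior_subset hg
  obtain ⟨r, hr, hball⟩ := hT.exists_ball_forall_mem g
  have hdim := hG.codim.2
  obtain ⟨x, hx, hxG⟩ := exists_mem_forall_notMem_affineSpan (countable_singleton ())
    (S := fun _ => G) (fun _ _ => by omega) (isOpen_interior.inter Metric.isOpen_ball)
    (hT.interior_inter_ball_nonempty hQ.1 (hQ.2 hgG) hr)
  obtain ⟨y, hy, hyG⟩ := exists_mem_forall_notMem_affineSpan (countable_singleton ())
    (S := fun _ => insert x G)
    (fun _ _ => by have := finrank_vectorSpan_insert_le_add_one G x; omega)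
    (isOpen_interior.inter Metric.isOpen_ball)
    (hT.interior_inter_ball_nonempty hR.1 (hR.2 hgG) hr)
  have hseg := segment_disjoint_affineSpan (hxG () rfl) (hyG () rfl)
  have hclosed : ∀ p : Set E → Prop, IsClosed (⋃ S ∈ {S ∈ cellsAt T G | p S}, S) := fun p =>
    ((hT.finite_cellsAt hG.codim.1).subset (sep_subset _ _)).isClosed_biUnion
      fun S hS => (hT.compact S hS.1.1).isClosed
  by_contra hne
  obtain ⟨z, hz, hz_eq, hz_ne⟩ := isPreconnected_closed_iff.1 (convex_segment x y).isPreconnected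
    _ _ (hclosed (f · = f Q)) (hclosed (f · ≠ f Q))
    (fun z hz => by
      obtain ⟨S, hS, hzS⟩ := hT.cover z
      have hSG : S ∈ cellsAt T G := ⟨hS, hT.subset_of_mem_intrinsicInterior_ridge hG hg hS
        (hball S hS ⟨z, hzS, (convex_ball g r).segment_subset hx.2 hy.2 hz⟩)⟩
      rcases eq_or_ne (f S) (f Q) with h | h
      · exact Or.inl (mem_biUnion (x := S) ⟨hSG, h⟩ hzS)
      · exact Or.inr (mem_biUnion (x := S) ⟨hSG, h⟩ hzS))
    ⟨x, left_mem_segment ℝ x y, mem_biUnion (x := Q) ⟨hQ, rfl⟩ (interior_subset hx.1)⟩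
    ⟨y, right_mem_segment ℝ x y, mem_biUnion (x := R) ⟨hR, Ne.symm hne⟩ (interior_subset hy.1)⟩
  obtain ⟨S, ⟨hS, hfS⟩, hzS⟩ := mem_iUnion₂.1 hz_eq
  obtain ⟨S', ⟨hS', hfS'⟩, hzS'⟩ := mem_iUnion₂.1 hz_ne
  refine hfS' (hfS ▸ (hf S hS S' hS' ?_).symm)
  refine hT.hasCodim_one_of_ne hG hS hS' (fun h => hfS' (h ▸ hfS)) fun h => ?_
  exact Set.disjoint_left.1 hseg hz (subset_affineSpan ℝ _ (h ▸ ⟨hzS, hzS'⟩))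

theorem exists_cells_of_normal (hT : IsFaceTiling T) (hF : HasCodim 1 F)
    (hQ : ∃ Q ∈ T, IsExposed ℝ Q F) {n : E} (hn : ‖n‖ = 1)
    (hn_orth : ∀ v ∈ vectorSpan ℝ F, ⟪n, v⟫ = 0) :
    ∃ Q ∈ T, ∃ R ∈ T, Q ∩ R = F ∧ IsFacetNormal Q F n ∧ IsFacetNormal R F (-n) := by
  obtain ⟨Q, hQ, hFQ⟩ := hQ
  obtain ⟨R, hR, -, rfl⟩ := hT.exists_inter_eq_of_isExposed hQ hF hFQ
  obtain ⟨ν, hνQ, hνR⟩ := hT.exists_isFacetNormal_inter hQ hR hF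
  rcases eq_or_eq_neg_of_orthogonal hF hνQ.1 hn (fun u => hνQ.inner_eq_zero) hn_orth
    with rfl | rfl
  · exact ⟨Q, hQ, R, hR, rfl, hνQ, hνR⟩
  · exact ⟨R, hR, Q, hQ, inter_comm _ _, hνR, by rwa [neg_neg]⟩

theorem eq_of_isFacetNormal (hT : IsFaceTiling T) {n : E} (hQ : Q ∈ T) (hR : R ∈ T)
    (hF : HasCodim 1 F) (h : IsFacetNormal Q F n) (h' : IsFacetNormal R F n) : Q = R := by
  obtain ⟨x, hx, hx'⟩ := interior_inter_interior_nonempty_of_isFacetNormal (hT.convex Q hQ)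
    (hT.interior_nonempty Q hQ) (hT.convex R hR) (hT.interior_nonempty R hR) hF h h'
  exact (hT.eq_of_mem_interior hQ hR hx (interior_subset hx')).symm

end IsFaceTiling

end RidgeInner

/-! ### Normals directed around a face of codimension two -/

section Coherent

variable {E : Type*} [NormedAddCommGroup E] [InnerProductSpace ℝ E] {T : Set (Set E)}
  {G Q F₁ F₂ : Set E} {ω : E →ₗ[ℝ] E →ₗ[ℝ] ℝ} {n : Set E → E}

/-- `n` assigns to the facets around `G` unit normals directed according to the orientation `ω` of
the quotient of the space by the directions of `G`. -/
structure IsCoherent (T : Set (Set E)) (G : Set E) (ω : E →ₗ[ℝ] E →ₗ[ℝ] ℝ) (n : Set E → E) :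
    Prop where
  alt : ω.IsAlt
  ker : ∀ v ∈ vectorSpan ℝ G, ω v = 0
  norm : ∀ F ∈ facetsAt T G, ‖n F‖ = 1
  orth : ∀ F ∈ facetsAt T G, ∀ v ∈ vectorSpan ℝ F, ⟪n F, v⟫ = 0
  pos : ∀ F ∈ facetsAt T G, ∀ x ∈ G, ∀ y ∈ F \ G, 0 < ω (y - x) (n F)

theorem IsCoherent.neg (h : IsCoherent T G ω n) : IsCoherent T G (-ω) (-n) where
  alt x := by simp [h.alt x]
  ker v hv := by simp [h.ker v hv]
  norm F hF := by simp [h.norm F hF]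
  orth F hF v hv := by simp [h.orth F hF v hv]
  pos F hF x hx y hy := by simpa using h.pos F hF x hx y hy

variable [FiniteDimensional ℝ E] {m₁ m₂ : E}

theorem span_pair_eq_orthogonal_vectorSpan (hG : HasCodim 2 G)
    (hli : LinearIndependent ℝ ![m₁, m₂]) (h₁ : ∀ u ∈ vectorSpan ℝ G, ⟪m₁, u⟫ = 0)
    (h₂ : ∀ u ∈ vectorSpan ℝ G, ⟪m₂, u⟫ = 0) :
    Submodule.span ℝ {m₁, m₂} = (vectorSpan ℝ G)ᗮ := by
  refine Submodule.eq_of_le_of_finrank_le (Submodule.span_le.2 ?_) ?_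
  · rintro m (rfl | rfl)
    exacts [(Submodule.mem_orthogonal' _ _).2 h₁, (Submodule.mem_orthogonal' _ _).2 h₂]
  · have hspan := finrank_span_eq_card hli
    rw [Matrix.range_cons_cons_empty, Fintype.card_fin] at hspan
    have := Submodule.finrank_add_finrank_orthogonal (vectorSpan ℝ G)
    have := hG.2
    omega

theorem exists_sub_mem_vectorSpan (hG : HasCodim 2 G)
    (hli : LinearIndependent ℝ ![m₁, m₂]) (h₁ : ∀ u ∈ vectorSpan ℝ G, ⟪m₁, u⟫ = 0)
    (h₂ : ∀ u ∈ vectorSpan ℝ G, ⟪m₂, u⟫ = 0) (u : E) :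
    ∃ p q : ℝ, u - (p • m₁ + q • m₂) ∈ vectorSpan ℝ G := by
  obtain ⟨v, hv, w, hw, rfl⟩ := (vectorSpan ℝ G).exists_add_mem_mem_orthogonal u
  rw [← span_pair_eq_orthogonal_vectorSpan hG hli h₁ h₂] at hw
  obtain ⟨p, q, rfl⟩ := Submodule.mem_span_pair.1 hw
  exact ⟨p, q, by rwa [add_sub_cancel_right]⟩

theorem apply_apply_neg_of_inner_neg (hG : HasCodim 2 G) (hω : ω.IsAlt)
    (hker : ∀ v ∈ vectorSpan ℝ G, ω v = 0) (hm₁ : ‖m₁‖ = 1) (hm₂ : ‖m₂‖ = 1)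
    (h₁ : ∀ v ∈ vectorSpan ℝ G, ⟪m₁, v⟫ = 0) (h₂ : ∀ v ∈ vectorSpan ℝ G, ⟪m₂, v⟫ = 0) {u : E}
    (hu₁ : ⟪m₁, u⟫ = 0) (hu₂ : ⟪m₂, u⟫ < 0) (hu : 0 < ω u m₁) : ω m₂ m₁ < 0 := by
  have hli : LinearIndependent ℝ ![m₁, m₂] := by
    rw [LinearIndependent.pair_iff' (norm_ne_zero_iff.1 (hm₁ ▸ one_ne_zero))]
    rintro a rfl
    rw [inner_smul_left, hu₁, mul_zero] at hu₂
    exact hu₂.false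
  obtain ⟨p, q, hpq⟩ := exists_sub_mem_vectorSpan hG hli h₁ h₂ u
  have hinner : ∀ m, (∀ v ∈ vectorSpan ℝ G, ⟪m, v⟫ = 0) → ⟪m, u⟫ = p * ⟪m, m₁⟫ + q * ⟪m, m₂⟫ := by
    intro m hm
    rw [← inner_smul_right, ← inner_smul_right, ← inner_add_right, ← sub_eq_zero,
      ← inner_sub_right, hm _ hpq]
  have hωu : ω u m₁ = q * ω m₂ m₁ := by
    rw [sub_eq_zero.1 ((map_sub ω _ _).symm.trans (hker _ hpq))]
    simp [hω m₁]
  have hq : q * (1 - ⟪m₁, m₂⟫ ^ 2) < 0 := by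
    rw [hinner m₁ h₁, real_inner_self_eq_norm_sq, hm₁] at hu₁
    rw [hinner m₂ h₂, real_inner_self_eq_norm_sq, hm₂, real_inner_comm] at hu₂
    linear_combination hu₂ - ⟪m₁, m₂⟫ * hu₁
  have hcauchy : 0 ≤ 1 - ⟪m₁, m₂⟫ ^ 2 := by
    have := abs_real_inner_le_norm m₁ m₂
    rw [hm₁, hm₂, mul_one] at this
    linarith [(sq_le_one_iff_abs_le_one _).2 this]
  exact neg_of_mul_pos_right (hωu ▸ hu) (neg_of_mul_neg_left hq hcauchy).le

theorem IsCoherent.eq_of_isFacetNormal (hG : HasCodim 2 G) (h : IsCoherent T G ω n)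
    (hGQ : IsExposed ℝ Q G) (hF₁ : F₁ ∈ facetsAt T G) (hF₂ : F₂ ∈ facetsAt T G)
    (hn₁ : IsFacetNormal Q F₁ (n F₁)) (hn₂ : IsFacetNormal Q F₂ (n F₂)) : F₁ = F₂ := by
  by_contra hne
  have hinter := inter_eq_of_hasCodim_two hG hGQ hF₁.1 hF₂.1 hn₁.isExposed hn₂.isExposed
    hF₁.2.2 hF₂.2.2 hne
  obtain ⟨g, hg⟩ := hG.1
  -- Each of the two facets lies on the inner side of the other one; if both normals were outer
  -- normals of `Q`, then going around `G` from one to the other would reverse the orientation.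
  have hneg : ∀ F ∈ facetsAt T G, ∀ F' ∈ facetsAt T G, F ∩ F' = G → IsFacetNormal Q F (n F) →
      IsFacetNormal Q F' (n F') → ω (n F') (n F) < 0 := by
    intro F hF F' hF' hFF' hn hn'
    obtain ⟨y, hy, hyG⟩ := exists_mem_notMem_of_mem_facetsAt hG hF
    refine apply_apply_neg_of_inner_neg hG h.alt h.ker hn.1 hn'.1
      (fun v hv => hn.inner_eq_zero (vectorSpan_mono ℝ hF.2.2 hv))
      (fun v hv => hn'.inner_eq_zero (vectorSpan_mono ℝ hF'.2.2 hv))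
      (hn.inner_eq_zero (vsub_mem_vectorSpan ℝ hy (hF.2.2 hg))) ?_ (h.pos F hF g hg y ⟨hy, hyG⟩)
    rw [vsub_eq_sub, inner_sub_right, sub_neg]
    exact lt_of_not_ge fun hle =>
      hyG (hFF' ▸ ⟨hy, hn'.mem_of_inner_le (hn.subset hy) (hF'.2.2 hg) hle⟩)
  have h₂₁ := hneg F₁ hF₁ F₂ hF₂ hinter hn₁ hn₂
  have h₁₂ := hneg F₂ hF₂ F₁ hF₁ (inter_comm F₁ F₂ ▸ hinter) hn₂ hn₁
  rw [← h.alt.neg] at h₁₂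
  linarith

end Coherent

/-! ### Potentials around a face of codimension two -/

section Cycle

variable {ι Γ : Type*} [AddCommGroup Γ] {σ : Equiv.Perm ι}

theorem sum_range_pow_apply_eq_sum {s : Finset ι} (hσ : σ.IsCycleOn s) {x : ι} (hx : x ∈ s)
    (h : ι → Γ) : ∑ j ∈ Finset.range s.card, h ((σ ^ j) x) = ∑ y ∈ s, h y := by
  refine Finset.sum_bij (fun j _ => (σ ^ j) x)
    (fun j _ => (hσ.1.perm_pow j).mapsTo hx) ?_ ?_ fun _ _ => rfl
  · intro i hi j hj hij
    rw [hσ.pow_apply_eq_pow_apply hx] at hij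
    exact hij.eq_of_lt_of_lt (Finset.mem_range.1 hi) (Finset.mem_range.1 hj)
  · intro y hy
    obtain ⟨j, hj, rfl⟩ := hσ.exists_pow_eq hx hy
    exact ⟨j, Finset.mem_range.2 hj, rfl⟩

theorem exists_sub_eq_of_sum_eq_zero [Fintype ι] (hσ : ∀ x y, σ.SameCycle x y) {h : ι → Γ}
    (hsum : ∑ i, h i = 0) : ∃ a : ι → Γ, ∀ x, a (σ x) - a x = h x := by
  rcases isEmpty_or_nonempty ι with hι | ⟨⟨x₀⟩⟩
  · exact ⟨0, fun x => hι.elim x⟩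
  have hcyc : σ.IsCycleOn ((Finset.univ : Finset ι) : Set ι) := ⟨by simp, fun x _ y _ => hσ x y⟩
  let partialSum : ℕ → Γ := fun m => ∑ j ∈ Finset.range m, h ((σ ^ j) x₀)
  have hper : Function.Periodic partialSum (Finset.univ : Finset ι).card := fun m => by
    have hperiod := (sum_range_pow_apply_eq_sum hcyc (Finset.mem_univ ((σ ^ m) x₀)) h).trans hsum
    simp only [← Equiv.Perm.mul_apply, ← pow_add, add_comm _ m] at hperiod
    rw [show partialSum _ = _ from Finset.sum_range_add _ _ _, hperiod, add_zero]
  have hreach : ∀ x, ∃ m : ℕ, (σ ^ m) x₀ = x := fun x =>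
    let ⟨m, _, hm⟩ := hcyc.exists_pow_eq (Finset.mem_univ x₀) (Finset.mem_univ x)
    ⟨m, hm⟩
  choose index hindex using hreach
  refine ⟨fun x => partialSum (index x), fun x => ?_⟩
  have hsucc : partialSum (index (σ x)) = partialSum (index x + 1) := by
    have hpow : (σ ^ index (σ x)) x₀ = (σ ^ (index x + 1)) x₀ := by
      rw [hindex, pow_succ', Equiv.Perm.mul_apply, hindex]
    rw [hcyc.pow_apply_eq_pow_apply (Finset.mem_univ x₀)] at hpow
    rw [← hper.map_mod_nat, ← hper.map_mod_nat (index x + 1)]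
    exact congrArg partialSum hpow
  change partialSum (index (σ x)) - partialSum (index x) = h x
  rw [hsucc, show partialSum (index x + 1) = _ from Finset.sum_range_succ _ _,
    add_sub_cancel_left, hindex]

end Cycle

section Matching

variable {E : Type*} [NormedAddCommGroup E] [InnerProductSpace ℝ E] {T : Set (Set E)}
  {G Q R : Set E} {n : Set E → E} {src tgt : Set E → Set E}

/-- The facets around `G` are matched with the cells around `G` in two ways, namely with the cell
on the negative side and with the cell on the positive side of the normal `n F`. -/
structure IsMatching (T : Set (Set E)) (G : Set E) (n : Set E → E) (src tgt : Set E → Set E) :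
    Prop where
  bijOn_src : BijOn src (facetsAt T G) (cellsAt T G)
  bijOn_tgt : BijOn tgt (facetsAt T G) (cellsAt T G)
  inter : ∀ F ∈ facetsAt T G, src F ∩ tgt F = F
  normal_src : ∀ F ∈ facetsAt T G, IsFacetNormal (src F) F (n F)
  normal_tgt : ∀ F ∈ facetsAt T G, IsFacetNormal (tgt F) F (-(n F))

/-- The permutation of the cells around `G` that moves each cell across the facet whose normal
points out of it. -/
noncomputable def IsMatching.rotation (h : IsMatching T G n src tgt) :
    Equiv.Perm (cellsAt T G) :=
  (h.bijOn_src.equiv src).symm.trans (h.bijOn_tgt.equiv tgt)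

theorem IsMatching.rotation_src (h : IsMatching T G n src tgt) (F : facetsAt T G) :
    h.rotation (h.bijOn_src.equiv src F) = h.bijOn_tgt.equiv tgt F := by
  simp [rotation]

theorem IsMatching.finsum_sub_eq_zero {Γ : Type*} [AddCommGroup Γ] (h : IsMatching T G n src tgt)
    (hfin : (cellsAt T G).Finite) (u : Set E → Γ) :
    ∑ᶠ F ∈ facetsAt T G, (u (tgt F) - u (src F)) = 0 := by
  rw [finsum_mem_sub_distrib _ _ (.of_injOn h.bijOn_src.mapsTo h.bijOn_src.injOn hfin),
    finsum_mem_eq_of_bijOn tgt h.bijOn_tgt fun _ _ => rfl,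
    finsum_mem_eq_of_bijOn (g := u) src h.bijOn_src fun _ _ => rfl, sub_self]

variable [FiniteDimensional ℝ E] {ω : E →ₗ[ℝ] E →ₗ[ℝ] ℝ}

namespace IsFaceTiling

theorem exists_outer_facet (hT : IsFaceTiling T) (hG : IsRidge T G) (h : IsCoherent T G ω n)
    (hQ : Q ∈ cellsAt T G) : ∃ F ∈ facetsAt T G, IsFacetNormal Q F (n F) := by
  obtain ⟨g, hg⟩ := hT.exists_mem_intrinsicInterior_ridge hG
  have hGQ := hT.isExposed_ridge hG hQ
  obtain ⟨R₁, hR₁, R₂, hR₂, hne, hc₁, hc₂, hg₁, hg₂⟩ :=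
    hT.exists_two_facets hQ.1 hG.codim hGQ (intrinsicInterior_subset hg)
  by_contra! hcon
  have hinner : ∀ R ∈ T, HasCodim 1 (Q ∩ R) → g ∈ R → Q ∩ R ∈ facetsAt T G ∧
      IsFacetNormal Q (Q ∩ R) ((-n) (Q ∩ R)) := by
    intro R hR hc hgR
    have hF := hT.inter_mem_facetsAt hQ
      ⟨hR, hT.subset_of_mem_intrinsicInterior_ridge hG hg hR hgR⟩ hc
    refine ⟨hF, ?_⟩
    obtain ⟨ν, hν, -⟩ := hT.exists_isFacetNormal_inter hQ.1 hR hc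
    rcases eq_or_eq_neg_of_orthogonal hc hν.1 (h.norm _ hF) (fun u => hν.inner_eq_zero)
      (h.orth _ hF) with heq | heq
    · exact absurd (heq ▸ hν) (hcon _ hF)
    · rwa [Pi.neg_apply, heq, neg_neg]
  obtain ⟨hF₁, hn₁⟩ := hinner R₁ hR₁ hc₁ hg₁
  obtain ⟨hF₂, hn₂⟩ := hinner R₂ hR₂ hc₂ hg₂
  exact hne (hT.neighbor_unique hQ.1 hR₁ hR₂ hc₁
    (h.neg.eq_of_isFacetNormal hG.codim hGQ hF₁ hF₂ hn₁ hn₂))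

theorem bijOn_of_isCoherent (hT : IsFaceTiling T) (hG : IsRidge T G) (h : IsCoherent T G ω n)
    {cell : Set E → Set E} (hcell : ∀ F ∈ facetsAt T G, cell F ∈ T)
    (hn : ∀ F ∈ facetsAt T G, IsFacetNormal (cell F) F (n F)) :
    BijOn cell (facetsAt T G) (cellsAt T G) := by
  have hmaps : MapsTo cell (facetsAt T G) (cellsAt T G) := fun F hF =>
    ⟨hcell F hF, hF.2.2.trans (hn F hF).subset⟩
  refine ⟨hmaps, fun F₁ hF₁ F₂ hF₂ heq => ?_, fun Q hQ => ?_⟩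
  · exact h.eq_of_isFacetNormal hG.codim (hT.isExposed_ridge hG (hmaps hF₁)) hF₁ hF₂ (hn F₁ hF₁)
      (heq ▸ hn F₂ hF₂)
  · obtain ⟨F, hF, hQF⟩ := hT.exists_outer_facet hG h hQ
    exact ⟨F, hF, hT.eq_of_isFacetNormal (hcell F hF) hQ.1 hF.1 (hn F hF) hQF⟩

theorem exists_isMatching (hT : IsFaceTiling T) (hG : IsRidge T G) (h : IsCoherent T G ω n) :
    ∃ src tgt, IsMatching T G n src tgt := by
  have hex : ∀ F ∈ facetsAt T G, ∃ Q ∈ T, ∃ R ∈ T, Q ∩ R = F ∧ IsFacetNormal Q F (n F) ∧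
      IsFacetNormal R F (-(n F)) := fun F hF =>
    hT.exists_cells_of_normal hF.1 hF.2.1 (h.norm F hF) (h.orth F hF)
  choose! src hsrc tgt htgt hinter hn_src hn_tgt using hex
  exact ⟨src, tgt, hT.bijOn_of_isCoherent hG h hsrc hn_src,
    hT.bijOn_of_isCoherent hG h.neg htgt hn_tgt, hinter, hn_src, hn_tgt⟩

theorem src_tgt_eq (hT : IsFaceTiling T) (h : IsMatching T G n src tgt) (hQ : Q ∈ cellsAt T G)
    (hR : R ∈ cellsAt T G) (hc : HasCodim 1 (Q ∩ R)) :
    (src (Q ∩ R) = Q ∧ tgt (Q ∩ R) = R) ∨ (src (Q ∩ R) = R ∧ tgt (Q ∩ R) = Q) := by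
  have hF := hT.inter_mem_facetsAt hQ hR hc
  have hsrc := (h.bijOn_src.mapsTo hF).1
  have htgt := (h.bijOn_tgt.mapsTo hF).1
  have hn_src := h.normal_src _ hF
  have hn_tgt := h.normal_tgt _ hF
  obtain ⟨ν, hνQ, hνR⟩ := hT.exists_isFacetNormal_inter hQ.1 hR.1 hc
  rcases eq_or_eq_neg_of_orthogonal hc hνQ.1 hn_src.1 (fun u => hνQ.inner_eq_zero)
    (fun u => hn_src.inner_eq_zero) with heq | heq
  · rw [heq] at hn_src hn_tgt
    exact Or.inl ⟨hT.eq_of_isFacetNormal hsrc hQ.1 hc hn_src hνQ,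
      hT.eq_of_isFacetNormal htgt hR.1 hc hn_tgt hνR⟩
  · rw [heq] at hn_src hn_tgt
    rw [neg_neg] at hn_tgt
    exact Or.inr ⟨hT.eq_of_isFacetNormal hsrc hR.1 hc hn_src hνR,
      hT.eq_of_isFacetNormal htgt hQ.1 hc hn_tgt hνQ⟩

theorem rotation_eq_or_rotation_eq (hT : IsFaceTiling T) (h : IsMatching T G n src tgt)
    (Q R : cellsAt T G) (hc : HasCodim 1 (Q.1 ∩ R.1)) : h.rotation Q = R ∨ h.rotation R = Q := by
  have hF := hT.inter_mem_facetsAt Q.2 R.2 hc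
  have hrot := h.rotation_src ⟨_, hF⟩
  rcases hT.src_tgt_eq h Q.2 R.2 hc with ⟨hsrc, htgt⟩ | ⟨hsrc, htgt⟩
  · rw [show h.bijOn_src.equiv src ⟨_, hF⟩ = Q from Subtype.ext hsrc,
      show h.bijOn_tgt.equiv tgt ⟨_, hF⟩ = R from Subtype.ext htgt] at hrot
    exact Or.inl hrot
  · rw [show h.bijOn_src.equiv src ⟨_, hF⟩ = R from Subtype.ext hsrc,
      show h.bijOn_tgt.equiv tgt ⟨_, hF⟩ = Q from Subtype.ext htgt] at hrot
    exact Or.inr hrot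

theorem sameCycle_rotation (hT : IsFaceTiling T) (hG : IsRidge T G)
    (h : IsMatching T G n src tgt) (Q R : cellsAt T G) : h.rotation.SameCycle Q R := by
  have hadj : ∀ S S' : cellsAt T G, HasCodim 1 (S.1 ∩ S'.1) → h.rotation.SameCycle S S' := by
    intro S S' hc
    rcases hT.rotation_eq_or_rotation_eq h S S' hc with hrot | hrot <;> rw [← hrot]
    exacts [Equiv.Perm.sameCycle_apply_right.2 (.refl _ _),
      Equiv.Perm.sameCycle_apply_left.2 (.refl _ _)]
  have hconst := hT.eq_of_forall_adjacent_around hG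
    (f := fun S => ∃ hS : S ∈ cellsAt T G, h.rotation.SameCycle Q ⟨S, hS⟩)
    (fun S hS S' hS' hc => propext
      ⟨fun ⟨_, hQS⟩ => ⟨hS', hQS.trans (hadj ⟨S, hS⟩ ⟨S', hS'⟩ hc)⟩,
        fun ⟨_, hQS'⟩ => ⟨hS, hQS'.trans (hadj ⟨S, hS⟩ ⟨S', hS'⟩ hc).symm⟩⟩) Q.2 R.2
  obtain ⟨_, hQR⟩ := hconst.mp ⟨Q.2, .refl _ _⟩
  exact hQR

theorem exists_potential_around (hT : IsFaceTiling T) (hG : IsRidge T G)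
    (h : IsMatching T G n src tgt) {Γ : Type*} [AddCommGroup Γ] {c : Set E → Set E → Γ}
    (hc : ∀ Q ∈ T, ∀ R ∈ T, HasCodim 1 (Q ∩ R) → c R Q = -c Q R)
    (hsum : ∑ᶠ F ∈ facetsAt T G, c (src F) (tgt F) = 0) :
    ∃ a : Set E → Γ, ∀ Q ∈ cellsAt T G, ∀ R ∈ cellsAt T G, HasCodim 1 (Q ∩ R) →
      a R - a Q = c Q R := by
  classical
  have : Fintype (cellsAt T G) := (hT.finite_cellsAt hG.codim.1).fintype
  have : Fintype (facetsAt T G) := Fintype.ofEquiv _ (h.bijOn_src.equiv src).symm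
  have hsum_cells : ∑ Q : cellsAt T G, c Q.1 (h.rotation Q).1 = 0 := by
    rw [← hsum, ← finsum_set_coe_eq_finsum_mem, finsum_eq_sum_of_fintype,
      ← Equiv.sum_comp (h.bijOn_src.equiv src)]
    exact Finset.sum_congr rfl fun F _ => by rw [h.rotation_src]; rfl
  obtain ⟨a, ha⟩ := exists_sub_eq_of_sum_eq_zero (hT.sameCycle_rotation hG h) hsum_cells
  refine ⟨fun S => if hS : S ∈ cellsAt T G then a ⟨S, hS⟩ else 0, fun Q hQ R hR hcodim => ?_⟩
  simp only [dif_pos hQ, dif_pos hR]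
  rcases hT.rotation_eq_or_rotation_eq h ⟨Q, hQ⟩ ⟨R, hR⟩ hcodim with hrot | hrot
  · have haQ := ha ⟨Q, hQ⟩
    rw [hrot] at haQ
    exact haQ
  · have haR := ha ⟨R, hR⟩
    rw [hrot] at haR
    rw [← neg_sub, haR, hc Q hQ.1 R hR.1 hcodim, neg_neg]

end IsFaceTiling

end Matching

section ExistsCoherent

variable {E : Type*} [NormedAddCommGroup E] [InnerProductSpace ℝ E]

theorem exists_isAlt_ne_zero_of_finrank_orthogonal {W : Submodule ℝ E} (hW : finrank ℝ Wᗮ = 2) :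
    ∃ ω : E →ₗ[ℝ] E →ₗ[ℝ] ℝ, ω ≠ 0 ∧ ω.IsAlt ∧ ∀ v ∈ W, ω v = 0 := by
  have : FiniteDimensional ℝ Wᗮ := FiniteDimensional.of_finrank_pos (hW ▸ two_pos)
  let b := (stdOrthonormalBasis ℝ Wᗮ).reindex (finCongr hW)
  have hinner (i j : Fin 2) : ⟪(b i : E), b j⟫ = if i = j then 1 else 0 :=
    orthonormal_iff_ite.1 b.orthonormal i j
  have hb (i : Fin 2) {v : E} (hv : v ∈ W) : ⟪(b i : E), v⟫ = 0 :=
    Submodule.inner_left_of_mem_orthogonal hv (b i).2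
  let ω : E →ₗ[ℝ] E →ₗ[ℝ] ℝ := (innerₛₗ ℝ (b 0 : E)).smulRight (innerₛₗ ℝ (b 1 : E)) -
    (innerₛₗ ℝ (b 1 : E)).smulRight (innerₛₗ ℝ (b 0 : E))
  have hω (x y : E) :
      ω x y = ⟪(b 0 : E), x⟫ * ⟪(b 1 : E), y⟫ - ⟪(b 1 : E), x⟫ * ⟪(b 0 : E), y⟫ := by
    simp [ω]
  refine ⟨ω, fun h => ?_, fun x => ?_, fun v hv => LinearMap.ext fun y => ?_⟩
  · have := hω (b 0) (b 1)
    simp [h, hinner, b.orthonormal.ne_zero] at this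
  · rw [hω, mul_comm, sub_self]
  · simp [hω, hb _ hv]

theorem lt_apply_of_isExtreme {V : Type*} [AddCommGroup V] [Module ℝ V] {Q G F : Set V}
    (hG : IsExtreme ℝ Q G) (hFQ : F ⊆ Q) (hF : Convex ℝ F) {l : V →ₗ[ℝ] ℝ} {c : ℝ}
    (hl : ∀ x ∈ F, l x = c → x ∈ G) {y z : V} (hy : y ∈ F \ G) (hz : z ∈ F \ G) (hly : c < l y) :
    c < l z := by
  by_contra! hle
  have hlz : l z < c := hle.lt_of_ne fun h => hz.2 (hl z hz.1 h)
  have hc : c ∈ l '' openSegment ℝ z y := by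
    rw [← l.coe_toAffineMap, image_openSegment, l.coe_toAffineMap,
      openSegment_eq_Ioo (hlz.trans hly)]
    exact ⟨hlz, hly⟩
  obtain ⟨x, hx, hlx⟩ := hc
  exact hz.2 (hG.left_mem_of_mem_openSegment (hFQ hz.1) (hFQ hy.1)
    (hl x (hF.openSegment_subset hz.1 hy.1 hx) hlx) hx)

variable [FiniteDimensional ℝ E] {T : Set (Set E)} {G F : Set E} {ω : E →ₗ[ℝ] E →ₗ[ℝ] ℝ} {n : E}

theorem mem_vectorSpan_of_apply_eq_zero (hG : HasCodim 2 G) (hω_ne : ω ≠ 0) (hω : ω.IsAlt)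
    (hker : ∀ v ∈ vectorSpan ℝ G, ω v = 0) (hn : n ≠ 0) (hnG : ∀ v ∈ vectorSpan ℝ G, ⟪n, v⟫ = 0)
    {u : E} (hnu : ⟪n, u⟫ = 0) (hu : ω u n = 0) : u ∈ vectorSpan ℝ G := by
  obtain ⟨v, hv, w, hw, rfl⟩ := (vectorSpan ℝ G).exists_add_mem_mem_orthogonal u
  rw [inner_add_right, hnG v hv, zero_add] at hnu
  rw [map_add, hker v hv, zero_add] at hu
  by_contra hvw
  have hw_ne : w ≠ 0 := by
    rintro rfl
    exact hvw (by rwa [add_zero])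
  have hli : LinearIndependent ℝ ![n, w] := by
    rw [LinearIndependent.pair_iff' hn]
    rintro a rfl
    rw [inner_smul_right, mul_eq_zero, inner_self_eq_zero] at hnu
    exact hw_ne (by rw [hnu.resolve_right hn, zero_smul])
  have hwn : ω n w = 0 := by rw [← hω.neg, hu, neg_zero]
  have hrepr := exists_sub_mem_vectorSpan hG hli hnG ((Submodule.mem_orthogonal' _ _).1 hw)
  have hcongr : ∀ x y, x - y ∈ vectorSpan ℝ G → ω x = ω y := fun x y h =>
    sub_eq_zero.1 ((map_sub ω x y).symm.trans (hker _ h))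
  refine hω_ne (LinearMap.ext₂ fun x y => ?_)
  obtain ⟨p, q, hx⟩ := hrepr x
  obtain ⟨p', q', hy⟩ := hrepr y
  rw [hcongr _ _ hx, ← hω.neg, hcongr _ _ hy]
  simp [hω n, hω w, hu, hwn]

namespace IsFaceTiling

theorem mem_of_apply_sub_eq_zero (hT : IsFaceTiling T) (hG : IsRidge T G) (hω_ne : ω ≠ 0)
    (hω : ω.IsAlt) (hker : ∀ v ∈ vectorSpan ℝ G, ω v = 0) (hF : F ∈ facetsAt T G) (hn : n ≠ 0)
    (hnF : ∀ v ∈ vectorSpan ℝ F, ⟪n, v⟫ = 0) {x y : E} (hx : x ∈ G) (hy : y ∈ F)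
    (h : ω (y - x) n = 0) : y ∈ G := by
  obtain ⟨-, ⟨Q, hQ, hFQ⟩, hGF⟩ := hF
  exact mem_of_isExposed_of_sub_mem_vectorSpan
    (hT.isExposed_ridge hG ⟨hQ, hGF.trans hFQ.subset⟩) (hFQ.subset hy) hx
    (mem_vectorSpan_of_apply_eq_zero hG.codim hω_ne hω hker hn
      (fun v hv => hnF v (vectorSpan_mono ℝ hGF hv)) (hnF _ (vsub_mem_vectorSpan ℝ hy (hGF hx))) h)

theorem exists_normal_apply_pos (hT : IsFaceTiling T) (hG : IsRidge T G) (hω_ne : ω ≠ 0)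
    (hω : ω.IsAlt) (hker : ∀ v ∈ vectorSpan ℝ G, ω v = 0) (hF : F ∈ facetsAt T G) :
    ∃ n : E, ‖n‖ = 1 ∧ (∀ v ∈ vectorSpan ℝ F, ⟪n, v⟫ = 0) ∧
      ∀ x ∈ G, ∀ y ∈ F \ G, 0 < ω (y - x) n := by
  have hnonzero {n : E} (hn : ‖n‖ = 1) (hnF : ∀ v ∈ vectorSpan ℝ F, ⟪n, v⟫ = 0) {x y : E}
      (hx : x ∈ G) (hy : y ∈ F) (h : ω (y - x) n = 0) : y ∈ G :=
    hT.mem_of_apply_sub_eq_zero hG hω_ne hω hker hF (norm_ne_zero_iff.1 (hn ▸ one_ne_zero)) hnF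
      hx hy h
  obtain ⟨Q, hQ, hFQ⟩ := hF.2.1
  have hGQ := hT.isExposed_ridge hG ⟨hQ, hF.2.2.trans hFQ.subset⟩
  obtain ⟨x₀, hx₀⟩ := hG.codim.1
  obtain ⟨y₀, hy₀, hy₀G⟩ := exists_mem_notMem_of_mem_facetsAt hG.codim hF
  obtain ⟨n, hn, hnF, hpos⟩ : ∃ n : E, ‖n‖ = 1 ∧ (∀ v ∈ vectorSpan ℝ F, ⟪n, v⟫ = 0) ∧
      0 < ω (y₀ - x₀) n := by
    obtain ⟨ν, hν⟩ := exists_isFacetNormal (hT.interior_nonempty Q hQ) hF.1 hFQ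
    have hνF : ∀ v ∈ vectorSpan ℝ F, ⟪ν, v⟫ = 0 := fun v => hν.inner_eq_zero
    rcases lt_or_gt_of_ne fun h => hy₀G (hnonzero hν.1 hνF hx₀ hy₀ h) with hneg | hpos
    · exact ⟨-ν, by rw [norm_neg, hν.1], fun v hv => by rw [inner_neg_left, hνF v hv, neg_zero],
        by rwa [map_neg, neg_pos]⟩
    · exact ⟨ν, hν.1, hνF, hpos⟩
  refine ⟨n, hn, hnF, fun x hx y hy => ?_⟩
  have hxx₀ : ω x = ω x₀ :=
    sub_eq_zero.1 ((map_sub ω x x₀).symm.trans (hker _ (vsub_mem_vectorSpan ℝ hx hx₀)))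
  rw [map_sub, hxx₀, LinearMap.sub_apply, sub_pos]
  refine lt_apply_of_isExtreme (l := ω.flip n) hGQ.isExtreme hFQ.subset
    (hFQ.convex (hT.convex Q hQ)) (fun z hz h => hnonzero hn hnF hx₀ hz ?_) ⟨hy₀, hy₀G⟩ hy ?_
  · rwa [map_sub, LinearMap.sub_apply, sub_eq_zero]
  · rwa [map_sub, LinearMap.sub_apply, sub_pos] at hpos

theorem exists_isCoherent (hT : IsFaceTiling T) (hG : IsRidge T G) :
    ∃ ω n, ω ≠ 0 ∧ IsCoherent T G ω n := by
  have hdim : finrank ℝ (vectorSpan ℝ G)ᗮ = 2 := by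
    have := Submodule.finrank_add_finrank_orthogonal (vectorSpan ℝ G)
    have := hG.codim.2
    omega
  obtain ⟨ω, hω_ne, hω, hker⟩ := exists_isAlt_ne_zero_of_finrank_orthogonal hdim
  choose! n hn hnF hpos using fun F hF =>
    hT.exists_normal_apply_pos (F := F) hG hω_ne hω hker hF
  exact ⟨ω, n, hω_ne, hω, hker, hn, hnF, hpos⟩

end IsFaceTiling

end ExistsCoherent

/-! ### Potentials from ridge conditions -/

section RidgePotential

variable {E : Type*} [NormedAddCommGroup E] [InnerProductSpace ℝ E] [FiniteDimensional ℝ E]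
  {T : Set (Set E)} {Q R S : Set E} {Γ : Type*} [AddCommGroup Γ]

namespace IsFaceTiling

theorem hasCodim_one_of_finrank_le (hT : IsFaceTiling T) (hQ : Q ∈ T) (hR : R ∈ T)
    (hne : Q ≠ R) (h : (Q ∩ R).Nonempty)
    (hdim : finrank ℝ E ≤ finrank ℝ (vectorSpan ℝ (Q ∩ R)) + 1) : HasCodim 1 (Q ∩ R) :=
  ⟨h, le_antisymm (hT.finrank_inter_lt hQ hR hne h) hdim⟩

theorem eq_or_eq_or_eq_of_finrank_le (hT : IsFaceTiling T) (hQ : Q ∈ T) (hR : R ∈ T) (hS : S ∈ T)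
    (h : (Q ∩ R ∩ S).Nonempty)
    (hdim : finrank ℝ E ≤ finrank ℝ (vectorSpan ℝ (Q ∩ R ∩ S)) + 1) :
    Q = R ∨ S = Q ∨ S = R := by
  refine or_iff_not_imp_left.2 fun hQR => ?_
  have hle : finrank ℝ (vectorSpan ℝ (Q ∩ R ∩ S)) ≤ finrank ℝ (vectorSpan ℝ (Q ∩ R)) :=
    Submodule.finrank_mono (vectorSpan_mono ℝ inter_subset_left)
  have hcodim : HasCodim 1 (Q ∩ R) :=
    hT.hasCodim_one_of_finrank_le hQ hR hQR (h.mono inter_subset_left) (by omega)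
  have hexp : IsExposed ℝ Q (Q ∩ R ∩ S) := by
    rw [inter_assoc, inter_inter_distrib_left]
    exact (hT.isExposed_inter Q hQ R hR).inter (hT.isExposed_inter Q hQ S hS)
  have hQRS := eq_of_isExposed_of_finrank_le hexp h inter_subset_left inter_subset_left
    (by have := hcodim.2; omega)
  obtain ⟨w, hw⟩ := hcodim.1.intrinsicInterior ((hT.convex Q hQ).inter (hT.convex R hR))
  exact hT.eq_or_eq_of_mem_intrinsicInterior hQ hR hS hcodim hw
    (inter_eq_left.1 hQRS (intrinsicInterior_subset hw))

theorem isCellCocycle_of_forall_isRidge (hT : IsFaceTiling T) {k : Set E → Set E → Γ}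
    (hself : ∀ Q, k Q Q = 0)
    (hsymm : ∀ Q ∈ T, ∀ R ∈ T, HasCodim 1 (Q ∩ R) → k R Q = -k Q R)
    (hridge : ∀ G, IsRidge T G → ∃ a : Set E → Γ, ∀ Q ∈ cellsAt T G, ∀ R ∈ cellsAt T G,
      k Q R = a R - a Q) : IsCellCocycle T k := by
  intro Q hQ R hR S hS hne hdim
  by_cases hcodim : HasCodim 2 (Q ∩ R ∩ S)
  · have hexp : IsExposed ℝ Q (Q ∩ R ∩ S) := by
      rw [inter_assoc, inter_inter_distrib_left]
      exact (hT.isExposed_inter Q hQ R hR).inter (hT.isExposed_inter Q hQ S hS)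
    obtain ⟨a, ha⟩ := hridge _ ⟨hcodim, Q, hQ, hexp⟩
    have hQG : Q ∈ cellsAt T (Q ∩ R ∩ S) := ⟨hQ, fun _ h => h.1.1⟩
    have hRG : R ∈ cellsAt T (Q ∩ R ∩ S) := ⟨hR, fun _ h => h.1.2⟩
    have hSG : S ∈ cellsAt T (Q ∩ R ∩ S) := ⟨hS, fun _ h => h.2⟩
    rw [ha Q hQG R hRG, ha R hRG S hSG, ha Q hQG S hSG]
    abel
  have hdim' : finrank ℝ E ≤ finrank ℝ (vectorSpan ℝ (Q ∩ R ∩ S)) + 1 := by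
    have : finrank ℝ (vectorSpan ℝ (Q ∩ R ∩ S)) + 2 ≠ finrank ℝ E := fun h => hcodim ⟨hne, h⟩
    omega
  rcases eq_or_ne Q R with rfl | hQR
  · rw [hself, zero_add]
  rcases (hT.eq_or_eq_or_eq_of_finrank_le hQ hR hS hne hdim').resolve_left hQR with rfl | rfl
  · rw [inter_eq_left.2 inter_subset_left] at hne hdim'
    rw [hsymm S hQ R hR (hT.hasCodim_one_of_finrank_le hQ hR hQR hne hdim'), hself,
      add_neg_cancel]
  · rw [hself, add_zero]

theorem exists_potential_of_forall_isRidge (hT : IsFaceTiling T) {c : Set E → Set E → Γ}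
    (hc : ∀ Q ∈ T, ∀ R ∈ T, HasCodim 1 (Q ∩ R) → c R Q = -c Q R)
    (hridge : ∀ G, IsRidge T G → ∃ a : Set E → Γ, ∀ Q ∈ cellsAt T G, ∀ R ∈ cellsAt T G,
      HasCodim 1 (Q ∩ R) → a R - a Q = c Q R) :
    ∃ a : Set E → Γ, ∀ Q ∈ T, ∀ R ∈ T, HasCodim 1 (Q ∩ R) → a R - a Q = c Q R := by
  classical
  choose! a ha using hridge
  let k : Set E → Set E → Γ := fun Q R =>
    if Q = R then 0 else if HasCodim 1 (Q ∩ R) then c Q R else a (Q ∩ R) R - a (Q ∩ R) Q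
  have hself (Q : Set E) : k Q Q = 0 := if_pos rfl
  have hcodim {Q R : Set E} (hQ : Q ∈ T) (h : HasCodim 1 (Q ∩ R)) : k Q R = c Q R :=
    (if_neg (hT.ne_of_hasCodim_one hQ h)).trans (if_pos h)
  have hcocycle : IsCellCocycle T k := by
    refine hT.isCellCocycle_of_forall_isRidge hself (fun Q hQ R hR h => ?_) fun G hG =>
      ⟨a G, fun Q hQ R hR => ?_⟩
    · rw [hcodim hQ h, hcodim hR (inter_comm Q R ▸ h), hc Q hQ R hR h]
    · rcases eq_or_ne Q R with rfl | hQR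
      · rw [hself, sub_self]
      by_cases h : HasCodim 1 (Q ∩ R)
      · rw [hcodim hQ.1 h, ha G hG Q hQ R hR h]
      · have hG_eq : G = Q ∩ R := by
          by_contra hne
          exact h (hT.hasCodim_one_of_ne hG hQ hR hQR hne)
        rw [hG_eq]
        exact (if_neg hQR).trans (if_neg h)
  obtain ⟨A, hA⟩ := hcocycle.exists_potential hT
  exact ⟨A, fun Q hQ R hR h => by rw [hA Q hQ R hR h, hcodim hQ h]⟩

end IsFaceTiling

end RidgePotential

/-! ### Tilings by translates -/

theorem finite_of_totallyBounded_of_dist_lt {α : Type*} [PseudoMetricSpace α] {X : Set α}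
    (hX : TotallyBounded X) {ρ : ℝ} (hρ : 0 < ρ) (h : ∀ x ∈ X, ∀ y ∈ X, dist x y < ρ → x = y) :
    X.Finite := by
  obtain ⟨centers, hfin, hcover⟩ := Metric.totallyBounded_iff.1 hX (ρ / 2) (half_pos hρ)
  have hcenter : ∀ x ∈ X, ∃ c ∈ centers, dist x c < ρ / 2 := fun x hx => by
    simpa using hcover hx
  choose! c hc hdist using hcenter
  refine Set.Finite.of_injOn hc (fun x hx y hy hxy => h x hx y hy ?_) hfin
  have hy_dist := hdist y hy
  rw [← hxy] at hy_dist
  linarith [hdist x hx, dist_triangle_right x y (c x)]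

theorem vadd_inter_vadd {V : Type*} [AddCommGroup V] (P : Set V) (t t' : V) :
    (t +ᵥ P) ∩ (t' +ᵥ P) = t +ᵥ (P ∩ ((t' - t) +ᵥ P)) := by
  rw [vadd_set_inter, vadd_vadd, add_sub_cancel]

theorem hasCodim_vadd {V : Type*} [AddCommGroup V] [Module ℝ V] {k : ℕ} {F : Set V} (t : V) :
    HasCodim k (t +ᵥ F) ↔ HasCodim k F := by
  unfold HasCodim
  rw [vectorSpan_vadd, vadd_set_nonempty]

section Vadd

variable {E : Type*} [SeminormedAddCommGroup E] {P : Set E}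

theorem exists_pos_forall_not_disjoint_interior_vadd (hP : (interior P).Nonempty) :
    ∃ ρ > 0, ∀ t t' : E, dist t t' < ρ →
      ¬Disjoint (interior (t +ᵥ P)) (interior (t' +ᵥ P)) := by
  obtain ⟨p, hp⟩ := hP
  obtain ⟨ρ, hρ, hball⟩ := Metric.isOpen_iff.1 isOpen_interior p hp
  refine ⟨ρ, hρ, fun t t' hdist => Set.not_disjoint_iff.2 ⟨t + p, ?_, ?_⟩⟩
  · rw [interior_vadd]
    exact vadd_mem_vadd_set hp
  · rw [interior_vadd]
    refine ⟨p + (t - t'), hball ?_, by simp only [vadd_eq_add]; abel⟩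
    rwa [Metric.mem_ball, dist_eq_norm, add_sub_cancel_left, ← dist_eq_norm]

theorem isBounded_setOf_vadd_inter_nonempty {K : Set E} (hP : Bornology.IsBounded P)
    (hK : Bornology.IsBounded K) : Bornology.IsBounded {t : E | ((t +ᵥ P) ∩ K).Nonempty} := by
  refine (hK.sub hP).subset ?_
  rintro t ⟨_, ⟨x, hx, rfl⟩, hxK⟩
  exact ⟨t + x, hxK, x, hx, add_sub_cancel_right t x⟩

end Vadd

section Translate

variable {E : Type*} [NormedAddCommGroup E] [NormedSpace ℝ E] {P : Set E}

theorem eq_of_vadd_eq_vadd (hb : Bornology.IsBounded P) (hne : P.Nonempty) {t t' : E}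
    (h : t +ᵥ P = t' +ᵥ P) : t = t' := by
  refine sub_eq_zero.1 (eq_zero_of_forall_add_mem hb hne fun x hx => ?_)
  obtain ⟨y, hy, hxy⟩ : t +ᵥ x ∈ t' +ᵥ P := h ▸ vadd_mem_vadd_set hx
  simp only [vadd_eq_add] at hxy
  rwa [add_sub, add_comm x t, ← hxy, add_sub_cancel_left]

/-- A face-to-face tiling by translates of a convex body `P`. -/
structure IsTranslateTiling (P : Set E) (T : Set (Set E)) : Prop extends IsFaceTiling T where
  convex_body : Convex ℝ P
  compact_body : IsCompact P
  interior_body : (interior P).Nonempty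
  translate : ∀ Q ∈ T, ∃ t : E, Q = t +ᵥ P

namespace IsTranslateTiling

variable {T : Set (Set E)}

theorem nonempty_body (hT : IsTranslateTiling P T) : P.Nonempty :=
  hT.interior_body.mono interior_subset

theorem exists_translation (hT : IsTranslateTiling P T) :
    ∃ tr : Set E → E, (∀ Q ∈ T, Q = tr Q +ᵥ P) ∧ ∀ t, t +ᵥ P ∈ T → tr (t +ᵥ P) = t := by
  choose! tr htr using hT.translate
  exact ⟨tr, htr, fun t ht =>
    (eq_of_vadd_eq_vadd hT.compact_body.isBounded hT.nonempty_body (htr _ ht)).symm⟩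

theorem of_forall_eq_vadd [FiniteDimensional ℝ E] (hconv : Convex ℝ P) (hcomp : IsCompact P)
    (hinterior : (interior P).Nonempty) (htr : ∀ Q ∈ T, ∃ t : E, Q = t +ᵥ P) (hcov : ⋃₀ T = univ)
    (hdisj : ∀ Q ∈ T, ∀ R ∈ T, Q ≠ R → Disjoint (interior Q) (interior R))
    (hface : ∀ Q ∈ T, ∀ R ∈ T, IsExposed ℝ Q (Q ∩ R)) : IsTranslateTiling P T where
  convex_body := hconv
  compact_body := hcomp
  interior_body := hinterior
  translate := htr
  convex Q hQ := by
    obtain ⟨t, rfl⟩ := htr Q hQ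
    exact hconv.vadd t
  compact Q hQ := by
    obtain ⟨t, rfl⟩ := htr Q hQ
    exact hcomp.vadd t
  interior_nonempty Q hQ := by
    obtain ⟨t, rfl⟩ := htr Q hQ
    rw [interior_vadd]
    exact hinterior.vadd_set
  cover x := by
    rw [← mem_sUnion, hcov]
    exact mem_univ x
  disjoint := hdisj
  isExposed_inter := hface
  locallyFinite w := by
    refine ⟨Metric.ball w 1, Metric.ball_mem_nhds w one_pos, ?_⟩
    obtain ⟨ρ, hρ, hoverlap⟩ := exists_pos_forall_not_disjoint_interior_vadd hinterior
    have hfin : {t : E | t +ᵥ P ∈ T ∧ ((t +ᵥ P) ∩ Metric.ball w 1).Nonempty}.Finite := by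
      have : ProperSpace E := FiniteDimensional.proper_real E
      have hbounded :
          Bornology.IsBounded {t : E | t +ᵥ P ∈ T ∧ ((t +ᵥ P) ∩ Metric.ball w 1).Nonempty} :=
        (isBounded_setOf_vadd_inter_nonempty hcomp.isBounded Metric.isBounded_ball).subset
          fun t ht => ht.2
      refine finite_of_totallyBounded_of_dist_lt
        (hbounded.isCompact_closure.totallyBounded.subset subset_closure) hρ
        fun t ht t' ht' hdist => ?_
      by_contra hne
      refine hoverlap t t' hdist (hdisj _ ht.1 _ ht'.1 fun h => hne ?_)
      exact eq_of_vadd_eq_vadd hcomp.isBounded (hinterior.mono interior_subset) h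
    refine Set.Finite.of_finite_image ((hfin.image (· +ᵥ P)).subset ?_) Subtype.val_injective.injOn
    rintro _ ⟨⟨Q, hQ⟩, hne, rfl⟩
    obtain ⟨t, rfl⟩ := htr Q hQ
    exact ⟨t, ⟨hQ, hne⟩, rfl⟩

end IsTranslateTiling

end Translate

section FacetVec

variable {E : Type*} [NormedAddCommGroup E] [InnerProductSpace ℝ E] {P Q R F F' : Set E}
  {v v' n n' : E}

theorem IsFacetNormal.vadd (h : IsFacetNormal Q F n) (t : E) :
    IsFacetNormal (t +ᵥ Q) (t +ᵥ F) n := by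
  obtain ⟨hn, m, hm, rfl⟩ := h
  refine ⟨hn, ⟪n, t⟫ + m, ?_, Subset.antisymm ?_ ?_⟩
  · rintro _ ⟨x, hx, rfl⟩
    simpa only [vadd_eq_add, inner_add_right, add_le_add_iff_left] using hm x hx
  · rintro _ ⟨x, hx, rfl⟩
    refine ⟨vadd_mem_vadd_set hx.1, ?_⟩
    simp only [vadd_eq_add, inner_add_right, hx.2]
  · rintro _ ⟨⟨x, hx, rfl⟩, h⟩
    refine vadd_mem_vadd_set ⟨hx, ?_⟩
    simpa only [vadd_eq_add, inner_add_right, add_right_inj] using h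

theorem isFacetNormal_vadd (t : E) : IsFacetNormal (t +ᵥ Q) (t +ᵥ F) n ↔ IsFacetNormal Q F n :=
  ⟨fun h => by simpa only [neg_vadd_vadd] using h.vadd (-t), fun h => h.vadd t⟩

theorem IsFacetNormal.face_unique (h : IsFacetNormal Q F n) (h' : IsFacetNormal Q F' n)
    (hF : F.Nonempty) (hF' : F'.Nonempty) : F = F' := by
  obtain ⟨y, hy⟩ := hF
  obtain ⟨y', hy'⟩ := hF'
  ext x
  exact ⟨fun hx => h'.mem_of_inner_le (h.subset hx) hy' (h.inner_le (h'.subset hy') hx),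
    fun hx => h.mem_of_inner_le (h'.subset hx) hy (h'.inner_le (h.subset hy) hx)⟩

/-- `P` and `v +ᵥ P` share a facet, with unit normal `n` directed from `P` to `v +ᵥ P`. -/
structure IsFacetVec (P : Set E) (v n : E) : Prop where
  codim : HasCodim 1 (P ∩ (v +ᵥ P))
  normal : IsFacetNormal P (P ∩ (v +ᵥ P)) n
  normal_vadd : IsFacetNormal (v +ᵥ P) (P ∩ (v +ᵥ P)) (-n)

/-- The vectors joining `P` to its neighbours across facets. -/
def facetVecs (P : Set E) : Set E := {v | ∃ n, IsFacetVec P v n}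

namespace IsFacetVec

theorem of_eq_vadd {t t' : E} (hQ : Q = t +ᵥ P) (hR : R = t' +ᵥ P) (hc : HasCodim 1 (Q ∩ R))
    (h : IsFacetNormal Q (Q ∩ R) n) (h' : IsFacetNormal R (Q ∩ R) (-n)) :
    IsFacetVec P (t' - t) n := by
  subst hQ hR
  rw [vadd_inter_vadd] at hc h h'
  refine ⟨(hasCodim_vadd t).1 hc, (isFacetNormal_vadd t).1 h, ?_⟩
  rw [← isFacetNormal_vadd t, vadd_vadd, add_sub_cancel]
  exact h'

theorem vadd (h : IsFacetVec P v n) (t : E) :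
    HasCodim 1 ((t +ᵥ P) ∩ ((t + v) +ᵥ P)) ∧
      IsFacetNormal (t +ᵥ P) ((t +ᵥ P) ∩ ((t + v) +ᵥ P)) n ∧
      IsFacetNormal ((t + v) +ᵥ P) ((t +ᵥ P) ∩ ((t + v) +ᵥ P)) (-n) := by
  rw [vadd_inter_vadd, add_sub_cancel_left, ← vadd_vadd]
  exact ⟨(hasCodim_vadd t).2 h.codim, h.normal.vadd t, h.normal_vadd.vadd t⟩

theorem neg (h : IsFacetVec P v n) : IsFacetVec P (-v) (-n) := by
  have h' : IsFacetVec P (0 - v) (-n) := by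
    refine .of_eq_vadd rfl (zero_vadd E P).symm (inter_comm _ P ▸ h.codim)
      (inter_comm _ P ▸ h.normal_vadd) ?_
    rw [neg_neg, inter_comm]
    exact h.normal
  rwa [zero_sub] at h'

theorem unique (hb : Bornology.IsBounded P) (h : IsFacetVec P v n) (h' : IsFacetVec P v' n) :
    v = v' := by
  have hface := h.normal.face_unique h'.normal h.codim.1 h'.codim.1
  have hopp : IsFacetNormal P (-v +ᵥ (P ∩ (v +ᵥ P))) (-n) := by
    rw [← isFacetNormal_vadd v, vadd_neg_vadd]
    exact h.normal_vadd
  have hopp' : IsFacetNormal P (-v' +ᵥ (P ∩ (v +ᵥ P))) (-n) := by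
    rw [← isFacetNormal_vadd v', vadd_neg_vadd, hface]
    exact h'.normal_vadd
  exact neg_injective (eq_of_vadd_eq_vadd (hb.subset inter_subset_left) h.codim.1
    (hopp.face_unique hopp' h.codim.1.vadd_set h.codim.1.vadd_set))

theorem inner_pos (hi : (interior P).Nonempty) (h : IsFacetVec P v n) : 0 < ⟪n, v⟫ := by
  obtain ⟨x, hx⟩ := hi
  obtain ⟨y, hy⟩ := h.codim.1
  have hlt := h.normal.inner_lt_of_mem_interior hx hy
  have hle := h.normal_vadd.inner_le (vadd_mem_vadd_set (interior_subset hx)) hy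
  simp only [inner_neg_left, vadd_eq_add, inner_add_right] at hle
  linarith

variable [FiniteDimensional ℝ E]

theorem normal_unique (hi : (interior P).Nonempty) (h : IsFacetVec P v n)
    (h' : IsFacetVec P v n') : n' = n :=
  h.normal.unique hi h.codim h'.normal

end IsFacetVec

namespace IsTranslateTiling

variable [FiniteDimensional ℝ E] {T : Set (Set E)}

theorem vadd_add_mem (hT : IsTranslateTiling P T) {t : E} (ht : t +ᵥ P ∈ T)
    (hv : IsFacetVec P v n) : (t + v) +ᵥ P ∈ T := by
  obtain ⟨hc, hn, -⟩ := hv.vadd t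
  obtain ⟨R, hR, -, hinter⟩ := hT.exists_inter_eq_of_isExposed ht hc hn.isExposed
  obtain ⟨t', rfl⟩ := hT.translate R hR
  rw [← hinter] at hc hn
  obtain ⟨m, hm, hm'⟩ := hT.exists_isFacetNormal_inter ht hR hc
  obtain rfl : m = n := hn.unique (hT.interior_nonempty _ ht) hc hm
  have hv_eq := hv.unique hT.compact_body.isBounded (.of_eq_vadd rfl rfl hc hm hm')
  rwa [hv_eq, add_sub_cancel]

theorem vadd_mem_iff_vadd_add_mem (hT : IsTranslateTiling P T)
    (hv : v ∈ AddSubgroup.closure (facetVecs P)) (t : E) : t +ᵥ P ∈ T ↔ (t + v) +ᵥ P ∈ T := by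
  induction hv using AddSubgroup.closure_induction generalizing t with
  | mem v hv =>
    obtain ⟨n, hn⟩ := hv
    refine ⟨fun h => hT.vadd_add_mem h hn, fun h => ?_⟩
    have hneg := hT.vadd_add_mem h hn.neg
    rwa [add_neg_cancel_right] at hneg
  | zero => rw [add_zero]
  | add v w _ _ hv hw => rw [hv t, hw (t + v), add_assoc]
  | neg v _ hv => rw [hv (t + -v), neg_add_cancel_right]

theorem sub_mem_closure (hT : IsTranslateTiling P T) {t t' : E} (ht : t +ᵥ P ∈ T)
    (ht' : t' +ᵥ P ∈ T) : t' - t ∈ AddSubgroup.closure (facetVecs P) := by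
  obtain ⟨tr, htr, htr_vadd⟩ := hT.exists_translation
  have hclass := hT.eq_of_forall_adjacent
    (f := fun Q => (tr Q : E ⧸ AddSubgroup.closure (facetVecs P)))
    (fun Q hQ R hR hc => by
      obtain ⟨n, hn, hn'⟩ := hT.exists_isFacetNormal_inter hQ hR hc
      rw [QuotientAddGroup.eq, neg_add_eq_sub]
      exact AddSubgroup.subset_closure ⟨n, .of_eq_vadd (htr Q hQ) (htr R hR) hc hn hn'⟩) ht ht'
  rwa [htr_vadd t ht, htr_vadd t' ht', QuotientAddGroup.eq, neg_add_eq_sub] at hclass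

theorem vadd_mem_iff (hT : IsTranslateTiling P T) (hPT : P ∈ T) (t : E) :
    t +ᵥ P ∈ T ↔ t ∈ AddSubgroup.closure (facetVecs P) := by
  have h0 : (0 : E) +ᵥ P ∈ T := by rwa [zero_vadd]
  refine ⟨fun h => by simpa using hT.sub_mem_closure h0 h, fun h => ?_⟩
  simpa using (hT.vadd_mem_iff_vadd_add_mem h 0).1 h0

theorem finite_facetVecs (hT : IsTranslateTiling P T) (hPT : P ∈ T) : (facetVecs P).Finite := by
  refine Set.Finite.of_injOn (f := (· +ᵥ P)) (t := {R ∈ T | (R ∩ P).Nonempty}) ?_ ?_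
    (hT.finite_inter_compact hT.compact_body)
  · rintro v ⟨n, hv⟩
    exact ⟨(hT.vadd_mem_iff hPT v).2 (AddSubgroup.subset_closure ⟨n, hv⟩),
      inter_comm P _ ▸ hv.codim.1⟩
  · exact fun v _ w _ h => eq_of_vadd_eq_vadd hT.compact_body.isBounded hT.nonempty_body h

theorem exists_isFacetVec_inner_lt_of_notMem (hT : IsTranslateTiling P T) (hPT : P ∈ T) {y : E}
    (hy : y ∉ P) : ∃ v n, IsFacetVec P v n ∧ ∀ z ∈ P ∩ (v +ᵥ P), ⟪n, z⟫ < ⟪n, y⟫ := by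
  obtain ⟨R, hR, hc, hsep⟩ := hT.exists_facet_inner_lt_of_notMem hPT hy
  obtain ⟨n, hn, hn'⟩ := hT.exists_isFacetNormal_inter hPT hR hc
  obtain ⟨v, rfl⟩ := hT.translate R hR
  exact ⟨v, n, ⟨hc, hn, hn'⟩, hsep n hn⟩

theorem eq_zero_of_mem_interior_of_sub_mem (hT : IsTranslateTiling P T) (hPT : P ∈ T) {x : E}
    (hv : v ∈ AddSubgroup.closure (facetVecs P)) (hx : x ∈ interior P) (hxv : x - v ∈ P) :
    v = 0 := by
  have hvP := hT.eq_of_mem_interior hPT ((hT.vadd_mem_iff hPT v).2 hv) hx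
    ⟨x - v, hxv, add_sub_cancel v x⟩
  refine eq_of_vadd_eq_vadd hT.compact_body.isBounded hT.nonempty_body ?_
  rw [hvP, zero_vadd]

theorem exists_sub_mem (hT : IsTranslateTiling P T) (hPT : P ∈ T) (x : E) :
    ∃ v ∈ AddSubgroup.closure (facetVecs P), x - v ∈ P := by
  obtain ⟨Q, hQ, hx⟩ := hT.cover x
  obtain ⟨v, rfl⟩ := hT.translate Q hQ
  obtain ⟨y, hy, rfl⟩ := hx
  exact ⟨v, (hT.vadd_mem_iff hPT v).1 hQ, by simpa using hy⟩

end IsTranslateTiling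

end FacetVec

/-! ### The gradient of the generatrix -/

section Gradient

variable {E : Type*} [NormedAddCommGroup E] [InnerProductSpace ℝ E] {T : Set (Set E)}
  {s : Set E → ℝ} {a : Set E → E}

/-- A canonical scaling of the tiling `T` in an inner product space of any dimension. The values of
`s` on sets other than the facets of the tiling play no role. -/
structure IsCanonical (T : Set (Set E)) (s : Set E → ℝ) : Prop where
  pos : ∀ F, HasCodim 1 F → (∃ Q ∈ T, IsExposed ℝ Q F) → 0 < s F
  torsion_eq_zero : ∀ G, IsRidge T G → ∀ ω n, ω ≠ 0 → IsCoherent T G ω n →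
    ∑ᶠ F ∈ facetsAt T G, s F • n F = 0

/-- The vectors `a Q` are the gradients on the cells `Q` of a piecewise affine function (a
generatrix of the tiling) whose gradient jumps across each facet by `s` times the unit normal. -/
def IsGradient (T : Set (Set E)) (s : Set E → ℝ) (a : Set E → E) : Prop :=
  ∀ Q ∈ T, ∀ R ∈ T, ∀ n, HasCodim 1 (Q ∩ R) → IsFacetNormal Q (Q ∩ R) n →
    IsFacetNormal R (Q ∩ R) (-n) → a R - a Q = s (Q ∩ R) • n

namespace IsFaceTiling

variable [FiniteDimensional ℝ E]

theorem finsum_smul_eq_zero_of_isGradient (hT : IsFaceTiling T) (ha : IsGradient T s a) {G : Set E}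
    (hG : IsRidge T G) {ω : E →ₗ[ℝ] E →ₗ[ℝ] ℝ} {n : Set E → E} (hn : IsCoherent T G ω n) :
    ∑ᶠ F ∈ facetsAt T G, s F • n F = 0 := by
  obtain ⟨src, tgt, h⟩ := hT.exists_isMatching hG hn
  rw [← h.finsum_sub_eq_zero (hT.finite_cellsAt hG.codim.1) a]
  refine finsum_mem_congr rfl fun F hF => ?_
  have hjump := ha (src F) (h.bijOn_src.mapsTo hF).1 (tgt F) (h.bijOn_tgt.mapsTo hF).1 (n F)
  rw [h.inter F hF] at hjump
  exact (hjump hF.1 (h.normal_src F hF) (h.normal_tgt F hF)).symm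

theorem exists_jump (hT : IsFaceTiling T) (s : Set E → ℝ) :
    ∃ c : Set E → Set E → E, ∀ Q ∈ T, ∀ R ∈ T, HasCodim 1 (Q ∩ R) →
      c R Q = -c Q R ∧ ∀ n, IsFacetNormal Q (Q ∩ R) n → c Q R = s (Q ∩ R) • n := by
  have hex : ∀ Q ∈ T, ∀ R ∈ T, ∃ n, HasCodim 1 (Q ∩ R) → IsFacetNormal Q (Q ∩ R) n ∧
      IsFacetNormal R (Q ∩ R) (-n) := fun Q hQ R hR => by
    by_cases h : HasCodim 1 (Q ∩ R)
    · exact (hT.exists_isFacetNormal_inter hQ hR h).imp fun _ hn _ => hn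
    · exact ⟨0, fun h' => absurd h' h⟩
  choose! ν hν using hex
  refine ⟨fun Q R => s (Q ∩ R) • ν Q R, fun Q hQ R hR hc => ?_⟩
  obtain ⟨hnormal, hopposite⟩ := hν Q hQ R hR hc
  refine ⟨?_, fun n hn => ?_⟩
  · rw [inter_comm] at hc hopposite
    have hν_neg : -ν Q R = ν R Q :=
      (hν R hR Q hQ hc).1.unique (hT.interior_nonempty R hR) hc hopposite
    change s (R ∩ Q) • ν R Q = -(s (Q ∩ R) • ν Q R)
    rw [← hν_neg, inter_comm, smul_neg]
  · change s (Q ∩ R) • ν Q R = s (Q ∩ R) • n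
    rw [hn.unique (hT.interior_nonempty Q hQ) hc hnormal]

theorem exists_isGradient (hT : IsFaceTiling T) (hs : IsCanonical T s) :
    ∃ a, IsGradient T s a := by
  obtain ⟨c, hc⟩ := hT.exists_jump s
  have hanti : ∀ Q ∈ T, ∀ R ∈ T, HasCodim 1 (Q ∩ R) → c R Q = -c Q R :=
    fun Q hQ R hR hcodim => (hc Q hQ R hR hcodim).1
  obtain ⟨a, ha⟩ := hT.exists_potential_of_forall_isRidge hanti fun G hG => by
    obtain ⟨ω, n, hω, hn⟩ := hT.exists_isCoherent hG
    obtain ⟨src, tgt, h⟩ := hT.exists_isMatching hG hn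
    refine hT.exists_potential_around hG h hanti ?_
    rw [← hs.torsion_eq_zero G hG ω n hω hn]
    refine finsum_mem_congr rfl fun F hF => ?_
    have hjump := hc (src F) (h.bijOn_src.mapsTo hF).1 (tgt F) (h.bijOn_tgt.mapsTo hF).1
    rw [h.inter F hF] at hjump
    exact (hjump hF.1).2 (n F) (h.normal_src F hF)
  refine ⟨a, fun Q hQ R hR n hcodim hn _ => ?_⟩
  rw [ha Q hQ R hR hcodim, (hc Q hQ R hR hcodim).2 n hn]

end IsFaceTiling

end Gradient

/-! ### Affine images of Dirichlet domains -/

section Dirichlet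

variable {W : Type*} [NormedAddCommGroup W]

/-- The Dirichlet domain of the point `p` with respect to the subgroup `Λ` of any normed group. -/
def dirichletCell (Λ : AddSubgroup W) (p : W) : Set W := {x | ∀ q ∈ Λ, ‖x - p‖ ≤ ‖x - q‖}

variable {Λ : AddSubgroup W} {p x m : W}

theorem isClosed_dirichletCell : IsClosed (dirichletCell Λ p) := by
  simp only [dirichletCell, ofPred_forall]
  exact isClosed_biInter fun q _ => isClosed_le (by fun_prop) (by fun_prop)

theorem exists_sub_mem_dirichletCell [ProperSpace W] [DiscreteTopology Λ] (hp : p ∈ Λ) (x : W) :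
    ∃ m ∈ Λ, x - m ∈ dirichletCell Λ p := by
  obtain ⟨q₀, hq₀, hnearest⟩ :=
    (AddSubgroup.isClosed_of_discrete (H := Λ)).exists_infDist_eq_dist ⟨p, hp⟩ x
  refine ⟨q₀ - p, Λ.sub_mem hq₀ hp, fun q hq => ?_⟩
  calc ‖x - (q₀ - p) - p‖ = dist x q₀ := by rw [sub_sub, sub_add_cancel, dist_eq_norm]
    _ ≤ dist x (q + (q₀ - p)) := hnearest ▸
      Metric.infDist_le_dist_of_mem (Λ.add_mem hq (Λ.sub_mem hq₀ hp))
    _ = ‖x - (q₀ - p) - q‖ := by rw [dist_eq_norm, sub_sub, add_comm]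

variable [InnerProductSpace ℝ W]

theorem norm_sub_le_norm_sub_add_iff : ‖x - p‖ ≤ ‖x - (p + m)‖ ↔ 2 * ⟪m, x - p⟫ ≤ ‖m‖ ^ 2 := by
  rw [← sq_le_sq₀ (norm_nonneg _) (norm_nonneg _), ← sub_sub x p m, norm_sub_sq_real (x - p) m,
    real_inner_comm]
  constructor <;> intro h <;> linarith

theorem norm_sub_add_le_norm_sub_iff : ‖x - (p + m)‖ ≤ ‖x - p‖ ↔ ‖m‖ ^ 2 ≤ 2 * ⟪m, x - p⟫ := by
  rw [← sq_le_sq₀ (norm_nonneg _) (norm_nonneg _), ← sub_sub x p m, norm_sub_sq_real (x - p) m,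
    real_inner_comm]
  constructor <;> intro h <;> linarith

theorem two_mul_inner_le_of_mem_dirichletCell (hx : x ∈ dirichletCell Λ p) (hp : p ∈ Λ)
    (hm : m ∈ Λ) : 2 * ⟪m, x - p⟫ ≤ ‖m‖ ^ 2 :=
  norm_sub_le_norm_sub_add_iff.1 (hx _ (Λ.add_mem hp hm))

theorem sub_mem_dirichletCell (hx : x ∈ dirichletCell Λ p) (hm : m ∈ Λ)
    (htie : ‖m‖ ^ 2 ≤ 2 * ⟪m, x - p⟫) : x - m ∈ dirichletCell Λ p := by
  intro q hq
  calc ‖x - m - p‖ = ‖x - (p + m)‖ := by rw [sub_sub, add_comm]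
    _ ≤ ‖x - p‖ := norm_sub_add_le_norm_sub_iff.2 htie
    _ ≤ ‖x - (q + m)‖ := hx _ (Λ.add_mem hq hm)
    _ = ‖x - m - q‖ := by rw [sub_sub, add_comm]

variable [FiniteDimensional ℝ W]

theorem eventually_norm_sub_lt_norm_sub [DiscreteTopology Λ]
    (h : ∀ q ∈ Λ, q ≠ p → ‖x - p‖ < ‖x - q‖) : ∀ᶠ z in 𝓝 x, ∀ q ∈ Λ, q ≠ p →
      ‖z - p‖ < ‖z - q‖ := by
  have : ProperSpace W := FiniteDimensional.proper_real W
  have hfin : (Metric.closedBall x (‖x - p‖ + 2) ∩ (Λ : Set W)).Finite :=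
    Metric.finite_isBounded_inter_isClosed DiscreteTopology.isDiscrete
      Metric.isBounded_closedBall AddSubgroup.isClosed_of_discrete
  have hnear : ∀ᶠ z in 𝓝 x, ∀ q ∈ Metric.closedBall x (‖x - p‖ + 2) ∩ (Λ : Set W),
      q ≠ p → ‖z - p‖ < ‖z - q‖ := by
    rw [eventually_all_finite hfin]
    intro q hq
    by_cases hqp : q = p
    · exact .of_forall fun z hne => absurd hqp hne
    · have hcont (r : W) : Continuous fun z : W => ‖z - r‖ := by fun_prop
      filter_upwards [(hcont p).continuousAt.eventually_lt (hcont q).continuousAt (h q hq.2 hqp)]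
        with z hz _ using hz
  filter_upwards [hnear, Metric.ball_mem_nhds x one_pos] with z hz hzx q hq hqp
  by_cases hqball : q ∈ Metric.closedBall x (‖x - p‖ + 2)
  · exact hz q ⟨hqball, hq⟩ hqp
  · rw [Metric.mem_closedBall, not_le, dist_eq_norm] at hqball
    rw [Metric.mem_ball, dist_eq_norm] at hzx
    have hzp := norm_sub_le_norm_sub_add_norm_sub z x p
    have hqx := norm_sub_le_norm_sub_add_norm_sub q z x
    rw [norm_sub_rev q z] at hqx
    linarith

theorem exists_ne_zero_norm_sq_le_two_mul_inner [DiscreteTopology Λ] (hp : p ∈ Λ)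
    (hx : x ∉ interior (dirichletCell Λ p)) : ∃ m ∈ Λ, m ≠ 0 ∧ ‖m‖ ^ 2 ≤ 2 * ⟪m, x - p⟫ := by
  by_contra! hlt
  refine hx (mem_interior_iff_mem_nhds.2 ?_)
  have hcloser : ∀ q ∈ Λ, q ≠ p → ‖x - p‖ < ‖x - q‖ := fun q hq hqp => by
    have hqp_lt := hlt (q - p) (Λ.sub_mem hq hp) (sub_ne_zero.2 hqp)
    rwa [← not_le, ← norm_sub_add_le_norm_sub_iff, add_sub_cancel, not_le] at hqp_lt
  filter_upwards [eventually_norm_sub_lt_norm_sub hcloser] with z hz q hq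
  obtain rfl | hqp := eq_or_ne q p
  exacts [le_rfl, (hz q hq hqp).le]

end Dirichlet

theorem affineEquiv_apply_sub {V V' : Type*} [AddCommGroup V] [Module ℝ V] [AddCommGroup V']
    [Module ℝ V'] (f : V ≃ᵃ[ℝ] V') (x w : V) : f (x - w) = f x - f.linear w := by
  rw [sub_eq_neg_add, ← vadd_eq_add, f.map_vadd, map_neg, vadd_eq_add, neg_add_eq_sub]

section FacetVec

variable {E : Type*} [NormedAddCommGroup E] [InnerProductSpace ℝ E] {P F : Set E} {v w n a x₀ : E}

theorem IsFacetVec.eq_of_forall_sub_mem (hb : Bornology.IsBounded P) (h : IsFacetVec P v n)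
    (hw : ∀ x ∈ P ∩ (v +ᵥ P), x - w ∈ P ∧ ∀ y ∈ P, ⟪n, x - w⟫ ≤ ⟪n, y⟫) : v = w := by
  have hopposite : IsFacetNormal P (-v +ᵥ (P ∩ (v +ᵥ P))) (-n) := by
    rw [← isFacetNormal_vadd v, vadd_neg_vadd]
    exact h.normal_vadd
  refine sub_eq_zero.1 (eq_zero_of_forall_add_mem (hb.subset inter_subset_left) h.codim.1
    fun x hx => ?_)
  obtain ⟨hmem, hmin⟩ := hw x hx
  have hx' : -v +ᵥ x ∈ -v +ᵥ (P ∩ (v +ᵥ P)) := vadd_mem_vadd_set hx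
  obtain ⟨y, hy, hyx⟩ := hopposite.mem_of_inner_le hmem hx' (by
    simpa only [inner_neg_left, neg_le_neg_iff] using hmin _ (hopposite.subset hx'))
  have hy_eq : x + (v - w) = y := by
    simp only [vadd_eq_add, neg_add_eq_iff_eq_add] at hyx
    rw [hyx]
    abel
  rwa [hy_eq]

variable [FiniteDimensional ℝ E]

theorem IsFacetNormal.exists_pos_eq_smul (hi : (interior P).Nonempty) (h : IsFacetNormal P F n)
    (hF : HasCodim 1 F) (hx₀ : x₀ ∈ intrinsicInterior ℝ F) (ha : a ≠ 0)
    (hmax : ∀ y ∈ P, ⟪a, y⟫ ≤ ⟪a, x₀⟫) : ∃ κ > (0 : ℝ), a = κ • n := by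
  have hconst : ∀ y ∈ F, ⟪a, y⟫ = ⟪a, x₀⟫ := fun y hy =>
    eq_of_forall_le_of_mem_intrinsicInterior (l := innerₛₗ ℝ a) hx₀
      (fun y hy => hmax y (h.subset hy)) hy
  have ha_eq : a = ⟪n, a⟫ • n := eq_inner_smul_of_orthogonal hF h.1 (fun u => h.inner_eq_zero)
    fun u hu => map_eq_zero_of_mem_vectorSpan (l := innerₛₗ ℝ a) hconst hu
  refine ⟨⟪n, a⟫, ?_, ha_eq⟩
  have hne : ⟪n, a⟫ ≠ 0 := fun h0 => ha (by rw [ha_eq, h0, zero_smul])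
  obtain ⟨x, hx⟩ := hi
  have hlt := h.inner_lt_of_mem_interior hx (intrinsicInterior_subset hx₀)
  have hle := hmax x (interior_subset hx)
  rw [ha_eq, real_inner_smul_left, real_inner_smul_left] at hle
  refine hne.lt_or_gt.resolve_left fun hneg => hle.not_gt (mul_lt_mul_of_neg_left hlt hneg)

variable {W : Type*} [NormedAddCommGroup W] [InnerProductSpace ℝ W] [FiniteDimensional ℝ W]
  {Λ : AddSubgroup W} [DiscreteTopology Λ] {p : W}

theorem IsFacetNormal.exists_norm_sq_le_two_mul_inner (h : IsFacetNormal P F n) (f : E ≃ᵃ[ℝ] W)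
    (hp : p ∈ Λ) (hP : P = f ⁻¹' dirichletCell Λ p) {x : E} (hx : x ∈ F) :
    ∃ m ∈ Λ, m ≠ 0 ∧ ‖m‖ ^ 2 ≤ 2 * ⟪m, f x - p⟫ := by
  refine exists_ne_zero_norm_sq_le_two_mul_inner hp fun hfx => ?_
  have hf : Continuous f := f.toAffineMap.continuous_of_finiteDimensional
  refine lt_irrefl _ (h.inner_lt_of_mem_interior ?_ hx)
  rw [hP]
  exact preimage_interior_subset_interior_preimage hf hfx

/-- In the Euclidean structure pulled back from the Dirichlet domain each facet vector is normal
to its facet. -/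
theorem IsFacetVec.exists_adjoint_apply_eq_smul (hb : Bornology.IsBounded P)
    (hi : (interior P).Nonempty) (hconv : Convex ℝ P) (f : E ≃ᵃ[ℝ] W) (hp : p ∈ Λ)
    (hP : P = f ⁻¹' dirichletCell Λ p) (h : IsFacetVec P v n) :
    ∃ κ > (0 : ℝ), LinearMap.adjoint f.linear.toLinearMap (f.linear v) = κ • n := by
  obtain ⟨x₀, hx₀⟩ := h.codim.1.intrinsicInterior (h.normal.convex hconv)
  have hx₀F := intrinsicInterior_subset hx₀
  obtain ⟨m, hm, hm0, htie⟩ := h.normal.exists_norm_sq_le_two_mul_inner f hp hP hx₀F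
  obtain ⟨w, rfl⟩ := f.linear.surjective m
  set a := LinearMap.adjoint f.linear.toLinearMap (f.linear w) with ha_def
  have ha0 : a ≠ 0 := fun h0 => hm0 (inner_self_eq_zero (𝕜 := ℝ).1 (by
    rw [← LinearEquiv.coe_coe, ← LinearMap.adjoint_inner_left, LinearEquiv.coe_coe, ← ha_def, h0,
      inner_zero_left]))
  have hinner (x y : E) : ⟪f.linear w, f x - p⟫ - ⟪f.linear w, f y - p⟫ = ⟪a, x⟫ - ⟪a, y⟫ := by
    rw [← inner_sub_right, sub_sub_sub_cancel_right, ← inner_sub_right, ha_def,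
      LinearMap.adjoint_inner_left]
    exact congrArg _ (f.toAffineMap.linearMap_vsub x y).symm
  have hupper : ∀ y ∈ P, 2 * ⟪f.linear w, f y - p⟫ ≤ ‖f.linear w‖ ^ 2 := fun y hy =>
    two_mul_inner_le_of_mem_dirichletCell (by rwa [hP] at hy) hp hm
  have hlower : ∀ y ∈ P, -‖f.linear w‖ ^ 2 ≤ 2 * ⟪f.linear w, f y - p⟫ := fun y hy => by
    have := two_mul_inner_le_of_mem_dirichletCell (by rwa [hP] at hy) hp (Λ.neg_mem hm)
    rw [inner_neg_left, norm_neg] at this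
    linarith
  obtain ⟨κ, hκ, ha⟩ := h.normal.exists_pos_eq_smul (a := a) hi h.codim hx₀ ha0
    fun y hy => by linarith [hinner y x₀, hupper y hy]
  refine ⟨κ, hκ, ?_⟩
  rw [h.eq_of_forall_sub_mem (w := w) hb fun x hx => ?_, ← ha]
  have htie_x : ‖f.linear w‖ ^ 2 ≤ 2 * ⟪f.linear w, f x - p⟫ := by
    have hax : ⟪a, x⟫ = ⟪a, x₀⟫ := by
      rw [ha, real_inner_smul_left, real_inner_smul_left, h.normal.inner_eq hx hx₀F]
    linarith [hinner x x₀]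
  refine ⟨?_, fun y hy => ?_⟩
  · rw [hP, mem_preimage, affineEquiv_apply_sub]
    exact sub_mem_dirichletCell (by have := hx.1; rwa [hP] at this) hm htie_x
  · have hle : ⟪a, x - w⟫ ≤ ⟪a, y⟫ := by
      have hshift : ⟪f.linear w, f (x - w) - p⟫ =
          ⟪f.linear w, f x - p⟫ - ‖f.linear w‖ ^ 2 := by
        rw [affineEquiv_apply_sub, sub_right_comm, inner_sub_right, real_inner_self_eq_norm_sq]
      linarith [hinner y (x - w), hlower y hy, hupper x hx.1]
    rw [ha, real_inner_smul_left, real_inner_smul_left] at hle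
    exact le_of_mul_le_mul_left hle hκ

end FacetVec

section Scaling

variable {E : Type*} [NormedAddCommGroup E] [InnerProductSpace ℝ E] [FiniteDimensional ℝ E]
  {T : Set (Set E)} {Q R Q' R' : Set E}

namespace IsFaceTiling

theorem eq_or_eq_of_inter_eq (hT : IsFaceTiling T) (hQ : Q ∈ T) (hR : R ∈ T) (hQ' : Q' ∈ T)
    (hR' : R' ∈ T) (hc : HasCodim 1 (Q ∩ R)) (h : Q ∩ R = Q' ∩ R') :
    Q' = Q ∧ R' = R ∨ Q' = R ∧ R' = Q := by
  obtain ⟨w, hw⟩ := hc.1.intrinsicInterior ((hT.convex Q hQ).inter (hT.convex R hR))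
  have hwQR' : w ∈ Q' ∩ R' := h ▸ intrinsicInterior_subset hw
  have hne : Q' ≠ R' := hT.ne_of_hasCodim_one hQ' (h ▸ hc)
  rcases hT.eq_or_eq_of_mem_intrinsicInterior hQ hR hQ' hc hw hwQR'.1 with hQ'Q | hQ'R <;>
    rcases hT.eq_or_eq_of_mem_intrinsicInterior hQ hR hR' hc hw hwQR'.2 with hR'Q | hR'R
  exacts [absurd (hQ'Q.trans hR'Q.symm) hne, .inl ⟨hQ'Q, hR'R⟩, .inr ⟨hQ'R, hR'Q⟩,
    absurd (hQ'R.trans hR'R.symm) hne]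

theorem exists_forall_inter_eq (hT : IsFaceTiling T) {α : Type*} {g : Set E → Set E → α}
    (hg : ∀ Q R, g Q R = g R Q) :
    ∃ s : Set E → α, ∀ Q ∈ T, ∀ R ∈ T, HasCodim 1 (Q ∩ R) → s (Q ∩ R) = g Q R := by
  let inter (p : {p : Set E × Set E // p.1 ∈ T ∧ p.2 ∈ T ∧ HasCodim 1 (p.1 ∩ p.2)}) : Set E :=
    p.1.1 ∩ p.1.2
  have hfactors : Function.FactorsThrough (fun p => g p.1.1 p.1.2) inter := by
    rintro ⟨⟨Q, R⟩, hQ, hR, hc⟩ ⟨⟨Q', R'⟩, hQ', hR', _⟩ h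
    rcases hT.eq_or_eq_of_inter_eq hQ hR hQ' hR' hc h with ⟨rfl, rfl⟩ | ⟨rfl, rfl⟩
    exacts [rfl, hg _ _]
  exact ⟨Function.extend inter (fun p => g p.1.1 p.1.2) fun _ => g ∅ ∅, fun Q hQ R hR hc =>
    hfactors.extend_apply _ ⟨(Q, R), hQ, hR, hc⟩⟩

end IsFaceTiling

end Scaling

section Canonical

variable {E : Type*} [NormedAddCommGroup E] [InnerProductSpace ℝ E] [FiniteDimensional ℝ E]
  {P : Set E} {T : Set (Set E)}

/-- `A` maps every facet vector of `P` to a positive multiple of the outer unit normal of the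
corresponding facet. When `A` is linear, symmetric and positive, it is the metric in which facets
are orthogonal to facet vectors. -/
def IsNormalMap (P : Set E) (A : E → E) : Prop :=
  ∀ v n, IsFacetVec P v n → ∃ κ > (0 : ℝ), A v = κ • n

namespace IsTranslateTiling

theorem exists_isCanonical_of_isNormalMap (hT : IsTranslateTiling P T) {A : E →+ E}
    (hA : IsNormalMap P A) : ∃ s, IsCanonical T s := by
  obtain ⟨tr, htr, -⟩ := hT.exists_translation
  obtain ⟨s, hs⟩ := hT.exists_forall_inter_eq (g := fun Q R => ‖A (tr R - tr Q)‖) fun Q R => by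
    rw [← neg_sub, map_neg, norm_neg]
  have hjump : ∀ Q ∈ T, ∀ R ∈ T, ∀ n, HasCodim 1 (Q ∩ R) → IsFacetNormal Q (Q ∩ R) n →
      IsFacetNormal R (Q ∩ R) (-n) → 0 < s (Q ∩ R) ∧ A (tr R - tr Q) = s (Q ∩ R) • n := by
    intro Q hQ R hR n hc hn hn'
    obtain ⟨κ, hκ, hAκ⟩ := hA _ _ (.of_eq_vadd (htr Q hQ) (htr R hR) hc hn hn')
    have hsκ : s (Q ∩ R) = κ := by
      rw [hs Q hQ R hR hc, hAκ, norm_smul, hn.1, mul_one, Real.norm_of_nonneg hκ.le]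
    rw [hsκ]
    exact ⟨hκ, hAκ⟩
  refine ⟨s, fun F hF ⟨Q, hQ, hexp⟩ => ?_, fun G hG ω n _ hn =>
    hT.finsum_smul_eq_zero_of_isGradient (a := fun Q => A (tr Q)) ?_ hG hn⟩
  · obtain ⟨R, hR, -, rfl⟩ := hT.exists_inter_eq_of_isExposed hQ hF hexp
    obtain ⟨n, hn, hn'⟩ := hT.exists_isFacetNormal_inter hQ hR hF
    exact (hjump Q hQ R hR n hF hn hn').1
  · intro Q hQ R hR n hc hn hn'
    rw [← map_sub]
    exact (hjump Q hQ R hR n hc hn hn').2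

theorem exists_isCanonical_of_eq_preimage_dirichletCell (hT : IsTranslateTiling P T) {W : Type*}
    [NormedAddCommGroup W] [InnerProductSpace ℝ W] [FiniteDimensional ℝ W] {Λ : AddSubgroup W}
    [DiscreteTopology Λ] {p : W} (f : E ≃ᵃ[ℝ] W) (hp : p ∈ Λ)
    (hP : P = f ⁻¹' dirichletCell Λ p) : ∃ s, IsCanonical T s :=
  hT.exists_isCanonical_of_isNormalMap
    (A := (LinearMap.adjoint f.linear.toLinearMap ∘ₗ f.linear.toLinearMap).toAddMonoidHom)
    fun _ _ h => h.exists_adjoint_apply_eq_smul hT.compact_body.isBounded hT.interior_body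
      hT.convex_body f hp hP

end IsTranslateTiling

end Canonical

/-! ### Functions with vanishing mixed differences -/

section MixedDifferences

variable {A Γ : Type*} [AddCommGroup A] {α : A → Γ}

theorem periodic_of_mem_closure {S : Set A} (h : ∀ w ∈ S, Function.Periodic α w) {w : A}
    (hw : w ∈ AddSubgroup.closure S) : Function.Periodic α w := by
  induction hw using AddSubgroup.closure_induction with
  | mem w hw => exact h w hw
  | zero => exact fun x => congrArg α (add_zero x)
  | add w w' _ _ hw hw' => exact hw.add_period hw'
  | neg w _ hw => exact hw.neg

variable [AddCommGroup Γ]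

theorem periodic_fwdDiff_comm {r r' : A} :
    Function.Periodic (fwdDiff r α) r' ↔ Function.Periodic (fwdDiff r' α) r := by
  refine forall_congr' fun x => ?_
  rw [fwdDiff, fwdDiff, fwdDiff, fwdDiff, sub_eq_sub_iff_sub_eq_sub, add_right_comm]

variable {ι : Type*} {v : ι → A}

theorem periodic_fwdDiff_zsmul
    (hv : ∀ i j, i ≠ j → Function.Periodic (fwdDiff (v i) α) (v j)) (i : ι) {w : A}
    (hw : w ∈ AddSubgroup.closure (v '' {i}ᶜ)) (m : ℤ) :
    Function.Periodic (fwdDiff (m • v i) α) w := by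
  have hdiff : Function.Periodic (fwdDiff (v i) α) w :=
    periodic_of_mem_closure (forall_mem_image.2 fun j hj => hv i j (Ne.symm hj)) hw
  exact periodic_fwdDiff_comm.2 ((periodic_fwdDiff_comm.1 hdiff).zsmul m)

theorem sum_zsmul_mem_closure_image_compl {i : ι} {S : Finset ι} (hi : i ∉ S) (k : ι → ℤ) :
    ∑ j ∈ S, k j • v j ∈ AddSubgroup.closure (v '' {i}ᶜ) := by
  refine AddSubgroup.sum_mem _ fun j hj => AddSubgroup.zsmul_mem _ ?_ _
  exact AddSubgroup.subset_closure (mem_image_of_mem v fun h => hi (h ▸ hj))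

theorem apply_sum_zsmul_sub_apply_zero
    (hv : ∀ i j, i ≠ j → Function.Periodic (fwdDiff (v i) α) (v j)) (k : ι → ℤ)
    (S : Finset ι) : α (∑ i ∈ S, k i • v i) - α 0 = ∑ i ∈ S, fwdDiff (k i • v i) α 0 := by
  classical
  induction S using Finset.induction_on with
  | empty => simp
  | insert i S hi ih =>
    have hstep := (periodic_fwdDiff_zsmul hv i (sum_zsmul_mem_closure_image_compl hi k) (k i)).eq
    rw [Finset.sum_insert hi, Finset.sum_insert hi, ← hstep, ← ih, fwdDiff, add_comm]
    abel

theorem apply_mul_of_forall_apply_add {g : ℤ → Γ} {r : ℤ} (hr : ∀ m, g (r + m) = g r + g m)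
    (k : ℤ) : g (k * r) = k • g r := by
  induction k with
  | zero => simpa using hr 0
  | succ k ih => rw [add_mul, one_mul, add_comm, hr, ih, add_smul, one_smul, add_comm]
  | pred k ih =>
    have hpred := hr ((-k - 1) * r)
    rw [show r + (-k - 1) * r = -k * r by ring, ih] at hpred
    rw [sub_smul, one_smul, hpred, add_sub_cancel_left]

end MixedDifferences

section RealMixedDifferences

variable {E : Type*} [AddCommGroup E] [Module ℝ E]

theorem exists_pos_sub_eq_smul_of_lt {g : ℤ → E} {n : E}
    (hg : ∀ m, ∃ σ > (0 : ℝ), g (m + 1) - g m = σ • n) {a b : ℤ} (hab : a < b) :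
    ∃ σ > (0 : ℝ), g b - g a = σ • n := by
  induction b, hab using Int.leInduction with
  | base => exact hg a
  | succ b _ ih =>
    obtain ⟨σ, hσ, hσn⟩ := ih
    obtain ⟨τ, hτ, hτn⟩ := hg b
    exact ⟨τ + σ, add_pos hτ hσ, by rw [add_smul, ← hτn, ← hσn, sub_add_sub_cancel]⟩

theorem exists_pos_forall_eq_smul_of_additive {g : ℤ → E} {n : E}
    (hg : ∀ m, ∃ σ > (0 : ℝ), g (m + 1) - g m = σ • n) :
    ∃ κ > (0 : ℝ), ∀ r : ℤ, (∀ m, g (r + m) = g r + g m) → g r = (r : ℝ) • κ • n := by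
  by_cases hex : ∃ p > 0, ∀ m, g (p + m) = g p + g m
  · obtain ⟨p, hp, hadd⟩ := hex
    obtain ⟨σ, hσ, hgp⟩ := exists_pos_sub_eq_smul_of_lt hg hp
    rw [show g 0 = 0 by simpa using hadd 0, sub_zero] at hgp
    have hp' : (0 : ℝ) < p := Int.cast_pos.2 hp
    refine ⟨σ / p, div_pos hσ hp', fun r hr => ?_⟩
    have hcomm : (r : ℝ) • g p = (p : ℝ) • g r := by
      rw [Int.cast_smul_eq_zsmul, Int.cast_smul_eq_zsmul, ← apply_mul_of_forall_apply_add hadd,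
        ← apply_mul_of_forall_apply_add hr, mul_comm]
    rw [div_eq_inv_mul, mul_smul, smul_comm, ← hgp, hcomm, inv_smul_smul₀ hp'.ne']
  · push Not at hex
    obtain ⟨σ, hσ, -⟩ := hg 0
    refine ⟨σ, hσ, fun r hr => ?_⟩
    have hneg (m : ℤ) : g (-r + m) = g (-r) + g m := by
      have hcancel := hr (-r + m)
      have hneg_one := apply_mul_of_forall_apply_add hr (-1)
      rw [add_neg_cancel_left] at hcancel
      rw [neg_one_mul, neg_one_smul] at hneg_one
      rw [hcancel, hneg_one, neg_add_cancel_left]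
    obtain rfl : r = 0 := by
      rcases lt_trichotomy r 0 with h | h | h
      · obtain ⟨m, hm⟩ := hex (-r) (neg_pos.2 h)
        exact absurd (hneg m) hm
      · exact h
      · obtain ⟨m, hm⟩ := hex r h
        exact absurd (hr m) hm
    simpa using hr 0

variable {A : Type*} [AddCommGroup A] {ι : Type*} {v : ι → A} {n : ι → E} {α : A → E}

theorem exists_pos_forall_fwdDiff_zsmul_eq
    (hv : ∀ i j, i ≠ j → Function.Periodic (fwdDiff (v i) α) (v j))
    (hα : ∀ i x, ∃ σ > (0 : ℝ), fwdDiff (v i) α x = σ • n i) (i : ι) :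
    ∃ κ > (0 : ℝ), ∀ r : ℤ, r • v i ∈ AddSubgroup.closure (v '' {i}ᶜ) →
      fwdDiff (r • v i) α 0 = (r : ℝ) • κ • n i := by
  obtain ⟨κ, hκ, hlin⟩ := exists_pos_forall_eq_smul_of_additive
    (g := fun m => fwdDiff (m • v i) α 0) (n := n i) fun m => by
      simpa [fwdDiff, add_smul] using hα i (m • v i)
  refine ⟨κ, hκ, fun r hr => hlin r fun m => ?_⟩
  have hper := (periodic_fwdDiff_zsmul hv i hr m).eq
  rw [← hper]
  simp only [fwdDiff, zero_add, add_smul]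
  abel

/-- In a relation `∑ kᵢ vᵢ = 0`, the vector `kᵢ vᵢ` is also an integer combination of the other
generators, so `m ↦ α (m vᵢ)` is additive along it and averages to a multiple of `nᵢ`. -/
theorem exists_forall_sum_smul_eq_zero [Fintype ι]
    (hv : ∀ i j, i ≠ j → Function.Periodic (fwdDiff (v i) α) (v j))
    (hα : ∀ i x, ∃ σ > (0 : ℝ), fwdDiff (v i) α x = σ • n i) :
    ∃ κ : ι → ℝ, (∀ i, 0 < κ i) ∧
      ∀ k : ι → ℤ, ∑ i, k i • v i = 0 → ∑ i, k i • κ i • n i = 0 := by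
  classical
  choose κ hκ hlin using exists_pos_forall_fwdDiff_zsmul_eq hv hα
  refine ⟨κ, hκ, fun k hk => ?_⟩
  have hsum := apply_sum_zsmul_sub_apply_zero hv k Finset.univ
  rw [hk, sub_self] at hsum
  rw [hsum]
  refine Finset.sum_congr rfl fun i _ => ?_
  rw [← Finset.add_sum_erase _ _ (Finset.mem_univ i)] at hk
  rw [hlin i, Int.cast_smul_eq_zsmul]
  rw [eq_neg_of_add_eq_zero_left hk]
  exact neg_mem (sum_zsmul_mem_closure_image_compl (Finset.notMem_erase i _) k)

theorem exists_addMonoidHom_eq_pos_smul [Finite ι] (hgen : AddSubgroup.closure (range v) = ⊤)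
    (hv : ∀ i j, i ≠ j → Function.Periodic (fwdDiff (v i) α) (v j))
    (hα : ∀ i x, ∃ σ > (0 : ℝ), fwdDiff (v i) α x = σ • n i) :
    ∃ g : A →+ E, ∀ i, ∃ κ > (0 : ℝ), g (v i) = κ • n i := by
  classical
  cases nonempty_fintype ι
  obtain ⟨κ, hκ, hrel⟩ := exists_forall_sum_smul_eq_zero hv hα
  let p := Fintype.linearCombination ℤ v
  let q := Fintype.linearCombination ℤ fun i => κ i • n i
  have hp : Function.Surjective p.toAddMonoidHom := by
    rw [← AddMonoidHom.range_eq_top, ← LinearMap.range_toAddSubgroup,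
      Fintype.range_linearCombination, Submodule.span_int_eq_addSubgroupClosure, hgen]
  let g := AddMonoidHom.liftOfSurjective p.toAddMonoidHom hp ⟨q.toAddMonoidHom, hrel⟩
  have hg : ∀ k, g (p k) = q k := AddMonoidHom.liftOfRightInverse_comp_apply _ _ _ _
  refine ⟨g, fun i => ⟨κ i, hκ i, ?_⟩⟩
  simpa [p, q, Fintype.linearCombination_apply_single] using hg (Pi.single i 1)

theorem periodic_fwdDiff_of_linearIndependent {v w : A} {n m : E}
    (hnm : LinearIndependent ℝ ![n, m]) (hv : ∀ x, ∃ σ : ℝ, fwdDiff v α x = σ • n)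
    (hw : ∀ x, ∃ τ : ℝ, fwdDiff w α x = τ • m) : Function.Periodic (fwdDiff v α) w := by
  intro x
  obtain ⟨σ, hσ⟩ := hv x
  obtain ⟨σ', hσ'⟩ := hv (x + w)
  obtain ⟨τ, hτ⟩ := hw x
  obtain ⟨τ', hτ'⟩ := hw (x + v)
  have hparallelogram : σ' • n + τ • m = σ • n + τ' • m := by
    rw [← hσ, ← hσ', ← hτ, ← hτ', fwdDiff, fwdDiff, fwdDiff, fwdDiff, add_right_comm x v w]
    abel
  rw [hσ, hσ', (hnm.eq_of_pair hparallelogram).1]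

end RealMixedDifferences

section FacetVectors

variable {E : Type*} [NormedAddCommGroup E] [InnerProductSpace ℝ E] {P : Set E}

theorem exists_forall_inner_ne_zero [FiniteDimensional ℝ E] {N : Set E} (hN : N.Finite)
    (h0 : (0 : E) ∉ N) : ∃ u : E, ∀ v ∈ N, ⟪u, v⟫ ≠ 0 := by
  have hdim : ∀ v ∈ N, finrank ℝ (vectorSpan ℝ ((ℝ ∙ v)ᗮ : Set E)) < finrank ℝ E := by
    intro v hv
    have hv0 : v ≠ 0 := ne_of_mem_of_not_mem hv h0
    have hspan : vectorSpan ℝ ((ℝ ∙ v)ᗮ : Set E) = (ℝ ∙ v)ᗮ := by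
      rw [vectorSpan_eq_span_vsub_set_right ℝ (zero_mem (ℝ ∙ v)ᗮ)]
      simp
    have hcompl := Submodule.finrank_add_finrank_orthogonal (ℝ ∙ v)
    rw [finrank_span_singleton hv0] at hcompl
    rw [hspan]
    lia
  obtain ⟨u, -, hu⟩ := exists_mem_forall_notMem_affineSpan hN.countable hdim isOpen_univ
    univ_nonempty
  refine ⟨u, fun v hv h => hu v hv (subset_affineSpan ℝ _ ?_)⟩
  exact Submodule.mem_orthogonal_singleton_iff_inner_left.2 h

namespace IsFacetVec

variable {v w n m : E}

theorem mem_closure (hv : IsFacetVec P v n) : v ∈ AddSubgroup.closure (facetVecs P) :=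
  AddSubgroup.subset_closure ⟨n, hv⟩

theorem linearIndependent (hb : Bornology.IsBounded P) (hv : IsFacetVec P v n)
    (hw : IsFacetVec P w m) (hne : w ≠ v) (hne_neg : w ≠ -v) : LinearIndependent ℝ ![n, m] := by
  refine (LinearIndependent.pair_iff' hv.normal.ne_zero).2 fun c hc => ?_
  have hc_abs : |c| = 1 := by
    have hnorm := congrArg norm hc
    rwa [norm_smul, hv.normal.1, hw.normal.1, mul_one] at hnorm
  rcases (abs_eq zero_le_one).1 hc_abs with rfl | rfl
  · rw [one_smul] at hc
    exact hne (hw.unique hb (hc ▸ hv))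
  · rw [neg_one_smul] at hc
    exact hne_neg (hw.unique hb (hc ▸ hv.neg))

theorem linearIndependent_of_inner_pos (hb : Bornology.IsBounded P) (hv : IsFacetVec P v n)
    (hw : IsFacetVec P w m) (hne : v ≠ w) {u : E} (huv : 0 < ⟪u, v⟫) (huw : 0 < ⟪u, w⟫) :
    LinearIndependent ℝ ![n, m] := by
  refine hv.linearIndependent hb hw hne.symm fun h => ?_
  rw [h, inner_neg_right] at huw
  linarith

end IsFacetVec

theorem closure_setOf_inner_pos {N : Set E} (hneg : ∀ v ∈ N, -v ∈ N) {u : E}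
    (hu : ∀ v ∈ N, ⟪u, v⟫ ≠ 0) :
    AddSubgroup.closure {v ∈ N | 0 < ⟪u, v⟫} = AddSubgroup.closure N := by
  refine le_antisymm (AddSubgroup.closure_mono (sep_subset _ _)) ?_
  rw [AddSubgroup.closure_le]
  intro v hv
  rcases (hu v hv).lt_or_gt with h | h
  · rw [SetLike.mem_coe, ← neg_mem_iff]
    exact AddSubgroup.subset_closure ⟨hneg v hv, by simpa using h⟩
  · exact AddSubgroup.subset_closure ⟨hv, h⟩

/-- Only one vector of each pair `±v` of facet vectors is used as a generator, since the increments
along `v` and `-v` are not independent. -/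
theorem exists_addMonoidHom_closure_facetVecs [FiniteDimensional ℝ E]
    (hb : Bornology.IsBounded P) (hi : (interior P).Nonempty) (hfin : (facetVecs P).Finite)
    {α : AddSubgroup.closure (facetVecs P) → E}
    (hα : ∀ v n (h : IsFacetVec P v n) t, ∃ σ > (0 : ℝ), fwdDiff ⟨v, h.mem_closure⟩ α t = σ • n) :
    ∃ g : AddSubgroup.closure (facetVecs P) →+ E, ∀ v n (h : IsFacetVec P v n),
      ∃ κ > (0 : ℝ), g ⟨v, h.mem_closure⟩ = κ • n := by
  obtain ⟨u, hu⟩ := exists_forall_inner_ne_zero hfin fun ⟨n, hn⟩ => by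
    simpa using hn.inner_pos hi
  let H : Set E := {v ∈ facetVecs P | 0 < ⟪u, v⟫}
  have : Finite H := hfin.subset (sep_subset _ _)
  choose n hn using fun v : H => v.2.1
  have hgen : AddSubgroup.closure (range fun v : H =>
      (⟨v, (hn v).mem_closure⟩ : AddSubgroup.closure (facetVecs P))) = ⊤ := by
    refine AddSubgroup.map_injective (AddSubgroup.subtype_injective _) ?_
    rw [AddMonoidHom.map_closure, ← range_comp, ← AddMonoidHom.range_eq_map,
      AddSubgroup.range_subtype]
    refine Eq.trans ?_
      (closure_setOf_inner_pos (N := facetVecs P) (fun v ⟨m, hm⟩ => ⟨-m, hm.neg⟩) hu)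
    exact congrArg _ Subtype.range_coe
  have hmixed (v w : H) (hvw : v ≠ w) : Function.Periodic
      (fwdDiff (⟨v, (hn v).mem_closure⟩ : AddSubgroup.closure (facetVecs P)) α)
      ⟨w, (hn w).mem_closure⟩ := by
    exact periodic_fwdDiff_of_linearIndependent
      ((hn v).linearIndependent_of_inner_pos hb (hn w) (Subtype.coe_ne_coe.2 hvw) v.2.2 w.2.2)
      (fun x => (hα v _ (hn v) x).imp fun _ => And.right)
      (fun x => (hα w _ (hn w) x).imp fun _ => And.right)
  obtain ⟨g, hg⟩ := exists_addMonoidHom_eq_pos_smul hgen hmixed fun v => hα v _ (hn v)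
  refine ⟨g, fun v m h => ?_⟩
  rcases (hu v ⟨m, h⟩).lt_or_gt with hneg | hpos
  · let w : H := ⟨-v, ⟨-m, h.neg⟩, by simpa using hneg⟩
    obtain ⟨κ, hκ, hgw⟩ := hg w
    have hmap : g ⟨v, h.mem_closure⟩ = -g ⟨w, (hn w).mem_closure⟩ := by
      rw [← map_neg]
      exact congrArg g (Subtype.ext (neg_neg v).symm)
    exact ⟨κ, hκ, by rw [hmap, hgw, h.neg.normal_unique hi (hn w), smul_neg, neg_neg]⟩
  · let w : H := ⟨v, ⟨m, h⟩, hpos⟩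
    obtain ⟨κ, hκ, hgw⟩ := hg w
    exact ⟨κ, hκ, hgw.trans (by rw [h.normal_unique hi (hn w)])⟩

end FacetVectors

/-! ### Lattices and positive maps -/

section Linear

variable {E : Type*} [NormedAddCommGroup E]

theorem exists_linearMap_forall_eq [NormedSpace ℝ E] [FiniteDimensional ℝ E] {F : Type*}
    [AddCommGroup F] [Module ℝ F] (Λ : Submodule ℤ E) [DiscreteTopology Λ] [IsZLattice ℝ Λ]
    (g : Λ →+ F) : ∃ A : E →ₗ[ℝ] F, ∀ v : Λ, A v = g v := by
  have := ZLattice.module_free ℝ Λ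
  have := ZLattice.module_finite ℝ Λ
  let b := Module.Free.chooseBasis ℤ Λ
  let A := (b.ofZLatticeBasis ℝ Λ).constr ℝ fun i => g (b i)
  have hA : A.restrictScalars ℤ ∘ₗ Λ.subtype = g.toIntLinearMap := b.ext fun i => by
    have hAb := (b.ofZLatticeBasis ℝ Λ).constr_basis ℝ (fun i => g (b i)) i
    rwa [b.ofZLatticeBasis_apply ℝ Λ] at hAb
  exact ⟨A, LinearMap.congr_fun hA⟩

variable [InnerProductSpace ℝ E] {A : E →ₗ[ℝ] E}

theorem isSymmetric_of_span_eq_top {S : Set E} (hS : Submodule.span ℝ S = ⊤)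
    (h : ∀ v ∈ S, ∀ w ∈ S, ⟪A v, w⟫ = ⟪v, A w⟫) : A.IsSymmetric := by
  have hbilin : (innerₛₗ ℝ).comp A = (innerₛₗ ℝ).compl₂ A :=
    LinearMap.ext_on hS fun v hv => LinearMap.ext_on hS fun w hw => h v hv w hw
  exact fun x y => LinearMap.congr_fun (LinearMap.congr_fun hbilin x) y

theorem exists_inner_map_map_eq [FiniteDimensional ℝ E] (hA : A.IsPositive) :
    ∃ B : E →ₗ[ℝ] E, ∀ x y, ⟪B x, B y⟫ = ⟪A x, y⟫ := by
  let b := hA.isSymmetric.eigenvectorBasis rfl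
  let eigenvalue := hA.isSymmetric.eigenvalues rfl
  have hnonneg (i) : 0 ≤ eigenvalue i := hA.nonneg_eigenvalues rfl i
  let B : E →ₗ[ℝ] E := b.toBasis.constr ℝ fun i => √(eigenvalue i) • b i
  have hB (i) : B (b i) = √(eigenvalue i) • b i := by
    have := b.toBasis.constr_basis ℝ (fun i => √(eigenvalue i) • b i) i
    rwa [b.coe_toBasis] at this
  have hAb (i) : A (b i) = eigenvalue i • b i := hA.isSymmetric.apply_eigenvectorBasis rfl i
  have hbilin : (innerₛₗ ℝ).compl₁₂ B B = (innerₛₗ ℝ).comp A := by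
    refine b.toBasis.ext fun i => b.toBasis.ext fun j => ?_
    change ⟪B (b.toBasis i), B (b.toBasis j)⟫ = ⟪A (b.toBasis i), b.toBasis j⟫
    simp only [b.coe_toBasis, hB, hAb, real_inner_smul_left, real_inner_smul_right]
    obtain rfl | hij := eq_or_ne i j
    · rw [← mul_assoc, Real.mul_self_sqrt (hnonneg i)]
    · rw [b.orthonormal.2 hij, mul_zero, mul_zero, mul_zero]
  exact ⟨B, fun x y => LinearMap.congr_fun (LinearMap.congr_fun hbilin x) y⟩

end Linear

section Lattice

variable {E : Type*} [NormedAddCommGroup E] [InnerProductSpace ℝ E] {P : Set E}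

/-- The group generated by the facet vectors of `P`: the translation lattice of a tiling by
translates of `P` that contains `P`. It is a `ℤ`-submodule, as the `ZLattice` library requires. -/
abbrev facetLattice (P : Set E) : Submodule ℤ E :=
  AddSubgroup.toIntSubmodule (AddSubgroup.closure (facetVecs P))

variable [FiniteDimensional ℝ E] {T : Set (Set E)}

namespace IsTranslateTiling

theorem discreteTopology_facetLattice (hT : IsTranslateTiling P T) (hPT : P ∈ T) :
    DiscreteTopology (facetLattice P) := by
  obtain ⟨p, hp⟩ := hT.interior_body
  obtain ⟨ρ, hρ, hball⟩ := Metric.isOpen_iff.1 isOpen_interior p hp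
  refine DiscreteTopology.of_forall_le_dist hρ fun x y hxy => ?_
  by_contra! hlt
  refine hxy (sub_eq_zero.1 (Subtype.ext ?_))
  refine hT.eq_zero_of_mem_interior_of_sub_mem hPT (x - y).2 hp (interior_subset (hball ?_))
  rwa [Metric.mem_ball, dist_eq_norm, sub_sub_cancel_left, norm_neg, Submodule.coe_sub,
    ← dist_eq_norm, ← Subtype.dist_eq]

theorem exists_tendsto_inv_smul (hT : IsTranslateTiling P T) (hPT : P ∈ T) (x : E) :
    ∃ v : ℕ → E, (∀ k, v k ∈ AddSubgroup.closure (facetVecs P)) ∧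
      Tendsto (fun k : ℕ => (k : ℝ)⁻¹ • v k) atTop (𝓝 x) := by
  choose v hv hvP using fun k : ℕ => hT.exists_sub_mem hPT ((k : ℝ) • x)
  refine ⟨v, hv, ?_⟩
  obtain ⟨D, hD⟩ := hT.compact_body.isBounded.exists_norm_le
  have herror : Tendsto (fun k : ℕ => (k : ℝ)⁻¹ • ((k : ℝ) • x - v k)) atTop (𝓝 0) :=
    tendsto_inv_atTop_nhds_zero_nat.zero_smul_isBoundedUnder_le
      (isBoundedUnder_of ⟨D, fun k => hD _ (hvP k)⟩)
  have hlim := (tendsto_const_nhds (x := x)).sub herror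
  rw [sub_zero] at hlim
  refine hlim.congr' ?_
  filter_upwards [eventually_ne_atTop 0] with k hk
  rw [smul_sub, inv_smul_smul₀ (Nat.cast_ne_zero.2 hk), sub_sub_cancel]

theorem span_facetLattice (hT : IsTranslateTiling P T) (hPT : P ∈ T) :
    Submodule.span ℝ (facetLattice P : Set E) = ⊤ := by
  refine Submodule.eq_top_iff'.2 fun x => ?_
  obtain ⟨v, hv, hlim⟩ := hT.exists_tendsto_inv_smul hPT x
  exact (Submodule.closed_of_finiteDimensional _).mem_of_tendsto hlim <| .of_forall fun k =>
    Submodule.smul_mem _ _ (Submodule.subset_span (hv k))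

theorem isZLattice_facetLattice (hT : IsTranslateTiling P T) (hPT : P ∈ T)
    [DiscreteTopology (facetLattice P)] : IsZLattice ℝ (facetLattice P) :=
  ⟨hT.span_facetLattice hPT⟩

end IsTranslateTiling

end Lattice

/-! ### The generatrix -/

section Generatrix

variable {E : Type*} [NormedAddCommGroup E] [InnerProductSpace ℝ E] {P : Set E} {A : E →ₗ[ℝ] E}

/-- `b t` is the height of the affine piece over `t +ᵥ P` of a piecewise affine function that is
continuous across facets and has the gradient `A t` there: that piece is `x ↦ ⟪A t, x⟫ - b t`. -/
structure IsHeight (P : Set E) (A : E →ₗ[ℝ] E) (b : E → ℝ) : Prop where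
  apply_zero : b 0 = 0
  apply_add_sub : ∀ t ∈ AddSubgroup.closure (facetVecs P), ∀ v n, IsFacetVec P v n →
    ∀ z ∈ P ∩ (v +ᵥ P), b (t + v) - b t = ⟪A v, t + z⟫

namespace IsHeight

variable {b : E → ℝ} {v w t n z : E}

theorem apply_facetVec (hb : IsHeight P A b) (hv : IsFacetVec P v n) (hz : z ∈ P ∩ (v +ᵥ P)) :
    b v = ⟪A v, z⟫ := by
  have := hb.apply_add_sub 0 (zero_mem _) v n hv z hz
  rwa [zero_add, zero_add, hb.apply_zero, sub_zero] at this

theorem apply_add (hb : IsHeight P A b) (hw : w ∈ AddSubgroup.closure (facetVecs P))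
    (ht : t ∈ AddSubgroup.closure (facetVecs P)) : b (t + w) = b t + b w + ⟪A w, t⟫ := by
  induction hw using AddSubgroup.closure_induction generalizing t with
  | mem v hv =>
    obtain ⟨n, hv⟩ := hv
    obtain ⟨z, hz⟩ := hv.codim.1
    have hjump := hb.apply_add_sub t ht v n hv z hz
    rw [inner_add_right, ← hb.apply_facetVec hv hz] at hjump
    linarith
  | zero => simp [hb.apply_zero]
  | add w w' hw _ ih ih' =>
    rw [← add_assoc, ih' (add_mem ht hw), ih ht, ih' hw, map_add, inner_add_left, inner_add_right]
    ring
  | neg w hw ih =>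
    have hshift := ih (add_mem ht (neg_mem hw))
    have hcancel := ih (neg_mem hw)
    rw [neg_add_cancel_right, inner_add_right] at hshift
    rw [neg_add_cancel, hb.apply_zero] at hcancel
    rw [map_neg, inner_neg_left]
    linarith

theorem inner_map_eq_inner_map (hb : IsHeight P A b)
    (hv : v ∈ AddSubgroup.closure (facetVecs P)) (hw : w ∈ AddSubgroup.closure (facetVecs P)) :
    ⟪A v, w⟫ = ⟪v, A w⟫ := by
  have hwv := hb.apply_add hv hw
  have hvw := hb.apply_add hw hv
  rw [add_comm v w, real_inner_comm] at hvw
  linarith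

/-- The height is a quadratic function on the lattice; `c` represents its linear part. -/
theorem exists_forall_two_mul_inner_eq [FiniteDimensional ℝ E] (hb : IsHeight P A b)
    [DiscreteTopology (facetLattice P)] [IsZLattice ℝ (facetLattice P)] :
    ∃ c, ∀ v n, IsFacetVec P v n → ∀ z ∈ P ∩ (v +ᵥ P), 2 * ⟪A v, z⟫ = ⟪A v, v⟫ + 2 * ⟪c, v⟫ := by
  let linearPart : facetLattice P →+ ℝ :=
    AddMonoidHom.mk' (fun w => b w - ⟪A w, w⟫ / 2) fun v w => by
      have hsymm := hb.inner_map_eq_inner_map v.2 w.2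
      rw [real_inner_comm (A w) (v : E)] at hsymm
      rw [Submodule.coe_add, hb.apply_add w.2 v.2, map_add, inner_add_left, inner_add_right,
        inner_add_right]
      linarith
  obtain ⟨φ, hφ⟩ := exists_linearMap_forall_eq (facetLattice P) linearPart
  refine ⟨(InnerProductSpace.toDual ℝ E).symm (LinearMap.toContinuousLinearMap φ),
    fun v n hv z hz => ?_⟩
  have hφv : φ v = b v - ⟪A v, v⟫ / 2 := hφ ⟨v, hv.mem_closure⟩
  rw [InnerProductSpace.toDual_symm_apply, LinearMap.coe_toContinuousLinearMap', hφv,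
    hb.apply_facetVec hv hz]
  ring

end IsHeight

theorem IsNormalMap.inner_map_le_of_reflTransGen {T : Set (Set E)} (hA : IsNormalMap P A)
    {tr : Set E → E} (htr : ∀ Q ∈ T, Q = tr Q +ᵥ P) {Q R : Set E} {u : E}
    (h : Relation.ReflTransGen (CrossesFacet T u) Q R) : ⟪A (tr Q), u⟫ ≤ ⟪A (tr R), u⟫ := by
  induction h with
  | refl => rfl
  | tail _ hcross ih =>
    obtain ⟨hS, hS', hc, n, hn, hn', hnu⟩ := hcross
    obtain ⟨κ, hκ, hAκ⟩ := hA _ n (.of_eq_vadd (htr _ hS) (htr _ hS') hc hn hn')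
    refine ih.trans ?_
    rw [← sub_nonneg, ← inner_sub_left, ← map_sub, hAκ, real_inner_smul_left]
    exact mul_nonneg hκ.le hnu

variable [FiniteDimensional ℝ E] {T : Set (Set E)}

namespace IsNormalMap

theorem exists_isHeight (hA : IsNormalMap P A) (hT : IsTranslateTiling P T) (hPT : P ∈ T) :
    ∃ b, IsHeight P A b := by
  obtain ⟨tr, htr, htr_vadd⟩ := hT.exists_translation
  have hpoint (F : Set E) : ∃ x, F.Nonempty → x ∈ F := by
    by_cases h : F.Nonempty
    exacts [⟨h.some, fun _ => h.some_mem⟩, ⟨0, fun h' => absurd h' h⟩]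
  choose point hpoint using hpoint
  let jump (Q R : Set E) : ℝ := ⟪A (tr R - tr Q), point (Q ∩ R)⟫
  have hjump : ∀ Q ∈ T, ∀ R ∈ T, HasCodim 1 (Q ∩ R) → ∀ g ∈ Q ∩ R,
      jump Q R = ⟪A (tr R - tr Q), g⟫ := by
    intro Q hQ R hR hc g hg
    obtain ⟨n, hn, hn'⟩ := hT.exists_isFacetNormal_inter hQ hR hc
    obtain ⟨κ, -, hAκ⟩ := hA _ n (.of_eq_vadd (htr Q hQ) (htr R hR) hc hn hn')
    simp only [jump, hAκ, real_inner_smul_left, hn.inner_eq (hpoint _ hc.1) hg]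
  obtain ⟨a, ha⟩ := hT.exists_potential_of_forall_isRidge (c := jump)
    (fun Q _ R _ _ => by
      simp only [jump]
      rw [← neg_sub (tr R), map_neg, inner_neg_left, inter_comm])
    (fun G hG => by
      obtain ⟨g, hg⟩ := hG.codim.1
      refine ⟨fun Q => ⟪A (tr Q), g⟫, fun Q hQ R hR hc => ?_⟩
      rw [hjump Q hQ.1 R hR.1 hc g ⟨hQ.2 hg, hR.2 hg⟩, map_sub, inner_sub_left])
  refine ⟨fun t => a (t +ᵥ P) - a P, by rw [zero_vadd, sub_self], fun t ht v n hv z hz => ?_⟩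
  have hQ := (hT.vadd_mem_iff hPT t).2 ht
  have hR := hT.vadd_add_mem hQ hv
  have hc := (hv.vadd t).1
  have hmem : t + z ∈ (t +ᵥ P) ∩ ((t + v) +ᵥ P) := by
    rw [vadd_inter_vadd, add_sub_cancel_left]
    exact vadd_mem_vadd_set hz
  rw [sub_sub_sub_cancel_right, ha _ hQ _ hR hc, hjump _ hQ _ hR hc _ hmem, htr_vadd _ hQ,
    htr_vadd _ hR, add_sub_cancel_left]

theorem isSymmetric (hA : IsNormalMap P A) (hT : IsTranslateTiling P T) (hPT : P ∈ T) :
    A.IsSymmetric := by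
  obtain ⟨b, hb⟩ := hA.exists_isHeight hT hPT
  exact isSymmetric_of_span_eq_top (hT.span_facetLattice hPT) fun v hv w hw =>
    hb.inner_map_eq_inner_map hv hw

/-- The gradient of the generatrix is monotone along a line, because every facet crossing adds to
it a positive multiple of the facet normal. -/
theorem inner_map_self_nonneg_of_mem_closure (hA : IsNormalMap P A)
    (hT : IsTranslateTiling P T) (hPT : P ∈ T) {t : E}
    (ht : t ∈ AddSubgroup.closure (facetVecs P)) : 0 ≤ ⟪A t, t⟫ := by
  obtain ⟨tr, htr, htr_vadd⟩ := hT.exists_translation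
  have htT := (hT.vadd_mem_iff hPT t).2 ht
  obtain ⟨p, hp⟩ := hT.interior_body
  by_contra! hneg
  have hopen : IsOpen {z : E × E | ⟪A t, z.2 - z.1⟫ < 0} :=
    isOpen_lt (by fun_prop) continuous_const
  obtain ⟨U, V, hU, hV, hpU, hpV, hUV⟩ := isOpen_prod_iff.1 hopen p (t + p)
    (by rwa [mem_ofPred_eq, add_sub_cancel_right])
  obtain ⟨x, hx, y, hy, hpath⟩ := hT.exists_reflTransGen_crossesFacet hPT htT
    (hU.inter isOpen_interior) ⟨p, hpU, hp⟩ inter_subset_right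
    (hV.inter isOpen_interior) ⟨t + p, hpV, interior_vadd t P ▸ vadd_mem_vadd_set hp⟩
    inter_subset_right
  have hmono := hA.inner_map_le_of_reflTransGen htr hpath
  have htrP : tr P = 0 := by
    simpa only [zero_vadd] using htr_vadd 0 (by rwa [zero_vadd])
  rw [htr_vadd t htT, htrP, map_zero, inner_zero_left] at hmono
  exact hmono.not_gt (hUV (show (x, y) ∈ U ×ˢ V from ⟨hx.1, hy.1⟩))

theorem isPositive (hA : IsNormalMap P A) (hT : IsTranslateTiling P T) (hPT : P ∈ T) :
    A.IsPositive := by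
  refine (LinearMap.isPositive_iff A).2 ⟨hA.isSymmetric hT hPT, fun x => ?_⟩
  obtain ⟨v, hv, hlim⟩ := hT.exists_tendsto_inv_smul hPT x
  have hcont : Continuous fun z => ⟪A z, z⟫ :=
    A.continuous_of_finiteDimensional.inner continuous_id
  refine ge_of_tendsto' ((hcont.tendsto x).comp hlim) fun k => ?_
  have hnonneg := hA.inner_map_self_nonneg_of_mem_closure hT hPT (hv k)
  simp only [Function.comp_apply, map_smul, real_inner_smul_left, real_inner_smul_right]
  positivity

theorem injective (hA : IsNormalMap P A) (hT : IsTranslateTiling P T) (hPT : P ∈ T) :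
    Function.Injective A := by
  refine (injective_iff_map_eq_zero A).2 fun x hx => ?_
  refine eq_zero_of_forall_add_mem hT.compact_body.isBounded hT.nonempty_body fun y hy => ?_
  by_contra hxy
  obtain ⟨v, n, hv, hsep⟩ := hT.exists_isFacetVec_inner_lt_of_notMem hPT hxy
  obtain ⟨κ, hκ, hAκ⟩ := hA v n hv
  obtain ⟨z, hz⟩ := hv.codim.1
  have hnx : ⟪n, x⟫ = 0 := by
    have hAvx := hA.isSymmetric hT hPT v x
    rw [hx, inner_zero_right, hAκ, real_inner_smul_left] at hAvx
    exact (mul_eq_zero.1 hAvx).resolve_left hκ.ne'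
  have hlt := hsep z hz
  rw [inner_add_right, hnx, add_zero] at hlt
  exact hlt.not_ge (hv.normal.inner_le hy hz)

/-- In the metric given by `A`, the facets of `P` bisect the facet vectors issuing from `c`. -/
theorem exists_center (hA : IsNormalMap P A) (hT : IsTranslateTiling P T) (hPT : P ∈ T) :
    ∃ c, ∀ v n, IsFacetVec P v n → ∀ z ∈ P ∩ (v +ᵥ P), 2 * ⟪A v, z - c⟫ = ⟪A v, v⟫ := by
  have := hT.discreteTopology_facetLattice hPT
  have := hT.isZLattice_facetLattice hPT
  obtain ⟨b, hb⟩ := hA.exists_isHeight hT hPT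
  obtain ⟨c', hc'⟩ := hb.exists_forall_two_mul_inner_eq
  obtain ⟨c, rfl⟩ := LinearMap.surjective_of_injective (hA.injective hT hPT) c'
  refine ⟨c, fun v n hv z hz => ?_⟩
  rw [inner_sub_right, mul_sub, hc' v n hv z hz, hA.isSymmetric hT hPT v c,
    real_inner_comm v (A c), add_sub_cancel_right]

end IsNormalMap

end Generatrix

/-! ### The Dirichlet domain of a canonical scaling -/

section TranslatedBody

variable {E : Type*} [NormedAddCommGroup E] [NormedSpace ℝ E] {P : Set E} {T : Set (Set E)}

namespace IsTranslateTiling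

theorem vadd (hT : IsTranslateTiling P T) (t : E) : IsTranslateTiling (t +ᵥ P) T where
  toIsFaceTiling := hT.toIsFaceTiling
  convex_body := hT.convex_body.vadd t
  compact_body := hT.compact_body.vadd t
  interior_body := by
    rw [interior_vadd]
    exact hT.interior_body.vadd_set
  translate Q hQ := by
    obtain ⟨u, rfl⟩ := hT.translate Q hQ
    exact ⟨u - t, by rw [vadd_vadd, sub_add_cancel]⟩

theorem subset_of_interior_subset (hT : IsTranslateTiling P T) {C : Set E} (hC : IsClosed C)
    (h : interior P ⊆ C) : P ⊆ C := by
  have hP : closure (interior P) = P := by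
    rw [hT.convex_body.closure_interior_eq_closure_of_nonempty_interior hT.interior_body,
      hT.compact_body.isClosed.closure_eq]
  exact hP ▸ closure_minimal h hC

end IsTranslateTiling

end TranslatedBody

section DirichletDomain

variable {E : Type*} [NormedAddCommGroup E] [InnerProductSpace ℝ E] [FiniteDimensional ℝ E]
  {P : Set E} {T : Set (Set E)}

namespace IsTranslateTiling

/-- The cells of `Λ` also tile, so no room is left in `P` outside the cell it contains. -/
theorem subset_preimage_dirichletCell (hT : IsTranslateTiling P T) (hPT : P ∈ T) {W : Type*}
    [NormedAddCommGroup W] [NormedSpace ℝ W] [FiniteDimensional ℝ W] {Λ : AddSubgroup W}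
    [DiscreteTopology Λ] {p : W} (f : E ≃ᵃ[ℝ] W) (hp : p ∈ Λ)
    (hΛ : ∀ w, f.linear w ∈ Λ → w ∈ AddSubgroup.closure (facetVecs P))
    (h : f ⁻¹' dirichletCell Λ p ⊆ P) : P ⊆ f ⁻¹' dirichletCell Λ p := by
  have : ProperSpace W := FiniteDimensional.proper_real W
  have hf : Continuous f := f.toAffineMap.continuous_of_finiteDimensional
  refine hT.subset_of_interior_subset (isClosed_dirichletCell.preimage hf) fun x hx => ?_
  obtain ⟨m, hm, hxm⟩ := exists_sub_mem_dirichletCell hp (f x)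
  obtain ⟨w, rfl⟩ := f.linear.surjective m
  rw [← affineEquiv_apply_sub] at hxm
  have hw := hT.eq_zero_of_mem_interior_of_sub_mem hPT (hΛ w hm) hx (h hxm)
  rwa [hw, sub_zero] at hxm

theorem exists_isNormalMap (hT : IsTranslateTiling P T) (hPT : P ∈ T) {s : Set E → ℝ}
    (hs : IsCanonical T s) : ∃ A : E →ₗ[ℝ] E, IsNormalMap P A := by
  obtain ⟨a, ha⟩ := hT.exists_isGradient hs
  obtain ⟨g, hg⟩ := exists_addMonoidHom_closure_facetVecs hT.compact_body.isBounded
    hT.interior_body (hT.finite_facetVecs hPT) (α := fun t => a ((t : E) +ᵥ P))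
    fun v n hv t => by
      have hQ := (hT.vadd_mem_iff hPT t).2 t.2
      obtain ⟨hc, hn, hn'⟩ := hv.vadd (t : E)
      exact ⟨_, hs.pos _ hc ⟨_, hQ, hn.isExposed⟩,
        ha _ hQ _ (hT.vadd_add_mem hQ hv) n hc hn hn'⟩
  have := hT.discreteTopology_facetLattice hPT
  have := hT.isZLattice_facetLattice hPT
  obtain ⟨A, hA⟩ := exists_linearMap_forall_eq (facetLattice P) g
  refine ⟨A, fun v n hv => ?_⟩
  obtain ⟨κ, hκ, hgκ⟩ := hg v n hv
  exact ⟨κ, hκ, (hA ⟨v, hv.mem_closure⟩).trans hgκ⟩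

end IsTranslateTiling

namespace IsNormalMap

variable {A : E →ₗ[ℝ] E}

theorem exists_linearEquiv_inner_eq (hA : IsNormalMap P A) (hT : IsTranslateTiling P T)
    (hPT : P ∈ T) : ∃ L : E ≃ₗ[ℝ] E, ∀ x y, ⟪L x, L y⟫ = ⟪A x, y⟫ := by
  obtain ⟨B, hB⟩ := exists_inner_map_map_eq (hA.isPositive hT hPT)
  have hB_inj : Function.Injective B := (injective_iff_map_eq_zero B).2 fun x hx => by
    refine (injective_iff_map_eq_zero A).1 (hA.injective hT hPT) x ?_
    rw [← inner_self_eq_zero (𝕜 := ℝ), ← hB, hx, inner_zero_left]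
  exact ⟨.ofInjectiveEndo B hB_inj, hB⟩

theorem mem_of_forall_two_mul_inner_le (hA : IsNormalMap P A) (hT : IsTranslateTiling P T)
    (hPT : P ∈ T) {c x : E}
    (hc : ∀ v n, IsFacetVec P v n → ∀ z ∈ P ∩ (v +ᵥ P), 2 * ⟪A v, z - c⟫ = ⟪A v, v⟫)
    (hx : ∀ v ∈ facetVecs P, 2 * ⟪A v, x - c⟫ ≤ ⟪A v, v⟫) : x ∈ P := by
  by_contra hxP
  obtain ⟨v, n, hv, hsep⟩ := hT.exists_isFacetVec_inner_lt_of_notMem hPT hxP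
  obtain ⟨κ, hκ, hAκ⟩ := hA v n hv
  obtain ⟨z, hz⟩ := hv.codim.1
  have hlt : ⟪A v, z⟫ < ⟪A v, x⟫ := by
    rw [hAκ, real_inner_smul_left, real_inner_smul_left]
    exact mul_lt_mul_of_pos_left (hsep z hz) hκ
  have hle := hx v ⟨n, hv⟩
  rw [← hc v n hv z hz, inner_sub_right, inner_sub_right] at hle
  linarith

theorem exists_eq_preimage_dirichletCell (hA : IsNormalMap P A) (hT : IsTranslateTiling P T)
    (hPT : P ∈ T) : ∃ (f : E ≃ᵃ[ℝ] E) (Λ : Submodule ℤ E) (_ : DiscreteTopology Λ),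
      IsZLattice ℝ Λ ∧ P = f ⁻¹' dirichletCell Λ.toAddSubgroup 0 := by
  have := hT.discreteTopology_facetLattice hPT
  have := hT.isZLattice_facetLattice hPT
  obtain ⟨c, hc⟩ := hA.exists_center hT hPT
  obtain ⟨L, hL⟩ := hA.exists_linearEquiv_inner_eq hT hPT
  let Λ := ZLattice.comap ℝ (facetLattice P) L.toContinuousLinearEquiv.symm.toLinearMap
  have hΛ (w : E) : L w ∈ Λ ↔ w ∈ AddSubgroup.closure (facetVecs P) := by
    change L.symm (L w) ∈ facetLattice P ↔ _
    rw [L.symm_apply_apply]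
    rfl
  have : DiscreteTopology Λ.toAddSubgroup := inferInstanceAs (DiscreteTopology Λ)
  let f : E ≃ᵃ[ℝ] E := (AffineEquiv.constVAdd ℝ E (-c)).trans L.toAffineEquiv
  have hf (x : E) : f x = L (x - c) := congrArg L (neg_add_eq_sub c x)
  have hcell : f ⁻¹' dirichletCell Λ.toAddSubgroup 0 ⊆ P := fun x hx =>
    hA.mem_of_forall_two_mul_inner_le hT hPT hc fun v hv => by
      have hLv := two_mul_inner_le_of_mem_dirichletCell hx (zero_mem _)
        ((hΛ v).2 (AddSubgroup.subset_closure hv))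
      rwa [sub_zero, hf, hL, ← real_inner_self_eq_norm_sq, hL] at hLv
  exact ⟨f, Λ, inferInstance, inferInstance,
    (hT.subset_preimage_dirichletCell hPT f (zero_mem _) (fun w => (hΛ w).1) hcell).antisymm hcell⟩

end IsNormalMap

theorem IsTranslateTiling.exists_eq_preimage_dirichletCell (hT : IsTranslateTiling P T)
    {s : Set E → ℝ} (hs : IsCanonical T s) :
    ∃ (f : E ≃ᵃ[ℝ] E) (Λ : Submodule ℤ E) (_ : DiscreteTopology Λ),
      IsZLattice ℝ Λ ∧ P = f ⁻¹' dirichletCell Λ.toAddSubgroup 0 := by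
  obtain ⟨Q, hQ, -⟩ := hT.cover 0
  obtain ⟨t, rfl⟩ := hT.translate Q hQ
  obtain ⟨A, hA⟩ := (hT.vadd t).exists_isNormalMap hQ hs
  obtain ⟨f, Λ, hdiscrete, hΛ, htP⟩ := hA.exists_eq_preimage_dirichletCell (hT.vadd t) hQ
  refine ⟨(AffineEquiv.constVAdd ℝ E t).trans f, Λ, hdiscrete, hΛ, ?_⟩
  rw [AffineEquiv.coe_trans, preimage_comp, ← htP]
  exact (preimage_image_eq P (AffineEquiv.constVAdd ℝ E t).injective).symm

end DirichletDomain

/-! ### Tilings and scalings of Euclidean space -/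

section EuclideanSpace

variable {d : ℕ} {P : Set (EuclideanSpace ℝ (Fin d))} {T : Set (Set (EuclideanSpace ℝ (Fin d)))}

theorem isTilingFace_iff {k : ℕ} {F : Set (EuclideanSpace ℝ (Fin d))} :
    IsTilingFace T k F ↔ HasCodim k F ∧ ∃ Q ∈ T, IsExposed ℝ Q F := by
  unfold IsTilingFace HasCodim
  rw [finrank_euclideanSpace_fin]
  tauto

theorem facetsAround_eq_facetsAt (T : Set (Set (EuclideanSpace ℝ (Fin d))))
    (G : Set (EuclideanSpace ℝ (Fin d))) : facetsAround T G = facetsAt T G := by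
  ext F
  change IsTilingFace T 1 F ∧ G ⊆ F ↔ _ ∧ _ ∧ _
  rw [isTilingFace_iff, and_assoc]

theorem areCoherentNormals_iff {G : Set (EuclideanSpace ℝ (Fin d))}
    {n : Set (EuclideanSpace ℝ (Fin d)) → EuclideanSpace ℝ (Fin d)} :
    AreCoherentNormals T G n ↔ ∃ ω, ω ≠ 0 ∧ IsCoherent T G ω n := by
  unfold AreCoherentNormals
  simp only [facetsAround_eq_facetsAt]
  refine exists_congr fun ω => and_congr_right fun _ => ⟨?_, ?_⟩
  · rintro ⟨alt, ker, h⟩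
    exact ⟨alt, ker, fun F hF => (h F hF).1,
      fun F hF v hv => (real_inner_comm _ _).trans ((h F hF).2.1 v hv), fun F hF => (h F hF).2.2⟩
  · intro h
    exact ⟨h.alt, h.ker, fun F hF => ⟨h.norm F hF,
      fun v hv => (real_inner_comm _ _).trans (h.orth F hF v hv), h.pos F hF⟩⟩

theorem isCanonicalScaling_iff {s : Set (EuclideanSpace ℝ (Fin d)) → ℝ} :
    IsCanonicalScaling T s ↔ IsCanonical T s := by
  unfold IsCanonicalScaling torsion
  simp only [facetsAround_eq_facetsAt, areCoherentNormals_iff, isTilingFace_iff]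
  exact ⟨fun h => ⟨fun F hF hexp => h.1 F ⟨hF, hexp⟩,
      fun G hG ω n hω hn => h.2 G ⟨hG.codim, hG.exposed⟩ n ⟨ω, hω, hn⟩⟩,
    fun h => ⟨fun F hF => h.pos F hF.1 hF.2,
      fun G hG n ⟨ω, hω, hn⟩ => h.torsion_eq_zero G ⟨hG.1, hG.2⟩ ω n hω hn⟩⟩

theorem isTranslateTiling_of_isNormalTranslateTiling (hP : IsFullDimPolytope P)
    (hT : IsNormalTranslateTiling P T) : IsTranslateTiling P T := by
  obtain ⟨⟨V, hV, rfl⟩, hinterior⟩ := hP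
  exact .of_forall_eq_vadd (convex_convexHull ℝ V) (hV.isCompact_convexHull ℝ) hinterior
    hT.translate hT.cover hT.disjoint fun Q hQ R hR => (hT.face_to_face Q hQ R hR).1

end EuclideanSpace

end Parallelohedron

theorem mainTheorem1_general {E : Type*} [NormedAddCommGroup E] [InnerProductSpace ℝ E]
    [FiniteDimensional ℝ E] {P : Set E} {T : Set (Set E)}
    (hT : Parallelohedron.IsTranslateTiling P T) :
    (∃ (f : E ≃ᵃ[ℝ] E) (Λ : Submodule ℤ E) (_ : DiscreteTopology Λ), IsZLattice ℝ Λ ∧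
      ∃ p ∈ Λ, f '' P = Parallelohedron.dirichletCell Λ.toAddSubgroup p) ↔
      ∃ s, Parallelohedron.IsCanonical T s := by
  constructor
  · rintro ⟨f, Λ, hdiscrete, -, p, hp, hfP⟩
    have : DiscreteTopology Λ.toAddSubgroup := hdiscrete
    exact hT.exists_isCanonical_of_eq_preimage_dirichletCell f hp <|
      hfP ▸ (Set.preimage_image_eq P f.injective).symm
  · rintro ⟨s, hs⟩
    obtain ⟨f, Λ, hdiscrete, hΛ, hP⟩ := hT.exists_eq_preimage_dirichletCell hs
    exact ⟨f, Λ, hdiscrete, hΛ, 0, zero_mem Λ, hP ▸ Set.image_preimage_eq _ f.surjective⟩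

theorem mainTheorem1 (d : ℕ) (P : Set (EuclideanSpace ℝ (Fin d))) (hP : IsParallelohedron P)
    (T : Set (Set (EuclideanSpace ℝ (Fin d)))) (hT : IsNormalTranslateTiling P T) :
    VoronoiConjectureHoldsFor P ↔
      ∃ s : Set (EuclideanSpace ℝ (Fin d)) → ℝ, IsCanonicalScaling T s := by
  simp only [Parallelohedron.isCanonicalScaling_iff]
  exact mainTheorem1_general (Parallelohedron.isTranslateTiling_of_isNormalTranslateTiling hP.1 hT)
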